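/- **Setting.** All functions are smooth and real. Let $\Omega\subseteq\mathbb R^3$ (coordinates $(t,x,u)$) be open and let $A$ be a finite-dimensional real vector space of vector fields on $\Omega$. $A$ is *abelian* if its elements commute on $\Omega$. $A$ is *admissible* on $\Omega$ if every $Q\in A$ has the form $Q=a(t)\partial_t+b(t,x,u)\partial_x+c(t,x,u)\partial_u$ and there is an equation $$u_t=F(t,x,u,u_1,u_2)\,u_3+G(t,x,u,u_1,u_2)\qquad(u_i=\partial_x^i u),$$ with $F,G$ smooth and $F$ nowhere zero on an open set $D$ of points $(t,x,u,u_1,u_2)$ whose projection to $(t,x,u)$ is $\Omega$, such that every $Q\in A$ is an infinitesimal symmetry of it, i.e. the third prolongation of $Q$ annihilates $\Delta=u_t-Fu_3-G$ at all points over $D$ where $\Delta=0$. The *rank* of $A$ on $\Omega$ is the smallest positive integer $r$ such that all $(r+1)$-fold wedge products of elements of $A$ vanish identically on $\Omega$. Two algebras, $A$ on $V$ and $B$ on $W$ ($V,W$ open), are *equivalent* if an invertible smooth transformation of $V$ onto $W$ of the form $t'=T(t)$, $x'=X(t,x,u)$, $u'=U(t,x,u)$, with smooth inverse of the same form, carries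 $A$ onto $B$. **The list.** On a nonempty open set $W$, consider the following types of algebras; the functions $c,q_i,f$ are smooth on the projection of $W$ to $(t,x)$ (to $x$ in type 9), and the stated conditions hold at every point of that projection. * $\dim A=1$: (1) $\langle\partial_t\rangle$; (2) $\langle\partial_u\rangle$. * $\dim A=2$: (3) $\langle\partial_t,\partial_u\rangle$; (4) $\langle\partial_x,\partial_u\rangle$; (5) $\langle\partial_u,x\partial_u\rangle$. * $\dim A=3$: (6) $\langle\partial_t,\partial_x,\partial_u\rangle$; (7) $\langle\partial_t,\partial_u,x\partial_u\rangle$; (8) $\langle\partial_u,x\partial_u,c(t,x)\partial_u\rangle$ with $c_{xx}\neq0$. * $\dim A=4$: (9) $\langle\partial_t,\partial_u,x\partial_u,c(x)\partial_u\rangle$ with $c''(x)\neq0$. * $\dim A=m+4$, for each $m\ge0$: (10$_m$) $\langle\partial_u,x\partial_u,c(t,x)\partial_u,q_0(t,x)\partial_u,\dots,q_m(t,x)\partial_u\rangle$ with these generators linearly independent on $W$, $c_{xx}\neq0$, $(q_i)_{xx}\neq0$ for all $i$, and such that there is a nowhere vanishing function $f(t,x)$ with $$\frac{c_t-f\,c_{xxx}}{c_{xx}}=\frac{(q_i)_t-f\,(q_i)_{xxx}}{(q_i)_{xx}}\qquad(0\le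 i\le m).$$ **Theorem 4.1.** 1. Let $A$ be a finite-dimensional admissible abelian algebra on an open set $\Omega\subseteq\mathbb R^3$. Then $\Omega$ has a dense open subset each of whose points has an open neighbourhood $V\subseteq\Omega$ such that either all elements of $A$ vanish identically on $V$, or the restriction of $A$ to $V$ is equivalent to an algebra of the list on some open set $W$. 2. Conversely, every algebra of the list is abelian and admissible on $W$, has the dimension stated in the list, and has rank $1$ for types (2), (5), (8), (10$_m$) and (1), rank $2$ for types (3), (4), (7), (9), and rank $3$ for type (6). Every type, including (10$_m$) for each $m\ge0$, occurs on some nonempty open $W$. 3. Algebras of different types (on any nonempty open sets) are inequivalent. 4. In particular, if $A$ is a finite-dimensional admissible abelian algebra on an open set $\Omega$, then it is impossible that $A$ has rank $3$ on $\Omega$ and its restriction to every nonempty open subset of $\Omega$ has dimension $\ge4$; and it is impossible that $A$ has rank $2$ on $\Omega$ and its restriction to every nonempty open subset of $\Omega$ has dimension $\ge5$. -/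

import Mathlib

open scoped ContDiff

namespace EvolEq

/-- The space of the variables `(t, x, u)`. -/
abbrev Pt : Type := ℝ × ℝ × ℝ

/-- The space of the variables `(t, x, u, u₁, u₂)`. -/
abbrev Jet : Type := ℝ × ℝ × ℝ × ℝ × ℝ

/-- The vector field `a ∂_t + b ∂_x + c ∂_u` is the map `p ↦ (a p, b p, c p)`. A field on an open
set `Ω` is represented by any such map; its values outside `Ω` are never used. -/
abbrev VField : Type := Pt → Pt

/-- Partial derivative in `t` of a function of `(t, x)`. -/
noncomputable def Dt (h : ℝ × ℝ → ℝ) (z : ℝ × ℝ) : ℝ := fderiv ℝ h z (1, 0)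

/-- Partial derivative in `x` of a function of `(t, x)`. -/
noncomputable def Dx (h : ℝ × ℝ → ℝ) (z : ℝ × ℝ) : ℝ := fderiv ℝ h z (0, 1)

/-- A smooth vector field on `Ω` of the form `a(t) ∂_t + b(t,x,u) ∂_x + c(t,x,u) ∂_u`. -/
def IsAllowedField (Ω : Set Pt) (Q : VField) : Prop :=
  ContDiffOn ℝ ∞ Q Ω ∧ ∃ a : ℝ → ℝ, ∀ p ∈ Ω, (Q p).1 = a p.1

section Symmetry

variable (Q : VField) (u : ℝ × ℝ → ℝ)

/-- The point `(t, x, u(t, x))` of the graph of `u`. -/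
def graphPt (z : ℝ × ℝ) : Pt := (z.1, z.2, u z)

/-- The point `(t, x, u, u_x, u_xx)` determined by the function `u`. -/
noncomputable def jet (z : ℝ × ℝ) : Jet := (z.1, z.2, u z, Dx u z, Dx (Dx u) z)

/-- The characteristic function `c - u_t a - u_x b` of `Q = a ∂_t + b ∂_x + c ∂_u`, evaluated along
the function `u`, so that `Dt` and `Dx` act on it as total derivatives. -/
noncomputable def characteristic (z : ℝ × ℝ) : ℝ :=
  (Q (graphPt u z)).2.2 - Dt u z * (Q (graphPt u z)).1 - Dx u z * (Q (graphPt u z)).2.1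

/-- The coefficient `D_J(characteristic) + a D_J(u_t) + b D_J(u_x)` of `∂/∂u_J` in the prolongation
of `Q`, along `u`, where `D` is the total derivative `D_J`. -/
noncomputable def prCoeff (D : (ℝ × ℝ → ℝ) → (ℝ × ℝ → ℝ)) (z : ℝ × ℝ) : ℝ :=
  D (characteristic Q u) z + (Q (graphPt u z)).1 * D (Dt u) z
    + (Q (graphPt u z)).2.1 * D (Dx u) z

/-- The prolongation of `Q` restricted to the variables `(t, x, u, u₁, u₂)`, along `u`. -/
noncomputable def prJet (z : ℝ × ℝ) : Jet :=
  ((Q (graphPt u z)).1, (Q (graphPt u z)).2.1, (Q (graphPt u z)).2.2,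
    prCoeff Q u Dx z, prCoeff Q u (fun h => Dx (Dx h)) z)

end Symmetry

/-- `Q` is an infinitesimal symmetry of `u_t = F(t,x,u,u₁,u₂) u₃ + G(t,x,u,u₁,u₂)`, with `F`, `G`
defined on `D`: the third prolongation of `Q` annihilates `Δ = u_t - F u₃ - G` at every point of
the third jet space over `D` where `Δ = 0` (every such point is the jet of a smooth function
`u(t, x)` at a point `z`). -/
def IsSymmetry (D : Set Jet) (F G : Jet → ℝ) (Q : VField) : Prop :=
  ∀ u : ℝ × ℝ → ℝ, ContDiff ℝ ∞ u → ∀ z : ℝ × ℝ, jet u z ∈ D →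
    Dt u z = F (jet u z) * Dx (Dx (Dx u)) z + G (jet u z) →
    prCoeff Q u Dt z
      - (fderiv ℝ F (jet u z) (prJet Q u z) * Dx (Dx (Dx u)) z
          + F (jet u z) * prCoeff Q u (fun h => Dx (Dx (Dx h))) z
          + fderiv ℝ G (jet u z) (prJet Q u z)) = 0

/-- `A` is admissible on `Ω`: its elements have the allowed form and are symmetries of one and the
same third-order equation `u_t = F u₃ + G`, where `F`, `G` are smooth and `F` does not vanish, on
an open set of `(t,x,u,u₁,u₂)` lying over `Ω`. -/
def IsAdmissible (Ω : Set Pt) (A : Submodule ℝ VField) : Prop :=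
  (∀ Q ∈ A, IsAllowedField Ω Q) ∧
  ∃ (D : Set Jet) (F G : Jet → ℝ),
    IsOpen D ∧ (fun j : Jet => ((j.1, j.2.1, j.2.2.1) : Pt)) '' D = Ω ∧
    ContDiffOn ℝ ∞ F D ∧ ContDiffOn ℝ ∞ G D ∧ (∀ j ∈ D, F j ≠ 0) ∧
    ∀ Q ∈ A, IsSymmetry D F G Q

/-- The elements of `A` commute on `Ω`. -/
def IsAbelianOn (Ω : Set Pt) (A : Submodule ℝ VField) : Prop :=
  ∀ Q ∈ A, ∀ R ∈ A, ∀ p ∈ Ω, VectorField.lieBracket ℝ Q R p = 0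

/-- The space of the restrictions to `Ω` of the elements of `A`. -/
def restrictTo (Ω : Set Pt) (A : Submodule ℝ VField) : Submodule ℝ (Ω → Pt) :=
  A.map (LinearMap.funLeft ℝ Pt (Subtype.val : Ω → Pt))

/-- The dimension of `A` as a space of vector fields on `Ω`. -/
noncomputable def dimOn (Ω : Set Pt) (A : Submodule ℝ VField) : ℕ :=
  Module.finrank ℝ (restrictTo Ω A)

/-- The smallest positive integer `r` such that all `(r+1)`-fold wedge products of elements of `A`
vanish identically on `Ω`. -/
noncomputable def rankOn (Ω : Set Pt) (A : Submodule ℝ VField) : ℕ :=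
  sInf {r : ℕ | 0 < r ∧ ∀ Q : Fin (r + 1) → VField, (∀ i, Q i ∈ A) →
    ∀ p ∈ Ω, ExteriorAlgebra.ιMulti ℝ (r + 1) (fun i => Q i p) = 0}

/-- `A` on `V` and `B` on `W` are equivalent: an invertible smooth transformation of `V` onto `W`
of the form `t' = T(t)`, `x' = X(t,x,u)`, `u' = U(t,x,u)`, with inverse of the same form, carries
`A` onto `B`. -/
def Equivalent (V : Set Pt) (A : Submodule ℝ VField) (W : Set Pt) (B : Submodule ℝ VField) :
    Prop :=
  ∃ Φ Ψ : Pt → Pt,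
    Set.MapsTo Φ V W ∧ Set.MapsTo Ψ W V ∧ Set.LeftInvOn Ψ Φ V ∧ Set.LeftInvOn Φ Ψ W ∧
    ContDiffOn ℝ ∞ Φ V ∧ ContDiffOn ℝ ∞ Ψ W ∧
    (∃ T : ℝ → ℝ, ∀ p ∈ V, (Φ p).1 = T p.1) ∧ (∃ S : ℝ → ℝ, ∀ p ∈ W, (Ψ p).1 = S p.1) ∧
    (∀ Q ∈ A, ∃ R ∈ B, ∀ p ∈ V, fderiv ℝ Φ p (Q p) = R (Φ p)) ∧
    (∀ R ∈ B, ∃ Q ∈ A, ∀ p ∈ V, fderiv ℝ Φ p (Q p) = R (Φ p))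

/-- `∂_t` -/
def genT : VField := fun _ => (1, 0, 0)

/-- `∂_x` -/
def genX : VField := fun _ => (0, 1, 0)

/-- `∂_u` -/
def genU : VField := fun _ => (0, 0, 1)

/-- `c(t,x) ∂_u` -/
def coefU (c : ℝ × ℝ → ℝ) : VField := fun p => (0, 0, c (p.1, p.2.1))

/-- `x ∂_u` -/
def xGenU : VField := coefU (fun z => z.2)

/-- The projection of a set of points `(t,x,u)` to the variables `(t,x)`. -/
def projTX (W : Set Pt) : Set (ℝ × ℝ) := (fun p : Pt => (p.1, p.2.1)) '' W

/-- The projection of a set of points `(t,x,u)` to the variable `x`. -/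
def projX (W : Set Pt) : Set ℝ := (fun p : Pt => p.2.1) '' W

/-- The entries of the list of canonical abelian algebras. -/
inductive AlgType : Type
  /-- `⟨∂_t⟩` -/
  | t
  /-- `⟨∂_u⟩` -/
  | u
  /-- `⟨∂_t, ∂_u⟩` -/
  | tu
  /-- `⟨∂_x, ∂_u⟩` -/
  | xu
  /-- `⟨∂_u, x ∂_u⟩` -/
  | uxu
  /-- `⟨∂_t, ∂_x, ∂_u⟩` -/
  | txu
  /-- `⟨∂_t, ∂_u, x ∂_u⟩` -/
  | tuxu
  /-- `⟨∂_u, x ∂_u, c(t,x) ∂_u⟩` -/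
  | uxuc
  /-- `⟨∂_t, ∂_u, x ∂_u, c(x) ∂_u⟩` -/
  | tuxuc
  /-- `⟨∂_u, x ∂_u, c(t,x) ∂_u, q₀(t,x) ∂_u, …, qₘ(t,x) ∂_u⟩` -/
  | series (m : ℕ)

/-- The dimension of the algebras of each type. -/
def AlgType.dim : AlgType → ℕ
  | .t => 1
  | .u => 1
  | .tu => 2
  | .xu => 2
  | .uxu => 2
  | .txu => 3
  | .tuxu => 3
  | .uxuc => 3
  | .tuxuc => 4
  | .series m => m + 4

/-- The rank of the algebras of each type. -/
def AlgType.rank : AlgType → ℕ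
  | .t => 1
  | .u => 1
  | .tu => 2
  | .xu => 2
  | .uxu => 1
  | .txu => 3
  | .tuxu => 2
  | .uxuc => 1
  | .tuxuc => 2
  | .series _ => 1

/-- `B` is, on `W`, a canonical algebra of the given type. -/
def IsCanonical (W : Set Pt) (B : Submodule ℝ VField) : AlgType → Prop
  | .t => B = Submodule.span ℝ {genT}
  | .u => B = Submodule.span ℝ {genU}
  | .tu => B = Submodule.span ℝ {genT, genU}
  | .xu => B = Submodule.span ℝ {genX, genU}
  | .uxu => B = Submodule.span ℝ {genU, xGenU}
  | .txu => B = Submodule.span ℝ {genT, genX, genU}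
  | .tuxu => B = Submodule.span ℝ {genT, genU, xGenU}
  | .uxuc => ∃ c : ℝ × ℝ → ℝ, ContDiffOn ℝ ∞ c (projTX W) ∧
      (∀ z ∈ projTX W, Dx (Dx c) z ≠ 0) ∧
      B = Submodule.span ℝ {genU, xGenU, coefU c}
  | .tuxuc => ∃ c : ℝ → ℝ, ContDiffOn ℝ ∞ c (projX W) ∧
      (∀ x ∈ projX W, deriv (deriv c) x ≠ 0) ∧
      B = Submodule.span ℝ {genT, genU, xGenU, coefU (fun z => c z.2)}
  | .series m => ∃ (c : ℝ × ℝ → ℝ) (q : Fin (m + 1) → ℝ × ℝ → ℝ),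
      ContDiffOn ℝ ∞ c (projTX W) ∧ (∀ i, ContDiffOn ℝ ∞ (q i) (projTX W)) ∧
      (∀ z ∈ projTX W, Dx (Dx c) z ≠ 0) ∧ (∀ i, ∀ z ∈ projTX W, Dx (Dx (q i)) z ≠ 0) ∧
      -- linear independence of the generators on `W`
      (∀ (α β γ : ℝ) (δ : Fin (m + 1) → ℝ),
        (∀ z ∈ projTX W, α + β * z.2 + γ * c z + ∑ i, δ i * q i z = 0) →
        α = 0 ∧ β = 0 ∧ γ = 0 ∧ δ = 0) ∧
      -- the compatibility condition
      (∃ f : ℝ × ℝ → ℝ, ContDiffOn ℝ ∞ f (projTX W) ∧ (∀ z ∈ projTX W, f z ≠ 0) ∧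
        ∀ i, ∀ z ∈ projTX W,
          (Dt c z - f z * Dx (Dx (Dx c)) z) / Dx (Dx c) z =
            (Dt (q i) z - f z * Dx (Dx (Dx (q i))) z) / Dx (Dx (q i)) z) ∧
      B = Submodule.span ℝ ({genU, xGenU, coefU c} ∪ Set.range (fun i => coefU (q i)))

end EvolEq

/-! The engine is a linearization. At a point where `u` satisfies the equation, the symmetry
condition for a field `Q = b ∂_x + c ∂_u` is linear in its characteristic `η = c - u_x b`: it reads
`η_t - F η_xxx + p₂ η_xx + p₁ η_x + k₁ b + k₂ c = 0`, with coefficients that do not depend on `Q`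
(`exists_symmetry_coefficients`). Two consequences are all that the classification uses. If `R =
β(t) Q₁ + γ(t) Q₂`, the functions of `t` pass through the `x`-derivatives and only `β' Q₁ + γ' Q₂ =
0` survives (`timeRigid_of_symmetries`). If `Q` and `X Q` are symmetries, then every symmetry `h(t,
X) Q` yields a solution of `h_t = f h_xxx + K h_xx` with `f`, `K` independent of `h`, because the
equations for `Q` and `X Q` cancel the terms of lower order (`linearCompatible_of_symmetries`). Test
functions quadratic in `x` and affine in `t` suffice. These facts, commutativity and unique
continuation form the structure `Tame`, which survives diffeomorphisms preserving `t`.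

For a tame algebra without `∂_t`, a field that is nonzero somewhere is straightened to `∂_u`, and
then no coefficient depends on `u`. If some field has a `∂_x`-component, it becomes `∂_x` while
`∂_u` is kept; all coefficients then depend on `t` only, and rigidity makes them constant. Otherwise
every field is `c(t,x) ∂_u`. Either all are constant multiples of `∂_u`, or some `c` with `c_x ≠ 0`
serves as the new `x`; the remaining basis coefficients are not affine in `x`, and the common value
`K = (c_t - f c_xxx) / c_xx` is the compatibility condition of the list.

If some field `Q` has a `∂_t`-component, commutativity makes all `∂_t`-components proportional to
that of `Q`, so the algebra is `ℝ Q` plus a tame part without `∂_t`. The tame part is normalized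
first; then the flow of `Q` turns `Q` into `∂_t` and replaces the other fields by their values at a
fixed time (`exists_straighten_t`). The series types cannot occur here: commuting with `Q` forces
`c_t = q_t = 0`, and then compatibility makes `q` a combination of `1`, `x` and `c`.

Smooth fields may become dependent on smaller open sets, so everything starts from an open set where
the dimension is minimal; there unique continuation holds (`exists_uniqueCont`). Applying the
argument inside every open subset gives density.

Conversely, every listed algebra consists of symmetries of some `u_t = f u_xxx + g u_xx`
(`isSymmetry_of_linear`). Dimension, pointwise rank and the presence of a `∂_t`-component are
invariants and together determine the type (`AlgType.eq_of_invariants`). The rank bounds follow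
since a rank of at least `2` is attained on an open set, where some canonical type has that rank. -/

namespace EvolEq
open Set Filter Topology

/-! ### Smoothness of composition operators on spaces of continuous curves -/

section Nemytskii

variable {K E F : Type} [TopologicalSpace K] [CompactSpace K]
  [NormedAddCommGroup E] [NormedSpace ℝ E] [NormedAddCommGroup F] [NormedSpace ℝ F]

/-- Pointwise evaluation of a continuous family of operators on a continuous family of vectors. -/
noncomputable def pointwiseEval :
    C(K, E →L[ℝ] F) →L[ℝ] C(K, E) →L[ℝ] C(K, F) :=
  LinearMap.mkContinuous₂
    (LinearMap.mk₂ ℝ (fun (A : C(K, E →L[ℝ] F)) (γ : C(K, E)) => (⟨fun k => A k (γ k), by fun_prop⟩ : C(K, F)))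
      (fun _ _ _ => by ext; simp) (fun _ _ _ => by ext; simp)
      (fun _ _ _ => by ext; simp) (fun _ _ _ => by ext; simp)) 1
    (fun A γ => by
      refine (ContinuousMap.norm_le _ (by positivity)).2 fun k => ?_
      rw [one_mul]
      exact ((A k).le_opNorm _).trans
        (by gcongr; exacts [A.norm_coe_le_norm k, γ.norm_coe_le_norm k]))

@[simp] theorem pointwiseEval_apply (A : C(K, E →L[ℝ] F)) (γ : C(K, E)) (k : K) :
    pointwiseEval A γ k = A k (γ k) := rfl

/-- The constant continuous maps. -/
noncomputable def constOp : E →L[ℝ] C(K, E) :=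
  LinearMap.mkContinuous
    { toFun := fun y => ContinuousMap.const K y
      map_add' := fun _ _ => rfl
      map_smul' := fun _ _ => rfl } 1
    (fun y => (ContinuousMap.norm_le _ (by positivity)).2 fun k => (one_mul ‖y‖).ge)

@[simp] theorem constOp_apply (y : E) (k : K) : constOp y k = y := rfl

/-- The composition operator `γ ↦ f ∘ γ` on continuous maps. -/
def compOp (f : E → F) (hf : Continuous f) (γ : C(K, E)) : C(K, F) :=
  (⟨f, hf⟩ : C(E, F)).comp γ

omit [CompactSpace K] [NormedSpace ℝ E] [NormedSpace ℝ F] in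
theorem continuous_compOp (f : E → F) (hf : Continuous f) :
    Continuous (compOp (K := K) f hf) :=
  ContinuousMap.continuous_postcomp _

/-- Composition with `fderiv ℝ f` is continuous in the sup norm, so for small `h` the derivative of
`f` varies by at most `ε` along all segments from `γ k` to `γ k + h k` at once. The mean value
inequality then bounds the remainder uniformly in `k`. -/
theorem hasFDerivAt_compOp {f : E → F} (hf : ContDiff ℝ 1 f) (γ : C(K, E)) :
    HasFDerivAt (compOp (K := K) f hf.continuous)
      (pointwiseEval (compOp (fderiv ℝ f) (hf.continuous_fderiv one_ne_zero) γ)) γ := by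
  rw [hasFDerivAt_iff_isLittleO_nhds_zero, Asymptotics.isLittleO_iff]
  intro ε hε
  have hc := (continuous_compOp (K := K) (fderiv ℝ f) (hf.continuous_fderiv one_ne_zero)).continuousAt
    (x := γ)
  obtain ⟨δ, hδ, H⟩ := Metric.continuousAt_iff.1 hc ε hε
  filter_upwards [Metric.ball_mem_nhds (0 : C(K, E)) hδ] with h hh
  rw [mem_ball_zero_iff] at hh
  refine (ContinuousMap.norm_le _ (by positivity)).2 fun k => ?_
  have key := (convex_segment (𝕜 := ℝ) (γ k) (γ k + h k)).norm_image_sub_le_of_norm_hasFDerivWithin_le'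
    (f := f) (f' := fderiv ℝ f) (φ := fderiv ℝ f (γ k)) (C := ε)
    (fun x _ => ((hf.differentiable one_ne_zero) x).hasFDerivAt.hasFDerivWithinAt)
    (by
      intro x hx
      rw [segment_eq_image'] at hx
      obtain ⟨θ, hθ, rfl⟩ := hx
      have h1 : dist (γ + θ • h) γ < δ := by
        rw [dist_eq_norm, add_sub_cancel_left, norm_smul, Real.norm_of_nonneg hθ.1]
        exact lt_of_le_of_lt (mul_le_of_le_one_left (norm_nonneg _) hθ.2) hh
      have h2 := H h1
      have h3 := (ContinuousMap.dist_lt_iff hε).1 h2 k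
      rw [dist_eq_norm] at h3
      simpa [compOp] using h3.le)
    (left_mem_segment _ _ _) (right_mem_segment _ _ _)
  have h4 : ε * ‖h k‖ ≤ ε * ‖h‖ := by gcongr; exact h.norm_coe_le_norm k
  refine le_trans ?_ (key.trans (by simpa using h4))
  simp [compOp]

/-- The derivative is again a composition operator, with `fderiv ℝ f` in place of `f`, followed by a
continuous linear map. The induction therefore has to allow the target space to change. -/
theorem contDiff_nat_compOp (n : ℕ) : ∀ {F : Type} [NormedAddCommGroup F] [NormedSpace ℝ F]
    {f : E → F} (hf : ContDiff ℝ n f), ContDiff ℝ n (compOp (K := K) f hf.continuous) := by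
  induction n with
  | zero => intro F _ _ f hf; exact contDiff_zero.2 (continuous_compOp _ _)
  | succ n ih =>
    intro F _ _ f hf
    have hf1 : ContDiff ℝ 1 f := hf.of_le (by norm_cast; omega)
    have hf' : ContDiff ℝ n (fderiv ℝ f) := hf.fderiv_right (by norm_cast)
    push_cast
    rw [contDiff_succ_iff_hasFDerivAt]
    exact ⟨fun γ => pointwiseEval (compOp (fderiv ℝ f) (hf1.continuous_fderiv one_ne_zero) γ),
      (ih hf').continuousLinearMap_comp (pointwiseEval (K := K) (E := E) (F := F)), fun γ => hasFDerivAt_compOp hf1 γ⟩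

theorem contDiff_compOp {f : E → F} (hf : ContDiff ℝ ∞ f) :
    ContDiff ℝ ∞ (compOp (K := K) f hf.continuous) :=
  contDiff_infty.2 fun n => contDiff_nat_compOp n (hf.of_le (by exact_mod_cast le_top))

end Nemytskii

/-! ### The inverse function theorem with an inverse smooth on its whole domain -/

section Inverse

variable {X Y : Type} [NormedAddCommGroup X] [NormedSpace ℝ X] [CompleteSpace X]
  [NormedAddCommGroup Y] [NormedSpace ℝ Y]

/-- Smoothness of the inverse at an image point needs an invertible derivative at the preimage.
Invertible operators form an open set, so the source can be shrunk to points with invertible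
derivative. No finite dimension is assumed, since `X` will be a space of curves. -/
theorem exists_smooth_inverse {G : X → Y} {N : Set X} (hN : IsOpen N) (hG : ContDiffOn ℝ ∞ G N)
    {a : X} (ha : a ∈ N) (e : X ≃L[ℝ] Y) (he : HasFDerivAt G (e : X →L[ℝ] Y) a) :
    ∃ φ : OpenPartialHomeomorph X Y, a ∈ φ.source ∧ φ.source ⊆ N ∧ ⇑φ = G ∧
      ContDiffOn ℝ ∞ φ.symm φ.target := by
  have hGa : ContDiffAt ℝ ∞ G a := hG.contDiffAt (hN.mem_nhds ha)
  let φ := hGa.toOpenPartialHomeomorph G he (by simp)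
  let S : Set X := N ∩ fderiv ℝ G ⁻¹' range ((↑) : (X ≃L[ℝ] Y) → X →L[ℝ] Y)
  have hS : IsOpen S :=
    (hG.continuousOn_fderiv_of_isOpen hN (by simp)).isOpen_inter_preimage hN
      ContinuousLinearEquiv.isOpen
  refine ⟨φ.restrOpen S hS, ⟨hGa.mem_toOpenPartialHomeomorph_source he (by simp), ha, e, he.fderiv.symm⟩,
    fun x hx => hx.2.1, rfl, ?_⟩
  intro y hy
  have hx := (φ.restrOpen S hS).map_target hy
  obtain ⟨-, hxN, e', he'⟩ := hx
  have hd : HasFDerivAt G (e' : X →L[ℝ] Y) ((φ.restrOpen S hS).symm y) := by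
    rw [he']
    exact ((hG.contDiffAt (hN.mem_nhds hxN)).differentiableAt (by simp)).hasFDerivAt
  exact ((φ.restrOpen S hS).contDiffAt_symm hy hd
    (hG.contDiffAt (hN.mem_nhds hxN))).contDiffWithinAt

end Inverse

/-! ### Smooth local flows -/

section Flow

variable {E : Type} [NormedAddCommGroup E] [NormedSpace ℝ E] [CompleteSpace E]

/-- The operator `γ ↦ (s ↦ ∫₀ˢ γ)` on continuous curves. -/
noncomputable def primitiveOp : C(unitInterval, E) →L[ℝ] C(unitInterval, E) :=
  LinearMap.mkContinuous
    { toFun := fun γ => ⟨fun s => ∫ r in (0 : ℝ)..s, IccExtend zero_le_one γ r, by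
        have h : Continuous (IccExtend (zero_le_one (α := ℝ)) γ) := γ.continuous.Icc_extend'
        exact (intervalIntegral.continuous_primitive (fun a b => h.intervalIntegrable a b) 0).comp
          continuous_subtype_val⟩
      map_add' := fun γ δ => by
        ext s
        exact intervalIntegral.integral_add
          (γ.continuous.Icc_extend'.intervalIntegrable _ _)
          (δ.continuous.Icc_extend'.intervalIntegrable _ _)
      map_smul' := fun c γ => by
        ext s
        exact intervalIntegral.integral_smul c _ } 1
    (fun γ => by
      refine (ContinuousMap.norm_le _ (by positivity)).2 fun s => ?_
      have h : ∀ r ∈ uIoc (0 : ℝ) s, ‖IccExtend (zero_le_one (α := ℝ)) γ r‖ ≤ ‖γ‖ :=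
        fun r _ => γ.norm_coe_le_norm _
      refine (intervalIntegral.norm_integral_le_of_norm_le_const h).trans ?_
      rw [one_mul, sub_zero, abs_of_nonneg s.2.1]
      exact mul_le_of_le_one_right (norm_nonneg _) s.2.2)

omit [CompleteSpace E] in
theorem primitiveOp_apply (γ : C(unitInterval, E)) (s : unitInterval) :
    primitiveOp γ s = ∫ r in (0 : ℝ)..s, IccExtend zero_le_one γ r := rfl

/-- The shear `(τ, γ) ↦ (τ, γ - τ w)`. -/
noncomputable def shearEquiv {C : Type} [NormedAddCommGroup C] [NormedSpace ℝ C] (w : C) :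
    (ℝ × C) ≃L[ℝ] (ℝ × C) :=
  ContinuousLinearEquiv.equivOfInverse
    ((ContinuousLinearMap.fst ℝ ℝ C).prod
      (ContinuousLinearMap.snd ℝ ℝ C - (ContinuousLinearMap.fst ℝ ℝ C).smulRight w))
    ((ContinuousLinearMap.fst ℝ ℝ C).prod
      (ContinuousLinearMap.snd ℝ ℝ C + (ContinuousLinearMap.fst ℝ ℝ C).smulRight w))
    (fun z => by simp) (fun z => by simp)

/-- With time rescaled to `[0, 1]`, the solution at time `τ` from `y` is the curve with `γ(s) = y +
τ ∫₀ˢ f(γ)`. This says `G (τ, γ) = (τ, y)` for the smooth map `G (τ, γ) = (τ, γ - τ ∫ f ∘ γ)`, whose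
derivative at `τ = 0` is a shear. The inverse function theorem makes `γ` depend smoothly on `(τ,
y)`, and the flow is its endpoint `γ(1)`. -/
theorem exists_smooth_flow_global {f : E → E} (hf : ContDiff ℝ ∞ f) (y₀ : E) :
    ∃ (Fl : ℝ × E → E) (ε : ℝ), 0 < ε ∧ ContDiffOn ℝ ∞ Fl (Metric.ball (0, y₀) ε) ∧
      ∀ z ∈ Metric.ball ((0 : ℝ), y₀) ε, Fl (0, z.2) = z.2 ∧
        HasDerivAt (fun τ => Fl (τ, z.2)) (f (Fl z)) z.1 := by
  let N : C(unitInterval, E) → C(unitInterval, E) := compOp f hf.continuous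
  have hN : ContDiff ℝ ∞ N := contDiff_compOp hf
  let G : ℝ × C(unitInterval, E) → ℝ × C(unitInterval, E) :=
    fun z => (z.1, z.2 - z.1 • primitiveOp (N z.2))
  have hG : ContDiff ℝ ∞ G := by
    have : ContDiff ℝ ∞ (fun z : ℝ × C(unitInterval, E) => primitiveOp (N z.2)) :=
      primitiveOp.contDiff.comp (hN.comp contDiff_snd)
    exact contDiff_fst.prodMk (contDiff_snd.sub (contDiff_fst.smul this))
  let c₀ : C(unitInterval, E) := constOp y₀
  have hG' : HasFDerivAt G
      (shearEquiv (primitiveOp (N c₀)) : (ℝ × C(unitInterval, E)) →L[ℝ] _) (0, c₀) := by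
    have h1 : HasFDerivAt (fun z : ℝ × C(unitInterval, E) => primitiveOp (N z.2))
        (fderiv ℝ (fun z : ℝ × C(unitInterval, E) => primitiveOp (N z.2)) (0, c₀)) (0, c₀) :=
      ((primitiveOp.contDiff.comp (hN.comp contDiff_snd)).differentiable (by simp) _).hasFDerivAt
    have h2 := (hasFDerivAt_fst (𝕜 := ℝ) (p := ((0 : ℝ), c₀))).prodMk
      ((hasFDerivAt_snd (𝕜 := ℝ) (p := ((0 : ℝ), c₀))).sub
        ((hasFDerivAt_fst (𝕜 := ℝ) (p := ((0 : ℝ), c₀))).smul h1))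
    refine h2.congr_fderiv ?_
    ext z <;> simp [shearEquiv]
  obtain ⟨φ, hφ0, -, hφ, hsm⟩ := exists_smooth_inverse isOpen_univ hG.contDiffOn (mem_univ _) _ hG'
  -- a ball on which `G` is injective
  obtain ⟨r, hr, hrs⟩ := Metric.isOpen_iff.1 φ.open_source _ hφ0
  have hG0 : G (0, c₀) = (0, c₀) := by simp [G]
  -- the solution curves
  let ι : ℝ × E → ℝ × C(unitInterval, E) := fun z => (z.1, constOp z.2)
  have hι : ContDiff ℝ ∞ ι :=
    contDiff_fst.prodMk (ContDiff.continuousLinearMap_comp (constOp (K := unitInterval) (E := E)) contDiff_snd)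
  let Γ : ℝ × E → C(unitInterval, E) := fun z => (φ.symm (ι z)).2
  -- On `D` the solution curve stays in the ball where `G` is injective; this is what identifies
  -- reparametrized curves below.
  let D : Set (ℝ × E) := ι ⁻¹' (φ.target ∩ φ.symm ⁻¹' Metric.ball (0, c₀) r)
  have hD : IsOpen D := (φ.isOpen_inter_preimage_symm Metric.isOpen_ball).preimage hι.continuous
  have hsol : ∀ z ∈ D, ∀ s : unitInterval,
      Γ z s = z.2 + z.1 • ∫ r in (0 : ℝ)..s, f (IccExtend zero_le_one (Γ z) r) := by
    intro z hz s
    have h1 : G (φ.symm (ι z)) = ι z := by rw [← hφ]; exact φ.right_inv hz.1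
    have h2 : (φ.symm (ι z)).1 = z.1 := congrArg Prod.fst h1
    have h3 : Γ z - (φ.symm (ι z)).1 • primitiveOp (N (Γ z)) = constOp z.2 := congrArg Prod.snd h1
    rw [h2] at h3
    have h4 := DFunLike.congr_fun h3 s
    simp only [ContinuousMap.sub_apply, ContinuousMap.smul_apply, constOp_apply,
      primitiveOp_apply] at h4
    rw [← h4, sub_add_eq_add_sub, eq_comm, sub_eq_iff_eq_add]
    rfl
  -- The curve `s' ↦ Γ z (s s')` solves the rescaled equation with time `τ s` and lies in the same
  -- ball, so by injectivity of `G` it is the solution curve for `(τ s, y)`. This turns the equation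
  -- on the fixed interval into the differential equation in `τ`.
  have hscale : ∀ z ∈ D, ∀ s : unitInterval, Γ (z.1 * s, z.2) 1 = Γ z s := by
    intro z hz s
    let δ : C(unitInterval, E) := (Γ z).comp ⟨fun s' => s * s', by fun_prop⟩
    have hball := hz.2
    have h1 : (φ.symm (ι z)).1 = z.1 := by
      have : G (φ.symm (ι z)) = ι z := by rw [← hφ]; exact φ.right_inv hz.1
      exact congrArg Prod.fst this
    have h2 : (z.1 * s, δ) ∈ Metric.ball ((0 : ℝ), c₀) r := by
      rw [mem_preimage, ← ball_prod_same, mem_prod, mem_ball_zero_iff, h1] at hball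
      rw [← ball_prod_same, mem_prod, mem_ball_zero_iff]
      refine ⟨lt_of_le_of_lt ?_ hball.1, lt_of_le_of_lt ?_ (Metric.mem_ball.1 hball.2)⟩
      · rw [norm_mul, Real.norm_of_nonneg s.2.1]
        exact mul_le_of_le_one_right (norm_nonneg _) s.2.2
      · exact (ContinuousMap.dist_le dist_nonneg).2 fun s' =>
          ContinuousMap.dist_apply_le_dist (f := Γ z) (g := c₀) (s * s')
    have h3 : G (z.1 * s, δ) = ι (z.1 * s, z.2) := by
      refine Prod.ext rfl (ContinuousMap.ext fun s' => ?_)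
      simp only [G, ι, ContinuousMap.sub_apply, ContinuousMap.smul_apply, constOp_apply,
        primitiveOp_apply]
      have h4 : ∫ r in (0 : ℝ)..s', IccExtend zero_le_one (N δ) r =
          ∫ r in (0 : ℝ)..s', f (IccExtend zero_le_one (Γ z) (s * r)) := by
        refine intervalIntegral.integral_congr fun r hr => ?_
        rw [uIcc_of_le s'.2.1] at hr
        have hr1 : r ∈ Icc (0 : ℝ) 1 := ⟨hr.1, hr.2.trans s'.2.2⟩
        have hr2 : (s : ℝ) * r ∈ Icc (0 : ℝ) 1 := unitInterval.mul_mem s.2 hr1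
        simp only [IccExtend_of_mem _ _ hr1, IccExtend_of_mem _ _ hr2]
        rfl
      have h5 : (s : ℝ) • ∫ r in (0 : ℝ)..s', f (IccExtend zero_le_one (Γ z) (s * r)) =
          ∫ r in (0 : ℝ)..(s * s' : unitInterval), f (IccExtend zero_le_one (Γ z) r) := by
        rw [intervalIntegral.smul_integral_comp_mul_left
          (fun r => f (IccExtend zero_le_one (Γ z) r)), mul_zero]
        rfl
      rw [h4, mul_smul, h5, sub_eq_iff_eq_add]
      exact hsol z hz (s * s')
    have h6 : φ.symm (ι (z.1 * s, z.2)) = (z.1 * s, δ) := by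
      rw [← h3, ← hφ]
      exact φ.left_inv (hrs h2)
    change (φ.symm (ι (z.1 * s, z.2))).2 1 = _
    rw [h6]
    change Γ z (s * 1) = _
    rw [mul_one]
  have hD0 : ((0 : ℝ), y₀) ∈ D := by
    have h1 : ι (0, y₀) = φ (0, c₀) := by rw [hφ, hG0]
    refine ⟨?_, ?_⟩
    · rw [h1]; exact φ.map_source hφ0
    · rw [mem_preimage, h1, φ.left_inv hφ0]; exact Metric.mem_ball_self hr
  obtain ⟨ε, hε, hεD⟩ := Metric.isOpen_iff.1 hD _ hD0
  have hFl : ContDiffOn ℝ ∞ (fun z => Γ z 1) (Metric.ball (0, y₀) ε) := by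
    have h1 : ContDiffOn ℝ ∞ Γ (Metric.ball (0, y₀) ε) :=
      contDiff_snd.comp_contDiffOn (hsm.comp hι.contDiffOn fun z hz => (hεD hz).1)
    exact (ContinuousMap.evalCLM (R := ℝ) (1 : unitInterval)).contDiff.comp_contDiffOn h1
  have hint : ∀ z ∈ Metric.ball ((0 : ℝ), y₀) ε,
      Γ z 1 = z.2 + ∫ r in (0 : ℝ)..z.1, f (Γ (r, z.2) 1) := by
    intro z hz
    rw [hsol z (hεD hz) 1]
    have h1 : ∫ r in (0 : ℝ)..(1 : unitInterval), f (IccExtend zero_le_one (Γ z) r) =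
        ∫ r in (0 : ℝ)..1, f (Γ (z.1 * r, z.2) 1) := by
      refine intervalIntegral.integral_congr fun r hr => ?_
      have hr1 : r ∈ Icc (0 : ℝ) 1 := by simpa [uIcc_of_le (zero_le_one' ℝ)] using hr
      simp only [IccExtend_of_mem _ _ hr1]
      rw [hscale z (hεD hz) ⟨r, hr1⟩]
    rw [h1, intervalIntegral.smul_integral_comp_mul_left (fun r => f (Γ (r, z.2) 1)), mul_zero,
      mul_one]
  refine ⟨fun z => Γ z 1, ε, hε, hFl, fun z hz => ⟨?_, ?_⟩⟩
  · have h0 : ((0 : ℝ), z.2) ∈ Metric.ball ((0 : ℝ), y₀) ε := by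
      rw [← ball_prod_same, mem_prod] at hz ⊢
      exact ⟨Metric.mem_ball_self hε, hz.2⟩
    simpa using hint _ h0
  · rw [← ball_prod_same, mem_prod] at hz
    have hcont : ContinuousOn (fun τ => f (Γ (τ, z.2) 1)) (Metric.ball (0 : ℝ) ε) := by
      refine hf.continuous.comp_continuousOn (hFl.continuousOn.comp (by fun_prop) fun τ hτ => ?_)
      rw [← ball_prod_same]
      exact ⟨hτ, hz.2⟩
    have hsub : uIcc 0 z.1 ⊆ Metric.ball (0 : ℝ) ε :=
      (convex_ball (0 : ℝ) ε).ordConnected.uIcc_subset (Metric.mem_ball_self hε) hz.1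
    have h1 := (intervalIntegral.integral_hasDerivAt_right
      ((hcont.mono hsub).intervalIntegrable)
      (hcont.stronglyMeasurableAtFilter Metric.isOpen_ball _ hz.1)
      (hcont.continuousAt (Metric.isOpen_ball.mem_nhds hz.1))).const_add z.2
    refine h1.congr_of_eventuallyEq ?_
    filter_upwards [Metric.isOpen_ball.mem_nhds hz.1] with τ hτ
    refine hint (τ, z.2) ?_
    rw [← ball_prod_same]
    exact ⟨hτ, hz.2⟩

/-- The local flow of a smooth vector field is smooth. -/
theorem exists_smooth_flow {E : Type} [NormedAddCommGroup E] [NormedSpace ℝ E]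
    [FiniteDimensional ℝ E] {V : Set E} (hV : IsOpen V) {f : E → E} (hf : ContDiffOn ℝ ∞ f V)
    {y₀ : E} (hy₀ : y₀ ∈ V) :
    ∃ (Fl : ℝ × E → E) (ε : ℝ), 0 < ε ∧ ContDiffOn ℝ ∞ Fl (Metric.ball (0, y₀) ε) ∧
      ∀ z ∈ Metric.ball ((0 : ℝ), y₀) ε, Fl z ∈ V ∧ Fl (0, z.2) = z.2 ∧
        HasDerivAt (fun τ => Fl (τ, z.2)) (f (Fl z)) z.1 := by
  have := FiniteDimensional.complete ℝ E
  obtain ⟨ρ, hρ, hρV⟩ := Metric.isOpen_iff.1 hV y₀ hy₀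
  -- A cutoff makes the field smooth on all of `E`. The times and starting points are later
  -- restricted so that the flow stays in the ball of radius `ρ / 4`, where the cutoff equals `1`.
  let χ : ContDiffBump y₀ := ⟨ρ / 4, ρ / 2, by positivity, by linarith⟩
  have hg : ContDiff ℝ ∞ (fun y => χ y • f y) := by
    rw [contDiff_iff_contDiffAt]
    intro y
    by_cases hy : y ∈ V
    · exact χ.contDiff.contDiffAt.smul (hf.contDiffAt (hV.mem_nhds hy))
    · have h1 : y ∉ Metric.closedBall y₀ (ρ / 2) := fun h =>
        hy (hρV (Metric.closedBall_subset_ball (by linarith) h))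
      refine (contDiffAt_const (c := (0 : E))).congr_of_eventuallyEq ?_
      filter_upwards [Metric.isClosed_closedBall.isOpen_compl.mem_nhds h1] with x hx
      have : χ x = 0 := χ.zero_of_le_dist (by
        simp only [Metric.mem_closedBall, mem_compl_iff, not_le] at hx; exact hx.le)
      simp [this]
  obtain ⟨Fl, ε, hε, hsm, hFl⟩ := exists_smooth_flow_global hg y₀
  have h0 : Fl (0, y₀) = y₀ := (hFl (0, y₀) (Metric.mem_ball_self hε)).1
  have hc : ContinuousAt Fl (0, y₀) :=
    hsm.continuousOn.continuousAt (Metric.ball_mem_nhds _ hε)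
  have hn : Fl ⁻¹' Metric.ball y₀ (ρ / 4) ∈ 𝓝 ((0 : ℝ), y₀) :=
    hc.preimage_mem_nhds (by rw [h0]; exact Metric.ball_mem_nhds _ (by positivity))
  obtain ⟨ε', hε', hsub⟩ := Metric.mem_nhds_iff.1 hn
  refine ⟨Fl, min ε ε', lt_min hε hε', hsm.mono (Metric.ball_subset_ball (min_le_left _ _)),
    fun z hz => ?_⟩
  have hz1 := Metric.ball_subset_ball (min_le_left ε ε') hz
  have hz2 : Fl z ∈ Metric.ball y₀ (ρ / 4) := hsub (Metric.ball_subset_ball (min_le_right ε ε') hz)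
  refine ⟨hρV (Metric.ball_subset_ball (by linarith) hz2), (hFl z hz1).1, ?_⟩
  have h1 : χ (Fl z) = 1 := χ.one_of_mem_closedBall (Metric.ball_subset_closedBall hz2)
  simpa [h1] using (hFl z hz1).2

end Flow
end EvolEq

namespace EvolEq
open Set Filter Topology

/-! ### Diffeomorphisms and charts -/

section Diffeo

/-- `Φ` is a diffeomorphism of the open set `V` onto the open set `W`, with inverse `Ψ`. -/
structure IsDiffeo (V W : Set Pt) (Φ Ψ : Pt → Pt) : Prop where
  isOpen_source : IsOpen V
  isOpen_target : IsOpen W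
  mapsTo : MapsTo Φ V W
  mapsTo_inv : MapsTo Ψ W V
  left_inv : LeftInvOn Ψ Φ V
  right_inv : LeftInvOn Φ Ψ W
  smooth : ContDiffOn ℝ ∞ Φ V
  smooth_inv : ContDiffOn ℝ ∞ Ψ W

variable {V W : Set Pt} {Φ Ψ : Pt → Pt}

theorem IsDiffeo.symm (h : IsDiffeo V W Φ Ψ) : IsDiffeo W V Ψ Φ :=
  ⟨h.2, h.1, h.4, h.3, h.6, h.5, h.8, h.7⟩

theorem IsDiffeo.restrict (h : IsDiffeo V W Φ Ψ) {V' : Set Pt} (hV' : IsOpen V') (hsub : V' ⊆ V) :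
    IsDiffeo V' (W ∩ Ψ ⁻¹' V') Φ Ψ where
  isOpen_source := hV'
  isOpen_target := h.smooth_inv.continuousOn.isOpen_inter_preimage h.isOpen_target hV'
  mapsTo p hp := ⟨h.mapsTo (hsub hp), by rw [mem_preimage, h.left_inv (hsub hp)]; exact hp⟩
  mapsTo_inv _ hw := hw.2
  left_inv := h.left_inv.mono hsub
  right_inv := h.right_inv.mono inter_subset_left
  smooth := h.smooth.mono hsub
  smooth_inv := h.smooth_inv.mono inter_subset_left

theorem IsDiffeo.fderiv_inv_comp (h : IsDiffeo V W Φ Ψ) {p : Pt} (hp : p ∈ V) (v : Pt) :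
    fderiv ℝ Ψ (Φ p) (fderiv ℝ Φ p v) = v := by
  have h1 : DifferentiableAt ℝ Φ p :=
    (h.smooth.contDiffAt (h.isOpen_source.mem_nhds hp)).differentiableAt (by simp)
  have h2 : DifferentiableAt ℝ Ψ (Φ p) :=
    (h.smooth_inv.contDiffAt (h.isOpen_target.mem_nhds (h.mapsTo hp))).differentiableAt (by simp)
  have h3 : HasFDerivAt (Ψ ∘ Φ) (fderiv ℝ Ψ (Φ p) ∘L fderiv ℝ Φ p) p :=
    h2.hasFDerivAt.comp p h1.hasFDerivAt
  have h4 : HasFDerivAt (Ψ ∘ Φ) (ContinuousLinearMap.id ℝ Pt) p := by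
    refine (hasFDerivAt_id p).congr_of_eventuallyEq ?_
    filter_upwards [h.isOpen_source.mem_nhds hp] with q hq using h.left_inv hq
  exact DFunLike.congr_fun (h3.unique h4) v

theorem IsDiffeo.fderiv_comp_inv (h : IsDiffeo V W Φ Ψ) {w : Pt} (hw : w ∈ W) (v : Pt) :
    fderiv ℝ Φ (Ψ w) (fderiv ℝ Ψ w v) = v :=
  h.symm.fderiv_inv_comp hw v

/-- In finite dimension an injective derivative is invertible, so the inverse function theorem
applies to the parametrization `Ψ`. The parameter domain is taken to be a ball because later
arguments integrate along its coordinate lines. -/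
theorem exists_chart {Ψ : Pt → Pt} {N V : Set Pt} (hN : IsOpen N) (hΨ : ContDiffOn ℝ ∞ Ψ N)
    {w : Pt} (hw : w ∈ N) (hV : IsOpen V) (hwV : Ψ w ∈ V)
    (hinj : ∀ v, fderiv ℝ Ψ w v = 0 → v = 0) :
    ∃ r > 0, ∃ (V' : Set Pt) (Φ : Pt → Pt), V' ⊆ V ∧ Metric.ball w r ⊆ N ∧
      IsDiffeo V' (Metric.ball w r) Φ Ψ := by
  let e : Pt ≃L[ℝ] Pt := (LinearEquiv.ofInjectiveEndo (fderiv ℝ Ψ w).toLinearMap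
    ((injective_iff_map_eq_zero _).2 hinj)).toContinuousLinearEquiv
  have he : HasFDerivAt Ψ (e : Pt →L[ℝ] Pt) w := by
    have h1 := ((hΨ.contDiffAt (hN.mem_nhds hw)).differentiableAt (by simp)).hasFDerivAt
    exact h1.congr_fderiv (ContinuousLinearMap.ext fun v => rfl)
  obtain ⟨φ, hφw, hφN, hφ, hsm⟩ := exists_smooth_inverse hN hΨ hw e he
  have hO : IsOpen (φ.source ∩ φ ⁻¹' V) := φ.isOpen_inter_preimage hV
  obtain ⟨r, hr, hsub⟩ := Metric.isOpen_iff.1 hO w ⟨hφw, by rw [hφ]; exact hwV⟩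
  have hsub1 : Metric.ball w r ⊆ φ.source := fun x hx => (hsub hx).1
  refine ⟨r, hr, φ '' Metric.ball w r, φ.symm, ?_, hsub1.trans hφN, ?_⟩
  · rintro _ ⟨x, hx, rfl⟩
    exact (hsub hx).2
  · rw [← hφ]
    refine ⟨φ.isOpen_image_of_subset_source Metric.isOpen_ball hsub1, Metric.isOpen_ball, ?_,
      fun x hx => mem_image_of_mem _ hx, ?_, fun x hx => φ.left_inv (hsub1 hx), ?_, ?_⟩
    · rintro _ ⟨x, hx, rfl⟩
      rwa [φ.left_inv (hsub1 hx)]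
    · rintro _ ⟨x, hx, rfl⟩
      rw [φ.left_inv (hsub1 hx)]
    · refine hsm.mono ?_
      rintro _ ⟨x, hx, rfl⟩
      exact φ.map_source (hsub1 hx)
    · rw [hφ]
      exact hΨ.mono (hsub1.trans hφN)

end Diffeo

/-! ### Transport of vector fields -/

section Push

variable {V W : Set Pt} {Φ Ψ : Pt → Pt}

/-- The transport of vector fields by `Φ`, with inverse `Ψ`. -/
noncomputable def pushField (Φ Ψ : Pt → Pt) : VField →ₗ[ℝ] VField where
  toFun Q w := fderiv ℝ Φ (Ψ w) (Q (Ψ w))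
  map_add' Q R := by ext1 w; simp
  map_smul' c Q := by ext1 w; simp

theorem pushField_apply (Q : VField) (w : Pt) :
    pushField Φ Ψ Q w = fderiv ℝ Φ (Ψ w) (Q (Ψ w)) := rfl

/-- Charts are mostly given by an explicit parametrization `Ψ`. This form avoids computing the
derivative of its inverse `Φ`. -/
theorem IsDiffeo.pushField_eq_iff (h : IsDiffeo V W Φ Ψ) {Q : VField} {w v : Pt} (hw : w ∈ W) :
    pushField Φ Ψ Q w = v ↔ fderiv ℝ Ψ w v = Q (Ψ w) := by
  rw [pushField_apply]
  constructor
  · rintro rfl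
    have := h.fderiv_inv_comp (h.mapsTo_inv hw) (Q (Ψ w))
    rwa [h.right_inv hw] at this
  · intro h1
    rw [← h1, h.fderiv_comp_inv hw]

theorem IsDiffeo.contDiffOn_pushField (h : IsDiffeo V W Φ Ψ) {Q : VField}
    (hQ : ContDiffOn ℝ ∞ Q V) : ContDiffOn ℝ ∞ (pushField Φ Ψ Q) W := by
  have h1 : ContDiffOn ℝ ∞ (fderiv ℝ Φ) V := h.smooth.fderiv_of_isOpen h.isOpen_source (by simp)
  exact (h1.comp h.smooth_inv h.mapsTo_inv).clm_apply (hQ.comp h.smooth_inv h.mapsTo_inv)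

/-- Pushing forward by `Φ` is pulling back by `Ψ`, and pullbacks respect the bracket. -/
theorem IsDiffeo.lieBracket_pushField (h : IsDiffeo V W Φ Ψ) {Q R : VField}
    (hQ : ContDiffOn ℝ ∞ Q V) (hR : ContDiffOn ℝ ∞ R V) {w : Pt} (hw : w ∈ W) :
    VectorField.lieBracket ℝ (pushField Φ Ψ Q) (pushField Φ Ψ R) w =
      fderiv ℝ Φ (Ψ w) (VectorField.lieBracket ℝ Q R (Ψ w)) := by
  have hinv : ∀ w ∈ W, (fderiv ℝ Ψ w).inverse = fderiv ℝ Φ (Ψ w) := fun w hw =>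
    ContinuousLinearMap.inverse_eq
      (ContinuousLinearMap.ext fun v => by
        have := h.fderiv_inv_comp (h.mapsTo_inv hw) v
        rw [h.right_inv hw] at this
        simpa using this)
      (ContinuousLinearMap.ext fun v => by simpa using h.fderiv_comp_inv hw v)
  have hp : ∀ Q : VField, pushField Φ Ψ Q =ᶠ[𝓝 w] VectorField.pullback ℝ Ψ Q := fun Q => by
    filter_upwards [h.isOpen_target.mem_nhds hw] with x hx
    rw [VectorField.pullback, hinv x hx, pushField_apply]
  have hd : ∀ {Q : VField}, ContDiffOn ℝ ∞ Q V → DifferentiableAt ℝ Q (Ψ w) := fun hQ =>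
    (hQ.contDiffAt (h.isOpen_source.mem_nhds (h.mapsTo_inv hw))).differentiableAt (by simp)
  rw [(hp Q).lieBracket_vectorField_eq (hp R), ← VectorField.pullback_lieBracket (n := ∞)
    (by simpa using (WithTop.coe_le_coe.2 le_top : ((2 : ℕ∞) : WithTop ℕ∞) ≤ ∞))
    (h.smooth_inv.contDiffAt (h.isOpen_target.mem_nhds hw)) (hd hQ) (hd hR), VectorField.pullback,
    hinv w hw]

theorem finiteDimensional_restrictTo_mono {A : Submodule ℝ VField} {V' : Set Pt} (hsub : V' ⊆ V)
    (h : FiniteDimensional ℝ (restrictTo V A)) : FiniteDimensional ℝ (restrictTo V' A) := by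
  have h1 : restrictTo V' A =
      (restrictTo V A).map (LinearMap.funLeft ℝ Pt (Set.inclusion hsub)) := by
    rw [restrictTo, restrictTo, ← Submodule.map_comp]
    rfl
  rw [h1]
  infer_instance

theorem IsDiffeo.finiteDimensional_push (h : IsDiffeo V W Φ Ψ) {A : Submodule ℝ VField}
    (hA : FiniteDimensional ℝ (restrictTo V A)) :
    FiniteDimensional ℝ (restrictTo W (A.map (pushField Φ Ψ))) := by
  let L : (V → Pt) →ₗ[ℝ] (W → Pt) :=
    { toFun := fun f w => fderiv ℝ Φ (Ψ w) (f ⟨Ψ w, h.mapsTo_inv w.2⟩)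
      map_add' := fun f g => by ext1 w; simp
      map_smul' := fun c f => by ext1 w; simp }
  have h1 : restrictTo W (A.map (pushField Φ Ψ)) = (restrictTo V A).map L := by
    rw [restrictTo, restrictTo, ← Submodule.map_comp, ← Submodule.map_comp]
    rfl
  rw [h1]
  infer_instance

end Push

/-! ### Equivalence of algebras, restriction and composition -/

section Equivalence

variable {V W : Set Pt} {Φ Ψ : Pt → Pt} {A B : Submodule ℝ VField}

/-- `A` and `B` have the same restrictions to `W`. -/
def AgreeOn (W : Set Pt) (A B : Submodule ℝ VField) : Prop :=
  (∀ Q ∈ A, ∃ R ∈ B, EqOn Q R W) ∧ ∀ R ∈ B, ∃ Q ∈ A, EqOn Q R W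

/-- An equivalence that does not change `t`. -/
def FiberEquivalent (V : Set Pt) (A : Submodule ℝ VField) (W : Set Pt) (B : Submodule ℝ VField) :
    Prop :=
  ∃ Φ Ψ : Pt → Pt, IsDiffeo V W Φ Ψ ∧ (∀ p ∈ V, (Φ p).1 = p.1) ∧
    AgreeOn W (A.map (pushField Φ Ψ)) B

theorem FiberEquivalent.equivalent (h : FiberEquivalent V A W B) : Equivalent V A W B := by
  obtain ⟨Φ, Ψ, hd, ht, h1, h2⟩ := h
  refine ⟨Φ, Ψ, hd.3, hd.4, hd.5, hd.6, hd.7, hd.8, ⟨id, ht⟩, ⟨id, fun p hp => ?_⟩, ?_, ?_⟩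
  · have := ht (Ψ p) (hd.4 hp)
    rw [hd.6 hp] at this
    exact this.symm
  · intro Q hQ
    obtain ⟨R, hR, hQR⟩ := h1 _ (Submodule.mem_map_of_mem hQ)
    refine ⟨R, hR, fun p hp => ?_⟩
    rw [← hQR (hd.3 hp), pushField_apply, hd.5 hp]
  · intro R hR
    obtain ⟨_, ⟨Q, hQ, rfl⟩, hQR⟩ := h2 R hR
    refine ⟨Q, hQ, fun p hp => ?_⟩
    rw [← hQR (hd.3 hp), pushField_apply, hd.5 hp]

theorem AgreeOn.refl (W : Set Pt) (A : Submodule ℝ VField) : AgreeOn W A A :=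
  ⟨fun Q hQ => ⟨Q, hQ, fun _ _ => rfl⟩, fun Q hQ => ⟨Q, hQ, fun _ _ => rfl⟩⟩

theorem AgreeOn.mono {W' : Set Pt} (h : AgreeOn W A B) (hsub : W' ⊆ W) : AgreeOn W' A B :=
  ⟨fun Q hQ => let ⟨R, hR, e⟩ := h.1 Q hQ; ⟨R, hR, e.mono hsub⟩,
    fun Q hQ => let ⟨R, hR, e⟩ := h.2 Q hQ; ⟨R, hR, e.mono hsub⟩⟩

theorem IsDiffeo.fiberEquivalent_push (h : IsDiffeo V W Φ Ψ) (ht : ∀ p ∈ V, (Φ p).1 = p.1)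
    (A : Submodule ℝ VField) : FiberEquivalent V A W (A.map (pushField Φ Ψ)) :=
  ⟨Φ, Ψ, h, ht, AgreeOn.refl _ _⟩

theorem FiberEquivalent.of_agreeOn (hV : IsOpen V) (h : AgreeOn V A B) :
    FiberEquivalent V A V B := by
  refine ⟨id, id, ⟨hV, hV, mapsTo_id _, mapsTo_id _, fun _ _ => rfl, fun _ _ => rfl,
    contDiffOn_id, contDiffOn_id⟩, fun _ _ => rfl, ?_⟩
  have : pushField id id = LinearMap.id := by ext1 Q; ext1 w; simp [pushField_apply]
  rw [this, Submodule.map_id]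
  exact h

theorem FiberEquivalent.restrict (h : FiberEquivalent V A W B) {W' : Set Pt} (hW' : IsOpen W')
    (hsub : W' ⊆ W) (hne : W'.Nonempty) :
    ∃ V' ⊆ V, IsOpen V' ∧ V'.Nonempty ∧ FiberEquivalent V' A W' B := by
  obtain ⟨Φ, Ψ, hd, ht, h1⟩ := h
  have h2 := (hd.symm.restrict hW' hsub).symm
  obtain ⟨w, hw⟩ := hne
  exact ⟨_, inter_subset_left, h2.isOpen_source, ⟨Ψ w, h2.mapsTo_inv hw⟩, Φ, Ψ, h2,
    fun p hp => ht p hp.1, h1.mono hsub⟩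

theorem Equivalent.restrict {W' : Set Pt} (h : Equivalent V A W B) (hV : IsOpen V)
    (hW' : IsOpen W') (hsub : W' ⊆ W) (hne : W'.Nonempty) :
    ∃ V' ⊆ V, IsOpen V' ∧ V'.Nonempty ∧ Equivalent V' A W' B := by
  obtain ⟨Φ, Ψ, h1, h2, h3, h4, h5, h6, ⟨T, hT⟩, ⟨S, hS⟩, h7, h8⟩ := h
  obtain ⟨w, hw⟩ := hne
  refine ⟨V ∩ Φ ⁻¹' W', inter_subset_left, h5.continuousOn.isOpen_inter_preimage hV hW',
    ⟨Ψ w, h2 (hsub hw), by rw [mem_preimage, h4 (hsub hw)]; exact hw⟩, Φ, Ψ, fun p hp => hp.2,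
    fun p hp => ⟨h2 (hsub hp), by rw [mem_preimage, h4 (hsub hp)]; exact hp⟩,
    h3.mono inter_subset_left, h4.mono hsub, h5.mono inter_subset_left, h6.mono hsub,
    ⟨T, fun p hp => hT p hp.1⟩, ⟨S, fun p hp => hS p (hsub hp)⟩, ?_, ?_⟩
  · intro Q hQ
    obtain ⟨R, hR, h⟩ := h7 Q hQ
    exact ⟨R, hR, fun p hp => h p hp.1⟩
  · intro R hR
    obtain ⟨Q, hQ, h⟩ := h8 R hR
    exact ⟨Q, hQ, fun p hp => h p hp.1⟩

theorem Equivalent.trans {X : Set Pt} {C : Submodule ℝ VField} (h : Equivalent V A W B)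
    (h' : Equivalent W B X C) (hV : IsOpen V) (hW : IsOpen W) : Equivalent V A X C := by
  obtain ⟨Φ, Ψ, h1, h2, h3, h4, h5, h6, ⟨T, hT⟩, ⟨S, hS⟩, h7, h8⟩ := h
  obtain ⟨Φ', Ψ', h1', h2', h3', h4', h5', h6', ⟨T', hT'⟩, ⟨S', hS'⟩, h7', h8'⟩ := h'
  have hfd : ∀ p ∈ V, ∀ v, fderiv ℝ (Φ' ∘ Φ) p v = fderiv ℝ Φ' (Φ p) (fderiv ℝ Φ p v) := by
    intro p hp v
    rw [fderiv_comp]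
    · rfl
    · exact (h5'.contDiffAt (hW.mem_nhds (h1 hp))).differentiableAt (by simp)
    · exact (h5.contDiffAt (hV.mem_nhds hp)).differentiableAt (by simp)
  refine ⟨Φ' ∘ Φ, Ψ ∘ Ψ', h1'.comp h1, h2.comp h2', fun p hp => ?_, fun p hp => ?_,
    h5'.comp h5 h1, h6.comp h6' h2', ⟨T' ∘ T, fun p hp => ?_⟩, ⟨S ∘ S', fun p hp => ?_⟩, ?_, ?_⟩
  · simp [h3' (h1 hp), h3 hp]
  · simp [h4 (h2' hp), h4' hp]
  · simp [hT' _ (h1 hp), hT p hp]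
  · simp [hS _ (h2' hp), hS' p hp]
  · intro Q hQ
    obtain ⟨R, hR, h⟩ := h7 Q hQ
    obtain ⟨R', hR', h'⟩ := h7' R hR
    exact ⟨R', hR', fun p hp => by rw [hfd p hp, h p hp, h' _ (h1 hp)]; rfl⟩
  · intro R' hR'
    obtain ⟨R, hR, h'⟩ := h8' R' hR'
    obtain ⟨Q, hQ, h⟩ := h8 R hR
    exact ⟨Q, hQ, fun p hp => by rw [hfd p hp, h p hp, h' _ (h1 hp)]; rfl⟩

theorem FiberEquivalent.trans {X : Set Pt} {C : Submodule ℝ VField}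
    (h : FiberEquivalent V A W B) (h' : FiberEquivalent W B X C) : FiberEquivalent V A X C := by
  obtain ⟨Φ, Ψ, hd, ht, h1, h2⟩ := h
  obtain ⟨Φ', Ψ', hd', ht', h1', h2'⟩ := h'
  have hpush : ∀ Q : VField, ∀ w ∈ X, pushField (Φ' ∘ Φ) (Ψ ∘ Ψ') Q w =
      pushField Φ' Ψ' (pushField Φ Ψ Q) w := by
    intro Q w hw
    have e : Φ (Ψ (Ψ' w)) = Ψ' w := hd.right_inv (hd'.mapsTo_inv hw)
    simp only [pushField_apply, Function.comp_apply]
    rw [fderiv_comp, e]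
    · rfl
    · rw [e]
      exact (hd'.smooth.contDiffAt (hd'.1.mem_nhds (hd'.mapsTo_inv hw))).differentiableAt (by simp)
    · exact (hd.smooth.contDiffAt (hd.1.mem_nhds (hd.mapsTo_inv (hd'.mapsTo_inv hw)))).differentiableAt
        (by simp)
  refine ⟨Φ' ∘ Φ, Ψ ∘ Ψ', ⟨hd.1, hd'.2, hd'.3.comp hd.3, hd.4.comp hd'.4, fun p hp => ?_,
    fun p hp => ?_, hd'.7.comp hd.7 hd.3, hd.8.comp hd'.8 hd'.4⟩, fun p hp => ?_, ?_, ?_⟩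
  · simp [hd'.5 (hd.3 hp), hd.5 hp]
  · simp [hd.6 (hd'.4 hp), hd'.6 hp]
  · simp [ht' _ (hd.3 hp), ht p hp]
  · rintro _ ⟨Q, hQ, rfl⟩
    obtain ⟨R, hR, e⟩ := h1 _ (Submodule.mem_map_of_mem hQ)
    obtain ⟨S, hS, e'⟩ := h1' _ (Submodule.mem_map_of_mem hR)
    refine ⟨S, hS, fun w hw => ?_⟩
    rw [hpush Q w hw, ← e' hw]
    exact congrArg (fderiv ℝ Φ' (Ψ' w)) (e (hd'.4 hw))
  · intro S hS
    obtain ⟨_, ⟨R, hR, rfl⟩, e'⟩ := h2' S hS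
    obtain ⟨_, ⟨Q, hQ, rfl⟩, e⟩ := h2 R hR
    refine ⟨_, Submodule.mem_map_of_mem hQ, fun w hw => ?_⟩
    rw [hpush Q w hw, ← e' hw]
    exact congrArg (fderiv ℝ Φ' (Ψ' w)) (e (hd'.4 hw))

end Equivalence
end EvolEq

namespace EvolEq
open Set Filter Topology

/-! ### Product and chain rules for the partial derivatives -/

section Calculus

variable {N : Set (ℝ × ℝ)} {f g : ℝ × ℝ → ℝ}

theorem Dx_congr (hN : IsOpen N) (h : EqOn f g N) : EqOn (Dx f) (Dx g) N := fun z hz => by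
  rw [Dx, Dx, (h.eventuallyEq_of_mem (hN.mem_nhds hz)).fderiv_eq]

theorem Dt_congr (hN : IsOpen N) (h : EqOn f g N) : EqOn (Dt f) (Dt g) N := fun z hz => by
  rw [Dt, Dt, (h.eventuallyEq_of_mem (hN.mem_nhds hz)).fderiv_eq]

theorem contDiffOn_Dx (hN : IsOpen N) (hf : ContDiffOn ℝ ∞ f N) : ContDiffOn ℝ ∞ (Dx f) N :=
  (hf.fderiv_of_isOpen hN (by simp)).clm_apply contDiffOn_const

theorem contDiffOn_Dt (hN : IsOpen N) (hf : ContDiffOn ℝ ∞ f N) : ContDiffOn ℝ ∞ (Dt f) N :=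
  (hf.fderiv_of_isOpen hN (by simp)).clm_apply contDiffOn_const

theorem contDiff_Dx (hf : ContDiff ℝ ∞ f) : ContDiff ℝ ∞ (Dx f) :=
  contDiffOn_univ.1 (contDiffOn_Dx isOpen_univ hf.contDiffOn)

theorem contDiff_Dt (hf : ContDiff ℝ ∞ f) : ContDiff ℝ ∞ (Dt f) :=
  contDiffOn_univ.1 (contDiffOn_Dt isOpen_univ hf.contDiffOn)

theorem differentiableAt_of_contDiffOn {E F : Type*} [NormedAddCommGroup E] [NormedSpace ℝ E]
    [NormedAddCommGroup F] [NormedSpace ℝ F] {f : E → F} {N : Set E} (hN : IsOpen N)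
    (hf : ContDiffOn ℝ ∞ f N) {z : E} (hz : z ∈ N) : DifferentiableAt ℝ f z :=
  (hf.contDiffAt (hN.mem_nhds hz)).differentiableAt (by simp)

theorem Dx_mul (hN : IsOpen N) (hf : ContDiffOn ℝ ∞ f N) (hg : ContDiffOn ℝ ∞ g N) :
    EqOn (Dx (f * g)) (Dx f * g + f * Dx g) N := fun z hz => by
  have h := ((differentiableAt_of_contDiffOn hN hf hz).hasFDerivAt.mul
    (differentiableAt_of_contDiffOn hN hg hz).hasFDerivAt).fderiv
  simp only [Dx, h, Pi.add_apply, Pi.mul_apply, add_apply, smul_apply,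
    smul_eq_mul]
  ring

theorem Dt_mul (hN : IsOpen N) (hf : ContDiffOn ℝ ∞ f N) (hg : ContDiffOn ℝ ∞ g N) :
    EqOn (Dt (f * g)) (Dt f * g + f * Dt g) N := fun z hz => by
  have h := ((differentiableAt_of_contDiffOn hN hf hz).hasFDerivAt.mul
    (differentiableAt_of_contDiffOn hN hg hz).hasFDerivAt).fderiv
  simp only [Dt, h, Pi.add_apply, Pi.mul_apply, add_apply, smul_apply,
    smul_eq_mul]
  ring

theorem Dx_add (hN : IsOpen N) (hf : ContDiffOn ℝ ∞ f N) (hg : ContDiffOn ℝ ∞ g N) :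
    EqOn (Dx (f + g)) (Dx f + Dx g) N := fun z hz => by
  have h := ((differentiableAt_of_contDiffOn hN hf hz).hasFDerivAt.add
    (differentiableAt_of_contDiffOn hN hg hz).hasFDerivAt).fderiv
  simp [Dx, h]

theorem Dt_add (hN : IsOpen N) (hf : ContDiffOn ℝ ∞ f N) (hg : ContDiffOn ℝ ∞ g N) :
    EqOn (Dt (f + g)) (Dt f + Dt g) N := fun z hz => by
  have h := ((differentiableAt_of_contDiffOn hN hf hz).hasFDerivAt.add
    (differentiableAt_of_contDiffOn hN hg hz).hasFDerivAt).fderiv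
  simp [Dt, h]

theorem Dx_Dx_add (hN : IsOpen N) (hf : ContDiffOn ℝ ∞ f N) (hg : ContDiffOn ℝ ∞ g N) :
    EqOn (Dx (Dx (f + g))) (Dx (Dx f) + Dx (Dx g)) N :=
  (Dx_congr hN (Dx_add hN hf hg)).trans (Dx_add hN (contDiffOn_Dx hN hf) (contDiffOn_Dx hN hg))


theorem Dx_Dx_Dx_add (hN : IsOpen N) (hf : ContDiffOn ℝ ∞ f N) (hg : ContDiffOn ℝ ∞ g N) :
    EqOn (Dx (Dx (Dx (f + g)))) (Dx (Dx (Dx f)) + Dx (Dx (Dx g))) N :=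
  (Dx_congr hN (Dx_Dx_add hN hf hg)).trans
    (Dx_add hN (contDiffOn_Dx hN (contDiffOn_Dx hN hf)) (contDiffOn_Dx hN (contDiffOn_Dx hN hg)))

theorem Dx_Dx_mul (hN : IsOpen N) (hf : ContDiffOn ℝ ∞ f N) (hg : ContDiffOn ℝ ∞ g N) {z : ℝ × ℝ}
    (hz : z ∈ N) : Dx (Dx (f * g)) z =
      Dx (Dx f) z * g z + 2 * Dx f z * Dx g z + f z * Dx (Dx g) z := by
  have hf1 := contDiffOn_Dx hN hf
  have hg1 := contDiffOn_Dx hN hg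
  have hfg : ContDiffOn ℝ ∞ (Dx f * g) N := hf1.mul hg
  have hgf : ContDiffOn ℝ ∞ (f * Dx g) N := hf.mul hg1
  rw [Dx_congr hN (Dx_mul hN hf hg) hz, Dx_add hN hfg hgf hz, Pi.add_apply,
    Dx_mul hN hf1 hg hz, Dx_mul hN hf hg1 hz]
  simp only [Pi.add_apply, Pi.mul_apply]
  ring

theorem Dx_Dx_Dx_mul (hN : IsOpen N) (hf : ContDiffOn ℝ ∞ f N) (hg : ContDiffOn ℝ ∞ g N)
    {z : ℝ × ℝ} (hz : z ∈ N) : Dx (Dx (Dx (f * g))) z =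
      Dx (Dx (Dx f)) z * g z + 3 * Dx (Dx f) z * Dx g z + 3 * Dx f z * Dx (Dx g) z
        + f z * Dx (Dx (Dx g)) z := by
  have hf1 := contDiffOn_Dx hN hf
  have hg1 := contDiffOn_Dx hN hg
  have hfg : ContDiffOn ℝ ∞ (Dx f * g) N := hf1.mul hg
  have hgf : ContDiffOn ℝ ∞ (f * Dx g) N := hf.mul hg1
  rw [Dx_congr hN (Dx_congr hN (Dx_mul hN hf hg)) hz, Dx_Dx_add hN hfg hgf hz,
    Pi.add_apply, Dx_Dx_mul hN hf1 hg hz, Dx_Dx_mul hN hf hg1 hz]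
  ring

section Composition

variable {h ξ : ℝ × ℝ → ℝ} {O : Set (ℝ × ℝ)}

theorem hasFDerivAt_comp_graph (hN : IsOpen N) (hO : IsOpen O) (hξ : ContDiffOn ℝ ∞ ξ N)
    (hh : ContDiffOn ℝ ∞ h O) (hm : ∀ z ∈ N, (z.1, ξ z) ∈ O) {z : ℝ × ℝ} (hz : z ∈ N) :
    HasFDerivAt (fun z => h (z.1, ξ z))
      (fderiv ℝ h (z.1, ξ z) ∘L ((ContinuousLinearMap.fst ℝ ℝ ℝ).prod (fderiv ℝ ξ z))) z :=
  (differentiableAt_of_contDiffOn hO hh (hm z hz)).hasFDerivAt.comp z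
    (f := fun z : ℝ × ℝ => (z.1, ξ z))
    (hasFDerivAt_fst.prodMk (differentiableAt_of_contDiffOn hN hξ hz).hasFDerivAt)

theorem contDiffOn_comp_graph (hξ : ContDiffOn ℝ ∞ ξ N)
    (hh : ContDiffOn ℝ ∞ h O) (hm : ∀ z ∈ N, (z.1, ξ z) ∈ O) :
    ContDiffOn ℝ ∞ (fun z => h (z.1, ξ z)) N :=
  hh.comp (contDiffOn_fst.prodMk hξ) hm

theorem Dx_comp_graph (hN : IsOpen N) (hO : IsOpen O) (hξ : ContDiffOn ℝ ∞ ξ N)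
    (hh : ContDiffOn ℝ ∞ h O) (hm : ∀ z ∈ N, (z.1, ξ z) ∈ O) :
    EqOn (Dx fun z => h (z.1, ξ z)) ((fun z => Dx h (z.1, ξ z)) * Dx ξ) N := fun z hz => by
  have e : (((0 : ℝ), fderiv ℝ ξ z (0, 1)) : ℝ × ℝ) = fderiv ℝ ξ z (0, 1) • ((0 : ℝ), (1 : ℝ)) := by
    simp
  rw [Dx, (hasFDerivAt_comp_graph hN hO hξ hh hm hz).fderiv]
  change fderiv ℝ h (z.1, ξ z) (0, fderiv ℝ ξ z (0, 1)) =
    fderiv ℝ h (z.1, ξ z) (0, 1) * fderiv ℝ ξ z (0, 1)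
  rw [e, map_smul, smul_eq_mul, mul_comm]

theorem Dt_comp_graph (hN : IsOpen N) (hO : IsOpen O) (hξ : ContDiffOn ℝ ∞ ξ N)
    (hh : ContDiffOn ℝ ∞ h O) (hm : ∀ z ∈ N, (z.1, ξ z) ∈ O) {z : ℝ × ℝ} (hz : z ∈ N) :
    Dt (fun z => h (z.1, ξ z)) z = Dt h (z.1, ξ z) + Dx h (z.1, ξ z) * Dt ξ z := by
  have e : (((1 : ℝ), fderiv ℝ ξ z (1, 0)) : ℝ × ℝ) =
      (1, 0) + fderiv ℝ ξ z (1, 0) • ((0 : ℝ), (1 : ℝ)) := by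
    simp
  rw [Dt, (hasFDerivAt_comp_graph hN hO hξ hh hm hz).fderiv]
  change fderiv ℝ h (z.1, ξ z) (1, fderiv ℝ ξ z (1, 0)) =
    fderiv ℝ h (z.1, ξ z) (1, 0) + fderiv ℝ h (z.1, ξ z) (0, 1) * fderiv ℝ ξ z (1, 0)
  rw [e, map_add, map_smul, smul_eq_mul, mul_comm]

theorem Dx_Dx_comp_graph (hN : IsOpen N) (hO : IsOpen O) (hξ : ContDiffOn ℝ ∞ ξ N)
    (hh : ContDiffOn ℝ ∞ h O) (hm : ∀ z ∈ N, (z.1, ξ z) ∈ O) {z : ℝ × ℝ} (hz : z ∈ N) :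
    Dx (Dx (fun z => h (z.1, ξ z))) z =
      Dx (Dx h) (z.1, ξ z) * Dx ξ z ^ 2 + Dx h (z.1, ξ z) * Dx (Dx ξ) z := by
  have h1 := contDiffOn_Dx hO hh
  rw [Dx_congr hN (Dx_comp_graph hN hO hξ hh hm) hz,
    Dx_mul hN (contDiffOn_comp_graph hξ h1 hm) (contDiffOn_Dx hN hξ) hz, Pi.add_apply,
    Pi.mul_apply, Dx_comp_graph hN hO hξ h1 hm hz]
  simp only [Pi.mul_apply]
  ring

theorem Dx_Dx_Dx_comp_graph (hN : IsOpen N) (hO : IsOpen O) (hξ : ContDiffOn ℝ ∞ ξ N)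
    (hh : ContDiffOn ℝ ∞ h O) (hm : ∀ z ∈ N, (z.1, ξ z) ∈ O) {z : ℝ × ℝ} (hz : z ∈ N) :
    Dx (Dx (Dx (fun z => h (z.1, ξ z)))) z =
      Dx (Dx (Dx h)) (z.1, ξ z) * Dx ξ z ^ 3 + 3 * Dx (Dx h) (z.1, ξ z) * Dx ξ z * Dx (Dx ξ) z
        + Dx h (z.1, ξ z) * Dx (Dx (Dx ξ)) z := by
  have h1 := contDiffOn_Dx hO hh
  rw [Dx_congr hN (Dx_congr hN (Dx_comp_graph hN hO hξ hh hm)) hz,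
    Dx_Dx_mul hN (contDiffOn_comp_graph hξ h1 hm) (contDiffOn_Dx hN hξ) hz,
    Dx_Dx_comp_graph hN hO hξ h1 hm hz, Dx_comp_graph hN hO hξ h1 hm hz]
  simp only [Pi.mul_apply]
  ring

/-- If an operator `∂_t - F ∂_x³ + p₂ ∂_x² + p₁ ∂_x + m` annihilates `η`, `ξ η` and `h(t, ξ) η`,
then `h` solves a linear third-order equation without lower-order terms. -/
theorem linear_equation_of_annihilated (hN : IsOpen N) {η : ℝ × ℝ → ℝ}
    (hξ : ContDiffOn ℝ ∞ ξ N) (hη : ContDiffOn ℝ ∞ η N) {z : ℝ × ℝ} (hz : z ∈ N) (hη0 : η z ≠ 0)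
    (F m p₁ p₂ : ℝ)
    (h0 : Dt η z + m + p₁ * Dx η z + p₂ * Dx (Dx η) z - F * Dx (Dx (Dx η)) z = 0)
    (h1 : Dt (ξ * η) z + ξ z * m + p₁ * Dx (ξ * η) z + p₂ * Dx (Dx (ξ * η)) z
      - F * Dx (Dx (Dx (ξ * η))) z = 0) :
    ∃ K : ℝ, ∀ (h : ℝ × ℝ → ℝ) (O : Set (ℝ × ℝ)), IsOpen O → ContDiffOn ℝ ∞ h O →
      (∀ z ∈ N, (z.1, ξ z) ∈ O) →
      (let H := fun z => h (z.1, ξ z)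
       Dt (H * η) z + H z * m + p₁ * Dx (H * η) z + p₂ * Dx (Dx (H * η)) z
        - F * Dx (Dx (Dx (H * η))) z = 0) →
      Dt h (z.1, ξ z) = F * Dx ξ z ^ 3 * Dx (Dx (Dx h)) (z.1, ξ z) + K * Dx (Dx h) (z.1, ξ z) := by
  -- `K` is the coefficient of `h_xx` in the expanded equation for `h(t, ξ) η`, moved to the
  -- right-hand side and divided by `η`.
  refine ⟨(3 * F * Dx ξ z * Dx (Dx ξ) z * η z + 3 * F * Dx ξ z ^ 2 * Dx η z
    - p₂ * Dx ξ z ^ 2 * η z) / η z, fun h O hO hh hm h2 => ?_⟩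
  have hH := contDiffOn_comp_graph hξ hh hm
  simp only at h2
  rw [Dt_mul hN hξ hη hz, Dx_mul hN hξ hη hz, Dx_Dx_mul hN hξ hη hz, Dx_Dx_Dx_mul hN hξ hη hz] at h1
  rw [Dt_mul hN hH hη hz, Dx_mul hN hH hη hz, Dx_Dx_mul hN hH hη hz, Dx_Dx_Dx_mul hN hH hη hz] at h2
  simp only [Pi.add_apply, Pi.mul_apply] at h1 h2
  rw [Dt_comp_graph hN hO hξ hh hm hz, Dx_comp_graph hN hO hξ hh hm hz,
    Dx_Dx_comp_graph hN hO hξ hh hm hz, Dx_Dx_Dx_comp_graph hN hO hξ hh hm hz] at h2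
  simp only [Pi.mul_apply] at h2
  field_simp
  -- Subtracting `h` times the equation for `η` removes the terms without derivatives of `h`. The
  -- equation for `ξ η` minus `ξ` times that for `η` is exactly the factor of `h_x`.
  linear_combination h2 - h (z.1, ξ z) * h0 - Dx h (z.1, ξ z) * (h1 - ξ z * h0)

end Composition

end Calculus

/-! ### Linearity of the symmetry condition in the characteristic -/

section Symmetry

/-- For a field without `∂_t`-component at the given point, the symmetry condition is a linear
third-order condition on the characteristic. -/
theorem exists_symmetry_coefficients (F G : Jet → ℝ) (u : ℝ × ℝ → ℝ) (z : ℝ × ℝ) :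
    ∃ k₁ k₂ p₁ p₂ : ℝ, ∀ Q : VField, (Q (graphPt u z)).1 = 0 →
      prCoeff Q u Dt z
        - (fderiv ℝ F (jet u z) (prJet Q u z) * Dx (Dx (Dx u)) z
            + F (jet u z) * prCoeff Q u (fun h => Dx (Dx (Dx h))) z
            + fderiv ℝ G (jet u z) (prJet Q u z)) =
      Dt (characteristic Q u) z
        + (k₁ * (Q (graphPt u z)).2.1 + k₂ * (Q (graphPt u z)).2.2)
        + p₁ * Dx (characteristic Q u) z + p₂ * Dx (Dx (characteristic Q u)) z
        - F (jet u z) * Dx (Dx (Dx (characteristic Q u))) z := by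
  -- `L` is the differential of `F u₃ + G` with `u₃` held fixed. The coefficients are values of `-L`
  -- on directions in the jet space; `k₁` also collects the terms `b D_J(u_x)` of the prolongation.
  let L : Jet →L[ℝ] ℝ := Dx (Dx (Dx u)) z • fderiv ℝ F (jet u z) + fderiv ℝ G (jet u z)
  refine ⟨Dt (Dx u) z - F (jet u z) * Dx (Dx (Dx (Dx u))) z
      - L (0, 1, 0, Dx (Dx u) z, Dx (Dx (Dx u)) z), -L (0, 0, 1, 0, 0), -L (0, 0, 0, 1, 0),
    -L (0, 0, 0, 0, 1), fun Q hQ => ?_⟩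
  have hJ : prJet Q u z = (Q (graphPt u z)).2.1 • ((0, 1, 0, Dx (Dx u) z, Dx (Dx (Dx u)) z) : Jet)
      + (Q (graphPt u z)).2.2 • ((0, 0, 1, 0, 0) : Jet)
      + Dx (characteristic Q u) z • ((0, 0, 0, 1, 0) : Jet)
      + Dx (Dx (characteristic Q u)) z • ((0, 0, 0, 0, 1) : Jet) := by
    simp only [prJet, prCoeff, hQ]
    ext <;> simp <;> ring
  have hL : fderiv ℝ F (jet u z) (prJet Q u z) * Dx (Dx (Dx u)) z
      + fderiv ℝ G (jet u z) (prJet Q u z) = L (prJet Q u z) := by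
    simp only [L, add_apply, smul_apply, smul_eq_mul]
    ring
  rw [add_right_comm, hL, hJ]
  simp only [map_add, map_smul, smul_eq_mul, prCoeff, hQ]
  ring

end Symmetry
end EvolEq

namespace EvolEq
open Set Filter Topology

/-! ### Test functions with a prescribed jet -/

section Families

theorem Dx_eq_of_hasDerivAt {h : ℝ × ℝ → ℝ} {z : ℝ × ℝ} {d : ℝ} (hd : DifferentiableAt ℝ h z)
    (hx : HasDerivAt (fun x => h (z.1, x)) d z.2) : Dx h z = d := by
  have h1 : HasDerivAt (fun x : ℝ => (z.1, x)) ((0 : ℝ), (1 : ℝ)) z.2 :=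
    (hasDerivAt_const _ _).prodMk (hasDerivAt_id _)
  exact (hd.hasFDerivAt.comp_hasDerivAt (f := fun x : ℝ => (z.1, x)) z.2 h1).unique hx

theorem Dt_eq_of_hasDerivAt {h : ℝ × ℝ → ℝ} {z : ℝ × ℝ} {d : ℝ} (hd : DifferentiableAt ℝ h z)
    (hx : HasDerivAt (fun t => h (t, z.2)) d z.1) : Dt h z = d := by
  have h1 : HasDerivAt (fun t : ℝ => (t, z.2)) ((1 : ℝ), (0 : ℝ)) z.1 :=
    (hasDerivAt_id _).prodMk (hasDerivAt_const _ _)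
  exact (hd.hasFDerivAt.comp_hasDerivAt (f := fun t : ℝ => (t, z.2)) z.1 h1).unique hx

/-- A function with prescribed second-order jet in `x` at `p` and constant derivative in `t`. -/
noncomputable def quadFun (p : Pt) (m₁ m₂ κ τ : ℝ) (z : ℝ × ℝ) : ℝ :=
  p.2.2 + m₁ * (z.2 - p.2.1) + m₂ / 2 * (z.2 - p.2.1) ^ 2 + κ * (z.1 - τ)

variable (p : Pt) (m₁ m₂ κ τ : ℝ)

theorem contDiff_quadFun : ContDiff ℝ ∞ (quadFun p m₁ m₂ κ τ) := by
  unfold quadFun; fun_prop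

theorem Dx_quadFun : Dx (quadFun p m₁ m₂ κ τ) = fun z => m₁ + m₂ * (z.2 - p.2.1) := by
  ext1 z
  refine Dx_eq_of_hasDerivAt ((contDiff_quadFun p m₁ m₂ κ τ).differentiable (by simp) z) ?_
  have h1 : HasDerivAt (fun x : ℝ => x - p.2.1) 1 z.2 := (hasDerivAt_id _).sub_const _
  have h2 := (((h1.const_mul m₁).const_add p.2.2).add ((h1.pow 2).const_mul (m₂ / 2))).add_const
    (κ * (z.1 - τ))
  refine h2.congr_deriv ?_
  simp; ring

theorem Dx_Dx_quadFun : Dx (Dx (quadFun p m₁ m₂ κ τ)) = fun _ => m₂ := by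
  rw [Dx_quadFun]
  ext1 z
  refine Dx_eq_of_hasDerivAt (by fun_prop) ?_
  have h1 : HasDerivAt (fun x : ℝ => x - p.2.1) 1 z.2 := (hasDerivAt_id _).sub_const _
  simpa using (h1.const_mul m₂).const_add m₁

theorem Dx_Dx_Dx_quadFun : Dx (Dx (Dx (quadFun p m₁ m₂ κ τ))) = fun _ => 0 := by
  rw [Dx_Dx_quadFun]
  ext1 z
  exact Dx_eq_of_hasDerivAt (by fun_prop) (hasDerivAt_const _ _)

theorem Dt_quadFun : Dt (quadFun p m₁ m₂ κ τ) = fun _ => κ := by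
  ext1 z
  refine Dt_eq_of_hasDerivAt ((contDiff_quadFun p m₁ m₂ κ τ).differentiable (by simp) z) ?_
  have h1 : HasDerivAt (fun t : ℝ => t - τ) 1 z.1 := (hasDerivAt_id _).sub_const _
  simpa [quadFun] using (h1.const_mul κ).const_add (p.2.2 + m₁ * (z.2 - p.2.1) + m₂ / 2 * (z.2 - p.2.1) ^ 2)

/-- The term `κ (t - τ)` vanishes at time `τ`, so `u_t` can be adjusted to satisfy the equation at
one instant without moving the second-order jet there. -/
theorem jet_quadFun (z : ℝ × ℝ) (hz : z.1 = τ) :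
    jet (quadFun p m₁ m₂ κ τ) z = jet (quadFun p m₁ m₂ 0 0) z := by
  simp only [jet, Dx_Dx_quadFun]
  simp [Dx_quadFun, quadFun, hz]

theorem graphPt_quadFun (z : ℝ × ℝ) (hz : z.1 = τ) :
    graphPt (quadFun p m₁ m₂ κ τ) z = graphPt (quadFun p m₁ m₂ 0 0) z := by
  simp [graphPt, quadFun, hz]

theorem jet_quadFun_self :
    jet (quadFun p m₁ m₂ 0 0) (p.1, p.2.1) = (p.1, p.2.1, p.2.2, m₁, m₂) := by
  simp only [jet, Dx_Dx_quadFun]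
  simp [Dx_quadFun, quadFun]

theorem graphPt_quadFun_self : graphPt (quadFun p m₁ m₂ 0 0) (p.1, p.2.1) = p := by
  simp [graphPt, quadFun]

theorem contDiff_graphPt {u : ℝ × ℝ → ℝ} (hu : ContDiff ℝ ∞ u) : ContDiff ℝ ∞ (graphPt u) :=
  contDiff_fst.prodMk (contDiff_snd.prodMk hu)

theorem contDiff_jet {u : ℝ × ℝ → ℝ} (hu : ContDiff ℝ ∞ u) : ContDiff ℝ ∞ (jet u) :=
  contDiff_fst.prodMk (contDiff_snd.prodMk (hu.prodMk
    ((contDiff_Dx hu).prodMk (contDiff_Dx (contDiff_Dx hu)))))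

theorem contDiffOn_characteristic {u : ℝ × ℝ → ℝ} (hu : ContDiff ℝ ∞ u) {Q : VField} {V : Set Pt}
    (hQ : ContDiffOn ℝ ∞ Q V) {N : Set (ℝ × ℝ)} (hN : MapsTo (graphPt u) N V) :
    ContDiffOn ℝ ∞ (characteristic Q u) N := by
  have h := hQ.comp (contDiff_graphPt hu).contDiffOn hN
  exact (h.snd.snd.sub ((contDiff_Dt hu).contDiffOn.mul h.fst)).sub
    ((contDiff_Dx hu).contDiffOn.mul h.snd.fst)

end Families

/-! ### The two consequences of admissibility -/

section Consequences

/-- Combinations of elements of `A` with coefficients depending on `t` belong to `A` only if the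
derivatives of the coefficients satisfy the corresponding linear relation. -/
def TimeRigid (V : Set Pt) (A : Submodule ℝ VField) : Prop :=
  ∀ Q₁ ∈ A, ∀ Q₂ ∈ A, ∀ R ∈ A, ∀ (β γ : ℝ → ℝ) (I : Set ℝ), IsOpen I → ContDiffOn ℝ ∞ β I →
    ContDiffOn ℝ ∞ γ I → ∀ p ∈ V, p.1 ∈ I →
    (∀ᶠ q in 𝓝 p, R q = β q.1 • Q₁ q + γ q.1 • Q₂ q) →
    deriv β p.1 • Q₁ p + deriv γ p.1 • Q₂ p = 0

/-- The fields `h(t, X) Q` of `A`, for given `Q` and `X` such that `Q` and `X Q` belong to `A`,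
correspond to solutions `h` of one linear third-order equation. -/
def LinearCompatible (V : Set Pt) (A : Submodule ℝ VField) : Prop :=
  ∀ Q ∈ A, ∀ (X : Pt → ℝ) (V₀ : Set Pt), IsOpen V₀ → V₀ ⊆ V → ContDiffOn ℝ ∞ X V₀ →
    (∃ R ∈ A, ∀ p ∈ V₀, R p = X p • Q p) → ∀ p ∈ V₀, Q p ≠ 0 →
    (∃ v : Pt, v.1 = 0 ∧ fderiv ℝ X p v ≠ 0) →
    ∃ (O : Set (ℝ × ℝ)) (f : ℝ × ℝ → ℝ), IsOpen O ∧ (p.1, X p) ∈ O ∧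
      O ⊆ (fun q => (q.1, X q)) '' V₀ ∧ ContDiffOn ℝ ∞ f O ∧ (∀ w ∈ O, f w ≠ 0) ∧
      ∀ w ∈ O, ∃ K : ℝ, ∀ h : ℝ × ℝ → ℝ, ContDiffOn ℝ ∞ h O →
        (∃ R ∈ A, ∀ q ∈ V₀, R q = h (q.1, X q) • Q q) →
        Dt h w = f w * Dx (Dx (Dx h)) w + K * Dx (Dx h) w

variable {V : Set Pt} {A : Submodule ℝ VField} {D : Set Jet} {F G : Jet → ℝ}

theorem exists_linear_condition (hvert : ∀ Q ∈ A, ∀ p ∈ V, (Q p).1 = 0)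
    (hsym : ∀ Q ∈ A, IsSymmetry D F G Q) {u : ℝ × ℝ → ℝ} (hu : ContDiff ℝ ∞ u) {z : ℝ × ℝ}
    (hz : jet u z ∈ D) (hzV : graphPt u z ∈ V)
    (hΔ : Dt u z = F (jet u z) * Dx (Dx (Dx u)) z + G (jet u z)) :
    ∃ k₁ k₂ p₁ p₂ : ℝ, ∀ Q ∈ A,
      Dt (characteristic Q u) z
        + (k₁ * (Q (graphPt u z)).2.1 + k₂ * (Q (graphPt u z)).2.2)
        + p₁ * Dx (characteristic Q u) z + p₂ * Dx (Dx (characteristic Q u)) z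
        - F (jet u z) * Dx (Dx (Dx (characteristic Q u))) z = 0 := by
  obtain ⟨k₁, k₂, p₁, p₂, h⟩ := exists_symmetry_coefficients F G u z
  exact ⟨k₁, k₂, p₁, p₂, fun Q hQ => by
    rw [← h Q (hvert Q hQ _ hzV)]; exact hsym Q hQ u hu z hz hΔ⟩

/-- Each of the two expressions is a nonzero affine function of `s`, with at most one root, whereas
`S` is infinite. The parameter `s` will be the value of `u_x`, the expressions the characteristic of
a field and the total `x`-derivative of a function. -/
theorem exists_near_avoiding {b c α β : ℝ} (h₁ : b ≠ 0 ∨ c ≠ 0) (h₂ : α ≠ 0 ∨ β ≠ 0) {S : Set ℝ}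
    (hS : IsOpen S) (hne : S.Nonempty) : ∃ s ∈ S, c - s * b ≠ 0 ∧ α + s * β ≠ 0 := by
  have hfin : ∀ a d : ℝ, (a ≠ 0 ∨ d ≠ 0) → {s : ℝ | a + s * d = 0}.Finite := by
    intro a d h
    by_cases hd : d = 0
    · convert Set.finite_empty
      ext s
      simp_all
    · refine (Set.finite_singleton (-a / d)).subset fun s hs => ?_
      have hs' : a + s * d = 0 := hs
      rw [mem_singleton_iff, eq_div_iff hd]
      linarith
  have hinf : S.Infinite := infinite_of_mem_nhds hne.some (hS.mem_nhds hne.some_mem)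
  obtain ⟨s, hs, hs'⟩ := (hinf.sdiff ((hfin c (-b) (by simpa [or_comm] using h₁)).union
    (hfin α β h₂))).nonempty
  simp only [mem_union, mem_ofPred_eq, not_or] at hs'
  exact ⟨s, hs, by intro h; apply hs'.1; linarith, hs'.2⟩

theorem Dx_fst_mul {N : Set (ℝ × ℝ)} (hN : IsOpen N) {β : ℝ → ℝ} {f : ℝ × ℝ → ℝ}
    (hβ : ContDiffOn ℝ ∞ (fun z : ℝ × ℝ => β z.1) N) (hf : ContDiffOn ℝ ∞ f N) :
    EqOn (Dx ((fun z => β z.1) * f)) ((fun z => β z.1) * Dx f) N := fun z hz => by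
  have h1 : Dx (fun z => β z.1) z = 0 :=
    Dx_eq_of_hasDerivAt (differentiableAt_of_contDiffOn hN hβ hz) (hasDerivAt_const z.2 (β z.1))
  rw [Dx_mul hN hβ hf hz]
  simp [h1]

theorem Dx_Dx_fst_mul {N : Set (ℝ × ℝ)} (hN : IsOpen N) {β : ℝ → ℝ} {f : ℝ × ℝ → ℝ}
    (hβ : ContDiffOn ℝ ∞ (fun z : ℝ × ℝ => β z.1) N) (hf : ContDiffOn ℝ ∞ f N) :
    EqOn (Dx (Dx ((fun z => β z.1) * f))) ((fun z => β z.1) * Dx (Dx f)) N :=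
  (Dx_congr hN (Dx_fst_mul hN hβ hf)).trans (Dx_fst_mul hN hβ (contDiffOn_Dx hN hf))

theorem Dx_Dx_Dx_fst_mul {N : Set (ℝ × ℝ)} (hN : IsOpen N) {β : ℝ → ℝ} {f : ℝ × ℝ → ℝ}
    (hβ : ContDiffOn ℝ ∞ (fun z : ℝ × ℝ => β z.1) N) (hf : ContDiffOn ℝ ∞ f N) :
    EqOn (Dx (Dx (Dx ((fun z => β z.1) * f)))) ((fun z => β z.1) * Dx (Dx (Dx f))) N :=
  (Dx_congr hN (Dx_Dx_fst_mul hN hβ hf)).trans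
    (Dx_fst_mul hN hβ (contDiffOn_Dx hN (contDiffOn_Dx hN hf)))

/-- The coefficients `β`, `γ` depend on `t` alone, so in the linear symmetry condition for `R` only
the term with `∂_t` differentiates them. Subtracting `β` and `γ` times the conditions for `Q₁` and
`Q₂` leaves `β' η₁ + γ' η₂ = 0` for the characteristics. This is affine in the free value of `u_x`,
so both of its coefficients vanish. -/
theorem timeRigid_of_symmetries (hV : IsOpen V) (hsm : ∀ Q ∈ A, ContDiffOn ℝ ∞ Q V)
    (hvert : ∀ Q ∈ A, ∀ p ∈ V, (Q p).1 = 0) (hD : IsOpen D)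
    (hDV : (fun j : Jet => ((j.1, j.2.1, j.2.2.1) : Pt)) '' D = V)
    (hsym : ∀ Q ∈ A, IsSymmetry D F G Q) : TimeRigid V A := by
  intro Q₁ hQ₁ Q₂ hQ₂ R hR β γ I hI hβ hγ p hp hpI hRe
  have hp' := hp
  rw [← hDV] at hp'
  obtain ⟨j, hj, hjp⟩ := hp'
  set m := j.2.2.2.1
  set m₂ := j.2.2.2.2
  have hj' : (p.1, p.2.1, p.2.2, m, m₂) ∈ D := by
    rw [← hjp]; exact hj
  set z : ℝ × ℝ := (p.1, p.2.1)
  -- the relation for all values `s` of `u_x` that are allowed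
  have key : ∀ s : ℝ, (p.1, p.2.1, p.2.2, s, m₂) ∈ D →
      deriv β p.1 * ((Q₁ p).2.2 - s * (Q₁ p).2.1) + deriv γ p.1 * ((Q₂ p).2.2 - s * (Q₂ p).2.1)
        = 0 := by
    intro s hs
    -- The test function has `u_xxx = 0`, so the equation holds at `z` once `u_t` equals this value
    -- of `G`.
    set κ := G (p.1, p.2.1, p.2.2, s, m₂)
    set u := quadFun p s m₂ κ p.1 with hu_def
    have hu : ContDiff ℝ ∞ u := contDiff_quadFun _ _ _ _ _
    have hjet : jet u z = (p.1, p.2.1, p.2.2, s, m₂) := by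
      rw [hu_def, jet_quadFun _ _ _ _ _ z rfl, jet_quadFun_self]
    have hgr : graphPt u z = p := by
      rw [hu_def, graphPt_quadFun _ _ _ _ _ z rfl, graphPt_quadFun_self]
    obtain ⟨k₁, k₂, p₁, p₂, hlin⟩ := exists_linear_condition hvert hsym hu (z := z)
      (by rw [hjet]; exact hs) (by rw [hgr]; exact hp)
      (by rw [hjet, Dt_quadFun, Dx_Dx_Dx_quadFun]; simp [κ])
    obtain ⟨V₁, hV₁, hV₁o, hpV₁⟩ := eventually_nhds_iff.1 (hRe.and (hV.mem_nhds hp))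
    set N : Set (ℝ × ℝ) := graphPt u ⁻¹' V₁ ∩ Prod.fst ⁻¹' I
    have hN : IsOpen N :=
      (hV₁o.preimage (contDiff_graphPt hu).continuous).inter (hI.preimage continuous_fst)
    have hzN : z ∈ N := ⟨by rw [mem_preimage, hgr]; exact hpV₁, hpI⟩
    have hNV : MapsTo (graphPt u) N V := fun z hz => (hV₁ _ hz.1).2
    have hη₁ := contDiffOn_characteristic hu (hsm Q₁ hQ₁) hNV
    have hη₂ := contDiffOn_characteristic hu (hsm Q₂ hQ₂) hNV
    have hb : ContDiffOn ℝ ∞ (fun z : ℝ × ℝ => β z.1) N :=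
      hβ.comp contDiffOn_fst fun z hz => hz.2
    have hg : ContDiffOn ℝ ∞ (fun z : ℝ × ℝ => γ z.1) N :=
      hγ.comp contDiffOn_fst fun z hz => hz.2
    have hbη : ContDiffOn ℝ ∞ ((fun z : ℝ × ℝ => β z.1) * characteristic Q₁ u) N := hb.mul hη₁
    have hgη : ContDiffOn ℝ ∞ ((fun z : ℝ × ℝ => γ z.1) * characteristic Q₂ u) N := hg.mul hη₂
    have hηR : EqOn (characteristic R u) ((fun z : ℝ × ℝ => β z.1) * characteristic Q₁ u
        + (fun z : ℝ × ℝ => γ z.1) * characteristic Q₂ u) N := by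
      intro z hz
      have := (hV₁ _ hz.1).1
      simp only [characteristic, Pi.add_apply, Pi.mul_apply, this]
      simp only [Prod.snd_add, Prod.fst_add, Prod.smul_snd, Prod.smul_fst, smul_eq_mul]
      simp only [graphPt]
      ring
    have hbt : Dt (fun z : ℝ × ℝ => β z.1) z = deriv β p.1 :=
      Dt_eq_of_hasDerivAt (differentiableAt_of_contDiffOn hN hb hzN)
        (differentiableAt_of_contDiffOn hI hβ hpI).hasDerivAt
    have hgt : Dt (fun z : ℝ × ℝ => γ z.1) z = deriv γ p.1 :=
      Dt_eq_of_hasDerivAt (differentiableAt_of_contDiffOn hN hg hzN)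
        (differentiableAt_of_contDiffOn hI hγ hpI).hasDerivAt
    have e₁ := hlin Q₁ hQ₁
    have e₂ := hlin Q₂ hQ₂
    have e₃ := hlin R hR
    have hRp : R p = β p.1 • Q₁ p + γ p.1 • Q₂ p := hRe.self_of_nhds
    rw [Dt_congr hN hηR hzN, Dx_congr hN hηR hzN, Dx_congr hN (Dx_congr hN hηR) hzN,
      Dx_congr hN (Dx_congr hN (Dx_congr hN hηR)) hzN, Dt_add hN hbη hgη hzN, Dx_add hN hbη hgη hzN,
      Dx_Dx_add hN hbη hgη hzN, Dx_Dx_Dx_add hN hbη hgη hzN] at e₃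
    simp only [Pi.add_apply] at e₃
    rw [Dt_mul hN hb hη₁ hzN, Dt_mul hN hg hη₂ hzN, Dx_fst_mul hN hb hη₁ hzN,
      Dx_fst_mul hN hg hη₂ hzN, Dx_Dx_fst_mul hN hb hη₁ hzN, Dx_Dx_fst_mul hN hg hη₂ hzN,
      Dx_Dx_Dx_fst_mul hN hb hη₁ hzN, Dx_Dx_Dx_fst_mul hN hg hη₂ hzN] at e₃
    simp only [Pi.add_apply, Pi.mul_apply, hbt, hgt, hgr, hRp, Prod.snd_add, Prod.fst_add,
      Prod.smul_snd, Prod.smul_fst, smul_eq_mul] at e₁ e₂ e₃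
    have hc : ∀ Q ∈ A, characteristic Q u z = (Q p).2.2 - s * (Q p).2.1 := by
      intro Q hQ
      simp only [characteristic, hgr, hvert Q hQ p hp]
      rw [hu_def, Dx_quadFun]
      simp [z]
    rw [← hc Q₁ hQ₁, ← hc Q₂ hQ₂]
    linear_combination e₃ - β p.1 * e₁ - γ p.1 * e₂
  -- The relation holds for an open set of values `s` of `u_x`; comparing two of them separates the
  -- `∂_x`- and `∂_u`-components.
  have hS : IsOpen {s : ℝ | (p.1, p.2.1, p.2.2, s, m₂) ∈ D} := hD.preimage (by fun_prop)
  have hinf : {s : ℝ | (p.1, p.2.1, p.2.2, s, m₂) ∈ D}.Infinite :=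
    infinite_of_mem_nhds m (hS.mem_nhds hj')
  obtain ⟨s, hs, hsm'⟩ := (hinf.sdiff (finite_singleton m)).nonempty
  have k₁ := key m hj'
  have k₂ := key s hs
  have hne : s - m ≠ 0 := sub_ne_zero.2 hsm'
  have e₁ : deriv β p.1 * (Q₁ p).2.1 + deriv γ p.1 * (Q₂ p).2.1 = 0 := by
    apply mul_left_cancel₀ hne
    linear_combination k₁ - k₂
  have e₂ : deriv β p.1 * (Q₁ p).2.2 + deriv γ p.1 * (Q₂ p).2.2 = 0 := by
    linear_combination k₁ + m * e₁
  refine Prod.ext ?_ (Prod.ext ?_ ?_)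
  · simp [hvert Q₁ hQ₁ p hp, hvert Q₂ hQ₂ p hp]
  · simpa using e₁
  · simpa using e₂

/-- Choose `u` so that near `p` the characteristic of `Q` and the `x`-derivative of `ξ = X(t, x, u)`
do not vanish. Then `(t, x) ↦ (t, ξ)` is a chart, and at each of its points
`linear_equation_of_annihilated` applies with `f = F ξ_x³`. The number `K` is only needed pointwise,
but must not depend on `h`. -/
theorem linearCompatible_of_symmetries (hsm : ∀ Q ∈ A, ContDiffOn ℝ ∞ Q V)
    (hvert : ∀ Q ∈ A, ∀ p ∈ V, (Q p).1 = 0) (hD : IsOpen D)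
    (hDV : (fun j : Jet => ((j.1, j.2.1, j.2.2.1) : Pt)) '' D = V) (hF : ContDiffOn ℝ ∞ F D)
    (hF0 : ∀ j ∈ D, F j ≠ 0)
    (hsym : ∀ Q ∈ A, IsSymmetry D F G Q) : LinearCompatible V A := by
  intro Q hQ X V₀ hV₀ hV₀V hX hXQ p hp hQp hXp
  obtain ⟨R₁, hR₁, hR₁X⟩ := hXQ
  have hp' := hV₀V hp
  rw [← hDV] at hp'
  obtain ⟨j, hj, hjp⟩ := hp'
  set m₂ := j.2.2.2.2
  have hj' : (p.1, p.2.1, p.2.2, j.2.2.2.1, m₂) ∈ D := by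
    rw [← hjp]; exact hj
  have hbc : (Q p).2.1 ≠ 0 ∨ (Q p).2.2 ≠ 0 := by
    by_contra! h
    exact hQp (Prod.ext (hvert Q hQ p (hV₀V hp)) (Prod.ext h.1 h.2))
  have hab : fderiv ℝ X p (0, 1, 0) ≠ 0 ∨ fderiv ℝ X p (0, 0, 1) ≠ 0 := by
    by_contra! h
    obtain ⟨v, hv, hv'⟩ := hXp
    apply hv'
    have : v = v.2.1 • ((0, 1, 0) : Pt) + v.2.2 • ((0, 0, 1) : Pt) := by
      ext <;> simp [hv]
    rw [this, map_add, map_smul, map_smul, h.1, h.2]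
    simp
  -- `m₁` is the value of `u_x` at `p`: it keeps the jet in `D`, makes the characteristic of `Q`
  -- nonzero, and makes `X` vary in `x` along `u`.
  obtain ⟨m₁, hm₁, hη0, hξ0⟩ := exists_near_avoiding hbc hab
    (S := {s : ℝ | (p.1, p.2.1, p.2.2, s, m₂) ∈ D}) (hD.preimage (by fun_prop)) ⟨_, hj'⟩
  -- the function `u` along which everything is evaluated, and its modifications
  let U : ℝ → ℝ → ℝ × ℝ → ℝ := fun κ τ => quadFun p m₁ m₂ κ τ
  have hU : ∀ κ τ, ContDiff ℝ ∞ (U κ τ) := fun κ τ => contDiff_quadFun _ _ _ _ _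
  let ξ : ℝ → ℝ → ℝ × ℝ → ℝ := fun κ τ z => X (graphPt (U κ τ) z)
  have hξ : ∀ κ τ, ContDiffOn ℝ ∞ (ξ κ τ) (graphPt (U κ τ) ⁻¹' V₀) := fun κ τ =>
    hX.comp (contDiff_graphPt (hU κ τ)).contDiffOn fun z hz => hz
  have hgo : ∀ κ τ, IsOpen (graphPt (U κ τ) ⁻¹' V₀) := fun κ τ =>
    hV₀.preimage (contDiff_graphPt (hU κ τ)).continuous
  have hξx : ∀ κ τ, ∀ z, graphPt (U κ τ) z ∈ V₀ → Dx (ξ κ τ) z =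
      fderiv ℝ X (graphPt (U κ τ) z) (0, 1, m₁ + m₂ * (z.2 - p.2.1)) := by
    intro κ τ z hz
    have h1 : HasFDerivAt (graphPt (U κ τ)) ((ContinuousLinearMap.fst ℝ ℝ ℝ).prod
        ((ContinuousLinearMap.snd ℝ ℝ ℝ).prod (fderiv ℝ (U κ τ) z))) z :=
      hasFDerivAt_fst.prodMk (hasFDerivAt_snd.prodMk
        ((hU κ τ).differentiable (by simp) z).hasFDerivAt)
    have h2 := (differentiableAt_of_contDiffOn hV₀ hX hz).hasFDerivAt.comp z h1
    have h3 : fderiv ℝ (U κ τ) z (0, 1) = m₁ + m₂ * (z.2 - p.2.1) :=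
      congrFun (Dx_quadFun p m₁ m₂ κ τ) z
    rw [← h3, Dx]
    exact DFunLike.congr_fun h2.fderiv ((0 : ℝ), (1 : ℝ))
  have hchar : ∀ κ τ, ∀ z, graphPt (U κ τ) z ∈ V₀ → characteristic Q (U κ τ) z =
      (Q (graphPt (U κ τ) z)).2.2
        - (m₁ + m₂ * (z.2 - p.2.1)) * (Q (graphPt (U κ τ) z)).2.1 := by
    intro κ τ z hz
    have h3 : Dx (U κ τ) z = m₁ + m₂ * (z.2 - p.2.1) := congrFun (Dx_quadFun p m₁ m₂ κ τ) z
    rw [characteristic, hvert Q hQ _ (hV₀V hz), h3]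
    ring
  let N₀ : Set (ℝ × ℝ) := graphPt (U 0 0) ⁻¹' V₀
  let η := characteristic Q (U 0 0)
  have hη : ContDiffOn ℝ ∞ η N₀ :=
    contDiffOn_characteristic (hU 0 0) (hsm Q hQ) fun z hz => hV₀V hz
  have hξx0 : ContDiffOn ℝ ∞ (Dx (ξ 0 0)) N₀ := contDiffOn_Dx (hgo 0 0) (hξ 0 0)
  let N : Set (ℝ × ℝ) := (N₀ ∩ Dx (ξ 0 0) ⁻¹' {0}ᶜ) ∩ (N₀ ∩ η ⁻¹' {0}ᶜ) ∩ jet (U 0 0) ⁻¹' D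
  have hN : IsOpen N :=
    ((hξx0.continuousOn.isOpen_inter_preimage (hgo 0 0) isOpen_compl_singleton).inter
      (hη.continuousOn.isOpen_inter_preimage (hgo 0 0) isOpen_compl_singleton)).inter
      (hD.preimage (contDiff_jet (hU 0 0)).continuous)
  have hgp : graphPt (U 0 0) (p.1, p.2.1) = p := graphPt_quadFun_self _ _ _
  have hpN₀ : (p.1, p.2.1) ∈ N₀ := by rw [mem_preimage, hgp]; exact hp
  have hξp : Dx (ξ 0 0) (p.1, p.2.1) ≠ 0 := by
    rw [hξx 0 0 _ hpN₀, hgp]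
    have : ((0, 1, m₁ + m₂ * (p.2.1 - p.2.1)) : Pt) = (0, 1, 0) + m₁ • ((0, 0, 1) : Pt) := by
      ext <;> simp
    simp only [this]
    rw [map_add, map_smul]
    exact hξ0
  have hpN : (p.1, p.2.1) ∈ N := by
    refine ⟨⟨⟨hpN₀, hξp⟩, hpN₀, ?_⟩, ?_⟩
    · change η (p.1, p.2.1) ≠ 0
      simp only [η]
      rw [hchar 0 0 _ hpN₀, hgp]
      simpa using hη0
    · rw [mem_preimage, jet_quadFun_self]; exact hm₁
  have hNN₀ : N ⊆ N₀ := fun z hz => hz.1.1.1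
  -- the change of variables `(t, x) ↦ (t, X)` along `u`
  let χ : ℝ × ℝ → ℝ × ℝ := fun z => (z.1, ξ 0 0 z)
  have hχ : ContDiffOn ℝ ∞ χ N := contDiffOn_fst.prodMk ((hξ 0 0).mono hNN₀)
  have hχ' : HasFDerivAt χ ((ContinuousLinearMap.fst ℝ ℝ ℝ).prod
      (fderiv ℝ (ξ 0 0) (p.1, p.2.1))) (p.1, p.2.1) :=
    hasFDerivAt_fst.prodMk (differentiableAt_of_contDiffOn (hgo 0 0) (hξ 0 0) hpN₀).hasFDerivAt
  let e : (ℝ × ℝ) ≃L[ℝ] (ℝ × ℝ) := (LinearEquiv.ofInjectiveEndo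
    ((ContinuousLinearMap.fst ℝ ℝ ℝ).prod (fderiv ℝ (ξ 0 0) (p.1, p.2.1))).toLinearMap
    ((injective_iff_map_eq_zero _).2 fun v hv => by
      have h1 : v.1 = 0 := congrArg Prod.fst hv
      have h2 : fderiv ℝ (ξ 0 0) (p.1, p.2.1) v = 0 := congrArg Prod.snd hv
      have h3 : v = v.2 • ((0, 1) : ℝ × ℝ) := by ext <;> simp [h1]
      rw [h3, map_smul, smul_eq_mul] at h2
      have h4 : v.2 = 0 := (mul_eq_zero.1 h2).resolve_right hξp
      exact Prod.ext h1 h4)).toContinuousLinearEquiv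
  obtain ⟨φ, hpφ, hφN, hφ, hφsm⟩ := exists_smooth_inverse hN hχ hpN e
    (hχ'.congr_fderiv (ContinuousLinearMap.ext fun v => rfl))
  have hback : ∀ w ∈ φ.target, φ.symm w ∈ N := fun w hw => hφN (φ.map_target hw)
  refine ⟨φ.target, fun w => F (jet (U 0 0) (φ.symm w)) * Dx (ξ 0 0) (φ.symm w) ^ 3,
    φ.open_target, ?_, ?_, ?_, ?_, ?_⟩
  · have := φ.map_source hpφ
    rw [hφ] at this
    simpa only [χ, ξ, hgp] using this
  · intro w hw
    refine ⟨graphPt (U 0 0) (φ.symm w), hNN₀ (hback w hw), ?_⟩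
    have := φ.right_inv hw
    rw [hφ] at this
    exact this
  · have h1 : ContDiffOn ℝ ∞ (fun z => F (jet (U 0 0) z) * Dx (ξ 0 0) z ^ 3) N :=
      (hF.comp (contDiff_jet (hU 0 0)).contDiffOn fun z hz => hz.2).mul ((hξx0.mono hNN₀).pow 3)
    exact h1.comp hφsm hback
  · intro w hw
    have := hback w hw
    exact mul_ne_zero (hF0 _ this.2) (pow_ne_zero _ this.1.1.2)
  · intro w hw
    have hzN := hback w hw
    have hzw : χ (φ.symm w) = w := by rw [← hφ]; exact φ.right_inv hw
    set z := φ.symm w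
    -- The chart and `f` are fixed by `U 0 0`, which need not satisfy the equation. For each `w` the
    -- function is modified by `κ (t - z.1)` so that the equation holds at `z`; the jet and the
    -- graph point there are unchanged.
    set κ := G (jet (U 0 0) z)
    set u := U κ z.1
    have hjet : jet u z = jet (U 0 0) z := jet_quadFun _ _ _ _ _ _ rfl
    have hgr : graphPt u z = graphPt (U 0 0) z := graphPt_quadFun _ _ _ _ _ _ rfl
    have hgrV : graphPt u z ∈ V₀ := by rw [hgr]; exact hNN₀ hzN
    obtain ⟨k₁, k₂, p₁, p₂, hlin⟩ := exists_linear_condition hvert hsym (hU κ z.1) (z := z)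
      (by rw [hjet]; exact hzN.2) (hV₀V hgrV)
      (by rw [hjet]; simp [U, Dt_quadFun, Dx_Dx_Dx_quadFun, κ])
    have hχu : (z.1, ξ κ z.1 z) = w := by
      rw [← hzw]
      simp only [χ, ξ]
      rw [hgr]
    let M : Set (ℝ × ℝ) := graphPt u ⁻¹' V₀ ∩ (fun z' => (z'.1, ξ κ z.1 z')) ⁻¹' φ.target
    have hM : IsOpen M :=
      (contDiffOn_fst.prodMk (hξ κ z.1)).continuousOn.isOpen_inter_preimage (hgo κ z.1) φ.open_target
    have hzM : z ∈ M := ⟨hgrV, by rw [mem_preimage, hχu]; exact hw⟩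
    have hMV : MapsTo (graphPt u) M V := fun z hz => hV₀V hz.1
    have hηM := contDiffOn_characteristic (hU κ z.1) (hsm Q hQ) hMV
    have hξM : ContDiffOn ℝ ∞ (ξ κ z.1) M := (hξ κ z.1).mono inter_subset_left
    have hmul : ∀ R ∈ A, ∀ H : Pt → ℝ, (∀ q ∈ V₀, R q = H q • Q q) →
        Dt ((fun z => H (graphPt u z)) * characteristic Q u) z
          + H (graphPt u z) * (k₁ * (Q (graphPt u z)).2.1 + k₂ * (Q (graphPt u z)).2.2)
          + p₁ * Dx ((fun z => H (graphPt u z)) * characteristic Q u) z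
          + p₂ * Dx (Dx ((fun z => H (graphPt u z)) * characteristic Q u)) z
          - F (jet u z) * Dx (Dx (Dx ((fun z => H (graphPt u z)) * characteristic Q u))) z = 0 := by
      intro R hR H hRH
      have he : EqOn (characteristic R u) ((fun z => H (graphPt u z)) * characteristic Q u) M := by
        intro z' hz'
        simp only [characteristic, Pi.mul_apply, hRH _ hz'.1, Prod.smul_snd, Prod.smul_fst,
          smul_eq_mul]
        ring
      have h1 := hlin R hR
      rw [Dt_congr hM he hzM, Dx_congr hM he hzM, Dx_congr hM (Dx_congr hM he) hzM,
        Dx_congr hM (Dx_congr hM (Dx_congr hM he)) hzM, hRH _ hgrV] at h1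
      simp only [Prod.smul_snd, Prod.smul_fst, smul_eq_mul] at h1
      linear_combination h1
    have hη0' : characteristic Q u z ≠ 0 := by
      have h1 := hchar κ z.1 z hgrV
      have h2 := hchar 0 0 z (hNN₀ hzN)
      change characteristic Q (U κ z.1) z ≠ 0
      rw [h1]
      change graphPt (U κ z.1) z = _ at hgr
      rw [hgr, ← h2]
      exact hzN.1.2.2
    obtain ⟨K, hK⟩ := linear_equation_of_annihilated hM hξM hηM hzM hη0' (F (jet u z))
      (k₁ * (Q (graphPt u z)).2.1 + k₂ * (Q (graphPt u z)).2.2) p₁ p₂ (hlin Q hQ)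
      (hmul R₁ hR₁ X hR₁X)
    refine ⟨K, fun h hh ⟨R, hR, hRh⟩ => ?_⟩
    have := hK h φ.target φ.open_target hh (fun z hz => hz.2)
      (hmul R hR (fun q => h (q.1, X q)) hRh)
    rw [hχu, hjet] at this
    -- The modification does not affect `u_x`, hence not `ξ_x`, so the coefficient obtained is the
    -- `f` fixed in advance.
    have hx : Dx (ξ κ z.1) z = Dx (ξ 0 0) z := by
      rw [hξx κ z.1 z hgrV, hξx 0 0 z (hNN₀ hzN)]
      change graphPt (U κ z.1) z = _ at hgr
      rw [hgr]
    rw [hx] at this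
    exact this

end Consequences
end EvolEq

namespace EvolEq
open Set Filter Topology

/-! ### Constancy along coordinate lines of balls -/

section Constancy

/-- A line meets a ball in an interval, on which `f` has zero derivative. -/
theorem eq_of_fderiv_direction_eq_zero {w₀ : Pt} {r : ℝ} {f : Pt → Pt}
    (hf : ContDiffOn ℝ ∞ f (Metric.ball w₀ r)) {v : Pt}
    (h : ∀ w ∈ Metric.ball w₀ r, fderiv ℝ f w v = 0) {w w' : Pt} (hw : w ∈ Metric.ball w₀ r)
    (hw' : w' ∈ Metric.ball w₀ r) (hv : ∃ s : ℝ, w' = w + s • v) : f w' = f w := by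
  obtain ⟨s, rfl⟩ := hv
  let g : ℝ → Pt := fun τ => w + τ • v
  have hg : ∀ τ, HasDerivAt g v τ := fun τ => by
    have := ((hasDerivAt_id τ).smul_const v).const_add w
    rwa [one_smul] at this
  have hgc : Continuous g := by fun_prop
  have hS : IsOpen (g ⁻¹' Metric.ball w₀ r) := Metric.isOpen_ball.preimage hgc
  have hconv : Convex ℝ (g ⁻¹' Metric.ball w₀ r) := by
    have : g = fun τ => (AffineMap.lineMap w (w + v) : ℝ →ᵃ[ℝ] Pt) τ := by
      ext1 τ; simp [g, AffineMap.lineMap_apply, add_comm]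
    rw [this]
    exact (convex_ball w₀ r).affine_preimage _
  have hd : ∀ τ ∈ g ⁻¹' Metric.ball w₀ r, HasDerivAt (fun τ => f (g τ)) 0 τ := fun τ hτ => by
    have h1 := (differentiableAt_of_contDiffOn Metric.isOpen_ball hf hτ).hasFDerivAt.comp_hasDerivAt
      τ (hg τ)
    rwa [h _ hτ] at h1
  have := hS.is_const_of_deriv_eq_zero hconv.isPreconnected
    (fun τ hτ => (hd τ hτ).differentiableAt.differentiableWithinAt) (fun τ hτ => (hd τ hτ).deriv)
    (x := s) (y := 0) hw' (by simpa [g] using hw)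
  simpa [g] using this

theorem const_of_hasDerivAt_zero {E : Type*} [NormedAddCommGroup E] [NormedSpace ℝ E] {c r : ℝ}
    {g : ℝ → E} (h : ∀ τ ∈ Metric.ball c r, HasDerivAt g 0 τ) {a b : ℝ}
    (ha : a ∈ Metric.ball c r) (hb : b ∈ Metric.ball c r) : g a = g b :=
  Metric.isOpen_ball.is_const_of_deriv_eq_zero (convex_ball c r).isPreconnected
    (fun τ hτ => (h τ hτ).differentiableAt.differentiableWithinAt) (fun τ hτ => (h τ hτ).deriv)
    ha hb

theorem mem_ball_pt {w w₀ : Pt} {r : ℝ} : w ∈ Metric.ball w₀ r ↔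
    w.1 ∈ Metric.ball w₀.1 r ∧ w.2.1 ∈ Metric.ball w₀.2.1 r ∧ w.2.2 ∈ Metric.ball w₀.2.2 r := by
  simp only [Metric.mem_ball, Prod.dist_eq, sup_lt_iff]

theorem mem_ball_tx {z z₀ : ℝ × ℝ} {r : ℝ} : z ∈ Metric.ball z₀ r ↔
    z.1 ∈ Metric.ball z₀.1 r ∧ z.2 ∈ Metric.ball z₀.2 r := by
  simp only [Metric.mem_ball, Prod.dist_eq, sup_lt_iff]

theorem projTX_ball (w₀ : Pt) {r : ℝ} (hr : 0 < r) :
    projTX (Metric.ball w₀ r) = Metric.ball (w₀.1, w₀.2.1) r := by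
  ext z
  simp only [projTX, mem_image, mem_ball_tx]
  constructor
  · rintro ⟨p, hp, rfl⟩
    rw [mem_ball_pt] at hp
    exact ⟨hp.1, hp.2.1⟩
  · rintro ⟨h1, h2⟩
    exact ⟨(z.1, z.2, w₀.2.2), mem_ball_pt.2 ⟨h1, h2, Metric.mem_ball_self hr⟩, rfl⟩

end Constancy

/-! ### Tame algebras -/

section Tame

/-- The consequences of admissibility that are used in the classification, for an abelian algebra
of fields without `∂_t`-component; they are stable under transport by diffeomorphisms that preserve
`t`. -/
structure Tame (V : Set Pt) (A : Submodule ℝ VField) : Prop where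
  isOpen : IsOpen V
  smooth : ∀ Q ∈ A, ContDiffOn ℝ ∞ Q V
  vertical : ∀ Q ∈ A, ∀ p ∈ V, (Q p).1 = 0
  abelian : IsAbelianOn V A
  uniqueCont : ∀ Q ∈ A, ∀ U ⊆ V, IsOpen U → U.Nonempty → (∀ p ∈ U, Q p = 0) → ∀ p ∈ V, Q p = 0
  finiteDim : FiniteDimensional ℝ (restrictTo V A)
  timeRigid : TimeRigid V A
  compatible : LinearCompatible V A

variable {V W : Set Pt} {A : Submodule ℝ VField} {Φ Ψ : Pt → Pt}

theorem Tame.restrict (h : Tame V A) {V' : Set Pt} (hV' : IsOpen V') (hsub : V' ⊆ V) :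
    Tame V' A where
  isOpen := hV'
  smooth Q hQ := (h.smooth Q hQ).mono hsub
  vertical Q hQ p hp := h.vertical Q hQ p (hsub hp)
  abelian Q hQ R hR p hp := h.abelian Q hQ R hR p (hsub hp)
  uniqueCont Q hQ U hU hUo hne h0 p hp := h.uniqueCont Q hQ U (hU.trans hsub) hUo hne h0 p (hsub hp)
  finiteDim := finiteDimensional_restrictTo_mono hsub h.finiteDim
  timeRigid Q₁ hQ₁ Q₂ hQ₂ R hR β γ I hI hβ hγ p hp :=
    h.timeRigid Q₁ hQ₁ Q₂ hQ₂ R hR β γ I hI hβ hγ p (hsub hp)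
  compatible Q hQ X V₀ hV₀ hV₀V := h.compatible Q hQ X V₀ hV₀ (hV₀V.trans hsub)

theorem IsDiffeo.time_inv (h : IsDiffeo V W Φ Ψ) (ht : ∀ p ∈ V, (Φ p).1 = p.1) {w : Pt}
    (hw : w ∈ W) : (Ψ w).1 = w.1 := by
  rw [← ht _ (h.mapsTo_inv hw), h.right_inv hw]

theorem IsDiffeo.fderiv_vertical (h : IsDiffeo V W Φ Ψ) (ht : ∀ p ∈ V, (Φ p).1 = p.1) {p : Pt}
    (hp : p ∈ V) (v : Pt) : (fderiv ℝ Φ p v).1 = v.1 := by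
  have h1 := (differentiableAt_of_contDiffOn h.isOpen_source h.smooth hp).hasFDerivAt.fst
  have h2 : HasFDerivAt (fun p => (Φ p).1) (ContinuousLinearMap.fst ℝ ℝ (ℝ × ℝ)) p := by
    refine (hasFDerivAt_fst (p := p)).congr_of_eventuallyEq ?_
    filter_upwards [h.isOpen_source.mem_nhds hp] with q hq using ht q hq
  exact DFunLike.congr_fun (h1.unique h2) v

/-- Rigidity involves only functions of `t`, which the diffeomorphism preserves. The compatibility
equation lives in the variables `(t, X)`, so it suffices to pull `X` back along `Φ` and keep `O`,
`f` and `K`. -/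
theorem Tame.push (h : Tame V A) (hd : IsDiffeo V W Φ Ψ) (ht : ∀ p ∈ V, (Φ p).1 = p.1) :
    Tame W (A.map (pushField Φ Ψ)) where
  isOpen := hd.isOpen_target
  smooth := by
    rintro _ ⟨Q, hQ, rfl⟩
    exact hd.contDiffOn_pushField (h.smooth Q hQ)
  vertical := by
    rintro _ ⟨Q, hQ, rfl⟩ w hw
    rw [pushField_apply, hd.fderiv_vertical ht (hd.mapsTo_inv hw),
      h.vertical Q hQ _ (hd.mapsTo_inv hw)]
  abelian := by
    rintro _ ⟨Q, hQ, rfl⟩ _ ⟨R, hR, rfl⟩ w hw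
    rw [hd.lieBracket_pushField (h.smooth Q hQ) (h.smooth R hR) hw,
      h.abelian Q hQ R hR _ (hd.mapsTo_inv hw), map_zero]
  uniqueCont := by
    rintro _ ⟨Q, hQ, rfl⟩ U hU hUo ⟨w₁, hw₁⟩ h0 w hw
    have hU' := hd.symm.restrict hUo hU
    have : ∀ p ∈ V, Q p = 0 := by
      refine h.uniqueCont Q hQ _ inter_subset_left hU'.isOpen_target ⟨Ψ w₁, hU'.mapsTo hw₁⟩ ?_
      intro p hp
      have h1 := (hd.pushField_eq_iff (hd.mapsTo hp.1)).1 (h0 (Φ p) hp.2)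
      rwa [map_zero, hd.left_inv hp.1, eq_comm] at h1
    rw [pushField_apply, this _ (hd.mapsTo_inv hw), map_zero]
  finiteDim := hd.finiteDimensional_push h.finiteDim
  timeRigid := by
    rintro _ ⟨Q₁, hQ₁, rfl⟩ _ ⟨Q₂, hQ₂, rfl⟩ _ ⟨R, hR, rfl⟩ β γ I hI hβ hγ w hw hwI hev
    have hwV := hd.mapsTo_inv hw
    have hc : ContinuousAt Φ (Ψ w) :=
      (differentiableAt_of_contDiffOn hd.isOpen_source hd.smooth hwV).continuousAt
    rw [← hd.right_inv hw] at hev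
    have h1 := h.timeRigid Q₁ hQ₁ Q₂ hQ₂ R hR β γ I hI hβ hγ (Ψ w) hwV
      (by rwa [hd.time_inv ht hw]) (by
        filter_upwards [hc.eventually hev, hd.isOpen_source.mem_nhds hwV] with q hq hqV
        have h2 := (hd.pushField_eq_iff (hd.mapsTo hqV)).1 hq
        rw [hd.left_inv hqV] at h2
        rw [← h2, map_add, map_smul, map_smul, pushField_apply, pushField_apply, hd.left_inv hqV,
          hd.fderiv_inv_comp hqV, hd.fderiv_inv_comp hqV, ht q hqV])
    rw [hd.time_inv ht hw] at h1
    rw [pushField_apply, pushField_apply, ← map_smul, ← map_smul, ← map_add, h1, map_zero]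
  compatible := by
    rintro _ ⟨Q, hQ, rfl⟩ X V₀ hV₀ hV₀W hX ⟨_, ⟨R, hR, rfl⟩, hRX⟩ w hw hQw ⟨v, hv, hXv⟩
    have hwW := hV₀W hw
    have hd' := (hd.symm.restrict hV₀ hV₀W).symm
    have hpull : ∀ (S : VField) (g : Pt → ℝ), (∀ q ∈ V₀, pushField Φ Ψ S q = g q • pushField Φ Ψ Q q) →
        ∀ p ∈ V ∩ Φ ⁻¹' V₀, S p = g (Φ p) • Q p := by
      intro S g hS p hp
      have h2 := (hd.pushField_eq_iff (hd.mapsTo hp.1)).1 (hS _ hp.2)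
      rw [hd.left_inv hp.1] at h2
      rw [← h2, map_smul, pushField_apply, hd.left_inv hp.1, hd.fderiv_inv_comp hp.1]
    obtain ⟨O, f, hO, hwO, hOsub, hf, hf0, hK⟩ := h.compatible Q hQ (fun p => X (Φ p))
      (V ∩ Φ ⁻¹' V₀) hd'.isOpen_source inter_subset_left (hX.comp hd'.smooth hd'.mapsTo)
      ⟨R, hR, hpull R X hRX⟩ (Ψ w) (hd'.mapsTo_inv hw)
      (by
        intro h0
        apply hQw
        rw [pushField_apply, h0, map_zero])
      ⟨fderiv ℝ Ψ w v, by
          rw [hd.symm.fderiv_vertical (fun w hw => hd.time_inv ht hw) hwW, hv], by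
          have h2 : DifferentiableAt ℝ X (Φ (Ψ w)) := by
            rw [hd.right_inv hwW]; exact differentiableAt_of_contDiffOn hV₀ hX hw
          have h3 := (h2.hasFDerivAt.comp (Ψ w) (differentiableAt_of_contDiffOn hd.isOpen_source
            hd.smooth (hd.mapsTo_inv hwW)).hasFDerivAt).fderiv
          have h4 := DFunLike.congr_fun h3 (fderiv ℝ Ψ w v)
          rw [ContinuousLinearMap.comp_apply, hd.fderiv_comp_inv hwW, hd.right_inv hwW] at h4
          change fderiv ℝ (X ∘ Φ) (Ψ w) _ ≠ 0
          rwa [h4]⟩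
    refine ⟨O, f, hO, ?_, ?_, hf, hf0, ?_⟩
    · simpa only [hd.time_inv ht hwW, hd.right_inv hwW] using hwO
    · intro o ho
      obtain ⟨q, hq, rfl⟩ := hOsub ho
      exact ⟨Φ q, hq.2, by simp only [ht q hq.1]⟩
    · intro o ho
      obtain ⟨K, hK⟩ := hK o ho
      refine ⟨K, fun g hg ⟨S, hS, hSg⟩ => hK g hg ?_⟩
      obtain ⟨S', hS', rfl⟩ := hS
      refine ⟨S', hS', fun q hq => ?_⟩
      rw [hpull S' (fun q => g (q.1, X q)) hSg q hq, ht q hq.1]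

end Tame

/-! ### Straightening a field without `∂_t` -/

section Normal

/-- The types of algebras without `∂_t`. -/
def AlgType.IsVertical : AlgType → Prop
  | .u => True
  | .xu => True
  | .uxu => True
  | .uxuc => True
  | .series _ => True
  | _ => False

/-- Somewhere in `V`, the algebra `A` is equivalent to a canonical one without `∂_t`. -/
def VerticalNormal (V : Set Pt) (A : Submodule ℝ VField) : Prop :=
  ∃ V' ⊆ V, IsOpen V' ∧ V'.Nonempty ∧ ∃ (w₀ : Pt) (r : ℝ) (B : Submodule ℝ VField) (k : AlgType),
    0 < r ∧ FiberEquivalent V' A (Metric.ball w₀ r) B ∧ IsCanonical (Metric.ball w₀ r) B k ∧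
    k.IsVertical

variable {V W : Set Pt} {A B : Submodule ℝ VField}

theorem VerticalNormal.mono {V' : Set Pt} (hsub : V' ⊆ V) (h : VerticalNormal V' A) :
    VerticalNormal V A :=
  let ⟨V'', h1, h2⟩ := h
  ⟨V'', h1.trans hsub, h2⟩

theorem VerticalNormal.of_fiberEquivalent (h : FiberEquivalent V A W B) (hB : VerticalNormal W B) :
    VerticalNormal V A := by
  obtain ⟨W', hW', hW'o, hne, w₀, r, C, k, hr, he, hk⟩ := hB
  obtain ⟨V', hV', hV'o, hV'ne, he'⟩ := h.restrict hW'o hW' hne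
  exact ⟨V', hV', hV'o, hV'ne, w₀, r, C, k, hr, he'.trans he, hk⟩

theorem VerticalNormal.of_push {Φ Ψ : Pt → Pt} {V' : Set Pt} (hd : IsDiffeo V' W Φ Ψ)
    (ht : ∀ p ∈ V', (Φ p).1 = p.1) (hsub : V' ⊆ V)
    (h : VerticalNormal W (A.map (pushField Φ Ψ))) : VerticalNormal V A :=
  (h.of_fiberEquivalent (hd.fiberEquivalent_push ht A)).mono hsub

/-- At time zero the flow has velocity `f` and is the identity in the initial point. This shows that
parametrizations built from flows are nondegenerate. -/
theorem fderiv_flow_zero {f : Pt → Pt} {Fl : ℝ × Pt → Pt} {ε : ℝ} (hε : 0 < ε) {p : Pt}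
    (hsm : ContDiffOn ℝ ∞ Fl (Metric.ball (0, p) ε))
    (hFl : ∀ z ∈ Metric.ball ((0 : ℝ), p) ε, Fl (0, z.2) = z.2 ∧
        HasDerivAt (fun τ => Fl (τ, z.2)) (f (Fl z)) z.1) (v : ℝ × Pt) :
    fderiv ℝ Fl (0, p) v = v.1 • f p + v.2 := by
  have h0 : ((0 : ℝ), p) ∈ Metric.ball ((0 : ℝ), p) ε := Metric.mem_ball_self hε
  have hd := differentiableAt_of_contDiffOn Metric.isOpen_ball hsm h0
  have h1 : fderiv ℝ Fl (0, p) (1, 0) = f p := by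
    have h2 : HasDerivAt (fun τ : ℝ => (τ, p)) ((1 : ℝ), (0 : Pt)) 0 :=
      (hasDerivAt_id _).prodMk (hasDerivAt_const _ _)
    have h3 := (hd.hasFDerivAt.comp_hasDerivAt (f := fun τ : ℝ => (τ, p)) 0 h2).unique (hFl _ h0).2
    rw [h3, (hFl _ h0).1]
  have h2 : ∀ v : Pt, fderiv ℝ Fl (0, p) (0, v) = v := by
    intro v
    have h3 : HasFDerivAt (fun y : Pt => ((0 : ℝ), y)) (ContinuousLinearMap.inr ℝ ℝ Pt) p :=
      (ContinuousLinearMap.inr ℝ ℝ Pt).hasFDerivAt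
    have h4 := hd.hasFDerivAt.comp p h3
    have h5 : HasFDerivAt (Fl ∘ fun y : Pt => ((0 : ℝ), y)) (ContinuousLinearMap.id ℝ Pt) p := by
      refine (hasFDerivAt_id p).congr_of_eventuallyEq ?_
      filter_upwards [Metric.ball_mem_nhds p hε] with y hy
      refine (hFl (0, y) ?_).1
      rw [← ball_prod_same]
      exact ⟨Metric.mem_ball_self hε, hy⟩
    exact DFunLike.congr_fun (h4.unique h5) v
  have h3 : v = v.1 • ((1 : ℝ), (0 : Pt)) + ((0 : ℝ), v.2) := by ext <;> simp
  conv_lhs => rw [h3]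
  rw [map_add, map_smul, h1, h2]

/-- The `t`-coordinate has zero derivative along the flow of a field without `∂_t`, so charts built
from such a flow preserve `t`. -/
theorem flow_time_eq {f : Pt → Pt} {Fl : ℝ × Pt → Pt} {ε : ℝ} {p : Pt} {V : Set Pt}
    (hf : ∀ q ∈ V, (f q).1 = 0)
    (hFl : ∀ z ∈ Metric.ball ((0 : ℝ), p) ε, Fl z ∈ V ∧ Fl (0, z.2) = z.2 ∧
        HasDerivAt (fun τ => Fl (τ, z.2)) (f (Fl z)) z.1) {z : ℝ × Pt}
    (hz : z ∈ Metric.ball ((0 : ℝ), p) ε) : (Fl z).1 = z.2.1 := by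
  have hz' := hz
  rw [← ball_prod_same] at hz'
  have h1 : ∀ τ ∈ Metric.ball (0 : ℝ) ε, HasDerivAt (fun τ => (Fl (τ, z.2)).1) 0 τ := by
    intro τ hτ
    have hm : (τ, z.2) ∈ Metric.ball ((0 : ℝ), p) ε := by
      rw [← ball_prod_same]; exact ⟨hτ, hz'.2⟩
    have h2 : HasDerivAt (fun τ => (Fl (τ, z.2)).1) (f (Fl (τ, z.2))).1 τ :=
      (ContinuousLinearMap.fst ℝ ℝ (ℝ × ℝ)).hasFDerivAt.comp_hasDerivAt τ (hFl _ hm).2.2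
    rwa [hf _ (hFl _ hm).1] at h2
  have h2 : (Fl (z.1, z.2)).1 = (Fl (0, z.2)).1 := const_of_hasDerivAt_zero h1 hz'.1
    (Metric.mem_ball_self (dist_nonneg.trans_lt (Metric.mem_ball.1 hz'.1)))
  rw [(hFl z hz).2.1] at h2
  exact h2

/-- A nonvanishing field without `∂_t`-component is transformed into `∂_u`. -/
theorem Tame.exists_straighten_u (h : Tame V A) {Q : VField} (hQ : Q ∈ A) {p : Pt} (hp : p ∈ V)
    (hQp : Q p ≠ 0) :
    ∃ (V' : Set Pt) (Φ Ψ : Pt → Pt) (w₀ : Pt) (r : ℝ), 0 < r ∧ V' ⊆ V ∧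
      IsDiffeo V' (Metric.ball w₀ r) Φ Ψ ∧ (∀ q ∈ V', (Φ q).1 = q.1) ∧
      ∀ w ∈ Metric.ball w₀ r, pushField Φ Ψ Q w = genU w := by
  obtain ⟨Fl, ε, hε, hsm, hFl⟩ := exists_smooth_flow h.isOpen (h.smooth Q hQ) hp
  set b := (Q p).2.1
  set c := (Q p).2.2
  have ha : (Q p).1 = 0 := h.vertical Q hQ p hp
  -- The parameter `(t, x, u)` is sent to the point reached in time `u` from a point of the plane
  -- through `p` spanned by `∂_t` and `(0, c, -b)`, which is transversal to `Q p = (0, b, c)`.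
  let L : Pt →L[ℝ] ℝ × Pt :=
    ((ContinuousLinearMap.snd ℝ ℝ ℝ).comp (ContinuousLinearMap.snd ℝ ℝ (ℝ × ℝ))).prod
      ((ContinuousLinearMap.fst ℝ ℝ (ℝ × ℝ)).prod
        ((c • (ContinuousLinearMap.fst ℝ ℝ ℝ).comp (ContinuousLinearMap.snd ℝ ℝ (ℝ × ℝ))).prod
          (-b • (ContinuousLinearMap.fst ℝ ℝ ℝ).comp (ContinuousLinearMap.snd ℝ ℝ (ℝ × ℝ)))))
  have hLv : ∀ v : Pt, L v = (v.2.2, v.1, c * v.2.1, -b * v.2.1) := fun v => rfl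
  let ι : Pt → ℝ × Pt := fun w => L w + (0, 0, p.2.1, p.2.2)
  have hι : ∀ w, HasFDerivAt ι L w := fun w => L.hasFDerivAt.add_const _
  have hιsm : ContDiff ℝ ∞ ι := L.contDiff.add contDiff_const
  let w₀ : Pt := (p.1, 0, 0)
  have hι0 : ι w₀ = (0, p) := by ext <;> simp [ι, hLv, w₀]
  let N : Set Pt := ι ⁻¹' Metric.ball (0, p) ε
  have hN : IsOpen N := Metric.isOpen_ball.preimage hιsm.continuous
  have hw₀ : w₀ ∈ N := by rw [mem_preimage, hι0]; exact Metric.mem_ball_self hε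
  let Ψ : Pt → Pt := fun w => Fl (ι w)
  have hΨ : ContDiffOn ℝ ∞ Ψ N := hsm.comp hιsm.contDiffOn fun w hw => hw
  have hΨ' : ∀ w ∈ N, ∀ v, fderiv ℝ Ψ w v = fderiv ℝ Fl (ι w) (L v) := fun w hw v =>
    DFunLike.congr_fun ((differentiableAt_of_contDiffOn Metric.isOpen_ball hsm hw).hasFDerivAt.comp w
      (hι w)).fderiv v
  have hFl0 : Fl (0, p) = p := (hFl (0, p) (Metric.mem_ball_self hε)).2.1
  obtain ⟨r, hr, V', Φ, hV', hbN, hd⟩ := exists_chart hN hΨ hw₀ h.isOpen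
    (by change Fl (ι w₀) ∈ V; rw [hι0, hFl0]; exact hp) (by
      intro v hv
      rw [hΨ' _ hw₀, hι0, fderiv_flow_zero hε hsm fun z hz => (hFl z hz).2] at hv
      have h1 := congrArg Prod.fst hv
      have h2 := congrArg (fun q : Pt => q.2.1) hv
      have h3 := congrArg (fun q : Pt => q.2.2) hv
      simp only [hLv, Prod.fst_add, Prod.snd_add, Prod.smul_fst, Prod.smul_snd, smul_eq_mul,
        Prod.fst_zero, Prod.snd_zero, ha] at h1 h2 h3
      change v.2.2 * b + c * v.2.1 = 0 at h2
      change v.2.2 * c + -b * v.2.1 = 0 at h3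
      -- This is the Jacobian determinant of `Ψ` at `w₀`.
      have hbc : b ^ 2 + c ^ 2 ≠ 0 := by
        intro h0
        have hb : b = 0 := by nlinarith [sq_nonneg b, sq_nonneg c]
        have hc : c = 0 := by nlinarith [sq_nonneg b, sq_nonneg c]
        exact hQp (Prod.ext ha (Prod.ext hb hc))
      have h4 : v.2.1 = 0 := mul_left_cancel₀ hbc (by linear_combination c * h2 - b * h3)
      have h5 : v.2.2 = 0 := mul_left_cancel₀ hbc (by linear_combination b * h2 + c * h3)
      have h6 : v.1 = 0 := by simpa using h1
      exact Prod.ext h6 (Prod.ext h4 h5))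
  have htΨ : ∀ w ∈ Metric.ball w₀ r, (Ψ w).1 = w.1 := by
    intro w hw
    rw [flow_time_eq (h.vertical Q hQ) hFl (hbN hw)]
    simp [ι, hLv]
  refine ⟨V', Φ, Ψ, w₀, r, hr, hV', hd, fun q hq => hd.symm.time_inv htΨ hq, fun w hw => ?_⟩
  rw [hd.pushField_eq_iff hw, hΨ' w (hbN hw)]
  have h1 : L (genU w) = (1, 0) := by simp [hLv, genU]
  rw [h1]
  have h2 : HasDerivAt (fun τ : ℝ => (τ, (ι w).2)) ((1 : ℝ), (0 : Pt)) (ι w).1 :=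
    (hasDerivAt_id _).prodMk (hasDerivAt_const _ _)
  exact ((differentiableAt_of_contDiffOn Metric.isOpen_ball hsm (hbN hw)).hasFDerivAt.comp_hasDerivAt
    (f := fun τ : ℝ => (τ, (ι w).2)) _ h2).unique (hFl _ (hbN hw)).2.2

end Normal
end EvolEq

namespace EvolEq
open Set Filter Topology

/-! ### Coefficients of fields commuting with `∂_u` -/

section Coefficients

/-- A constant field has zero derivative, so its bracket with `S` is the derivative of `S` in its
direction. -/
theorem fderiv_eq_zero_of_lieBracket {W : Set Pt} (hW : IsOpen W) {S₀ S : VField} {v : Pt}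
    (h : EqOn S₀ (fun _ => v) W) {w : Pt} (hw : w ∈ W)
    (hb : VectorField.lieBracket ℝ S₀ S w = 0) : fderiv ℝ S w v = 0 := by
  have h1 : fderiv ℝ S₀ w = 0 := by
    rw [(h.eventuallyEq_of_mem (hW.mem_nhds hw)).fderiv_eq]
    simp
  rw [VectorField.lieBracket, h1, h hw] at hb
  simpa using hb

theorem agreeOn_span {W : Set Pt} {B : Submodule ℝ VField} {s : Set VField}
    (h₁ : ∀ g ∈ s, ∃ Q ∈ B, EqOn Q g W) (h₂ : ∀ Q ∈ B, ∃ R ∈ Submodule.span ℝ s, EqOn Q R W) :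
    AgreeOn W B (Submodule.span ℝ s) := by
  refine ⟨h₂, fun R hR => ?_⟩
  induction hR using Submodule.span_induction with
  | mem g hg => exact h₁ g hg
  | zero => exact ⟨0, B.zero_mem, fun _ _ => rfl⟩
  | add x y _ _ hx hy =>
    obtain ⟨Q, hQ, e⟩ := hx
    obtain ⟨Q', hQ', e'⟩ := hy
    exact ⟨Q + Q', B.add_mem hQ hQ', fun w hw => by simp [e hw, e' hw]⟩
  | smul a x _ hx =>
    obtain ⟨Q, hQ, e⟩ := hx
    exact ⟨a • Q, B.smul_mem a hQ, fun w hw => by simp [e hw]⟩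

theorem eq_of_Dx_eq_zero {z₀ : ℝ × ℝ} {r : ℝ} {h : ℝ × ℝ → ℝ}
    (hh : ContDiffOn ℝ ∞ h (Metric.ball z₀ r)) (h0 : ∀ z ∈ Metric.ball z₀ r, Dx h z = 0) {t x x' : ℝ}
    (hx : (t, x) ∈ Metric.ball z₀ r) (hx' : (t, x') ∈ Metric.ball z₀ r) : h (t, x) = h (t, x') := by
  rw [mem_ball_tx] at hx hx'
  refine const_of_hasDerivAt_zero (g := fun x => h (t, x)) (fun y hy => ?_) hx.2 hx'.2
  have hm : (t, y) ∈ Metric.ball z₀ r := mem_ball_tx.2 ⟨hx.1, hy⟩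
  have h1 : HasDerivAt (fun x : ℝ => (t, x)) ((0 : ℝ), (1 : ℝ)) y :=
    (hasDerivAt_const _ _).prodMk (hasDerivAt_id _)
  have h2 := (differentiableAt_of_contDiffOn Metric.isOpen_ball hh hm).hasFDerivAt.comp_hasDerivAt
    (f := fun x : ℝ => (t, x)) y h1
  have h3 : fderiv ℝ h (t, y) (0, 1) = 0 := h0 _ hm
  rwa [h3] at h2

/-- Finitely many successive shrinkings: each function is nonzero somewhere in the current open set,
hence on a smaller one. -/
theorem exists_open_forall_ne_zero {ι : Type*} [Finite ι] {P : Set (ℝ × ℝ)} (hP : IsOpen P)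
    (hne : P.Nonempty) {g : ι → ℝ × ℝ → ℝ} (hg : ∀ i, ContinuousOn (g i) P)
    (h : ∀ i, ∀ U ⊆ P, IsOpen U → U.Nonempty → ∃ z ∈ U, g i z ≠ 0) :
    ∃ U ⊆ P, IsOpen U ∧ U.Nonempty ∧ ∀ i, ∀ z ∈ U, g i z ≠ 0 := by
  have := Fintype.ofFinite ι
  classical
  suffices ∀ s : Finset ι, ∃ U ⊆ P, IsOpen U ∧ U.Nonempty ∧ ∀ i ∈ s, ∀ z ∈ U, g i z ≠ 0 by
    obtain ⟨U, h1, h2, h3, h4⟩ := this Finset.univ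
    exact ⟨U, h1, h2, h3, fun i => h4 i (Finset.mem_univ i)⟩
  intro s
  induction s using Finset.induction_on with
  | empty => exact ⟨P, Subset.rfl, hP, hne, by simp⟩
  | insert a s _ ih =>
    obtain ⟨U, hUP, hU, hUne, hUs⟩ := ih
    obtain ⟨z, hz, hz0⟩ := h a U hUP hU hUne
    refine ⟨U ∩ g a ⁻¹' {0}ᶜ, inter_subset_left.trans hUP,
      ((hg a).mono hUP).isOpen_inter_preimage hU isOpen_compl_singleton, ⟨z, hz, hz0⟩, ?_⟩
    intro i hi y hy
    rcases Finset.mem_insert.1 hi with rfl | hi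
    · exact hy.2
    · exact hUs i hi y hy.1

/-- The coefficient of `∂_u` on the slice through `w₀`. -/
def coefOf (w₀ : Pt) (S : VField) (z : ℝ × ℝ) : ℝ := (S (z.1, z.2, w₀.2.2)).2.2

variable {w₀ : Pt} {r : ℝ} {B : Submodule ℝ VField}

/-- Commuting with `∂_u` means that the components do not depend on `u`. -/
theorem Tame.eq_of_eq_tx (h : Tame (Metric.ball w₀ r) B) {S₀ : VField} (hS₀ : S₀ ∈ B)
    (hS₀u : EqOn S₀ genU (Metric.ball w₀ r)) {S : VField} (hS : S ∈ B) {w w' : Pt}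
    (hw : w ∈ Metric.ball w₀ r) (hw' : w' ∈ Metric.ball w₀ r) (ht : w.1 = w'.1)
    (hx : w.2.1 = w'.2.1) : S w = S w' := by
  refine (eq_of_fderiv_direction_eq_zero (h.smooth S hS) (v := (0, 0, 1)) (fun w hw =>
    fderiv_eq_zero_of_lieBracket h.isOpen hS₀u hw (h.abelian S₀ hS₀ S hS w hw)) hw hw'
    ⟨w'.2.2 - w.2.2, ?_⟩).symm
  ext <;> simp [ht, hx]

theorem contDiffOn_coefOf {S : VField} (hS : ContDiffOn ℝ ∞ S (Metric.ball w₀ r)) (hr : 0 < r) :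
    ContDiffOn ℝ ∞ (coefOf w₀ S) (Metric.ball (w₀.1, w₀.2.1) r) := by
  have h1 : ContDiff ℝ ∞ (fun z : ℝ × ℝ => ((z.1, z.2, w₀.2.2) : Pt)) := by fun_prop
  exact (hS.comp h1.contDiffOn fun z hz => by
    rw [mem_ball_tx] at hz
    exact mem_ball_pt.2 ⟨hz.1, hz.2, Metric.mem_ball_self hr⟩).snd.snd

theorem Tame.eq_coefU (h : Tame (Metric.ball w₀ r) B) {S₀ : VField} (hS₀ : S₀ ∈ B)
    (hS₀u : EqOn S₀ genU (Metric.ball w₀ r)) {S : VField} (hS : S ∈ B)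
    (hb : ∀ w ∈ Metric.ball w₀ r, (S w).2.1 = 0) :
    EqOn S (coefU (coefOf w₀ S)) (Metric.ball w₀ r) := by
  intro w hw
  have hw' := mem_ball_pt.1 hw
  have hr := dist_nonneg.trans_lt (Metric.mem_ball.1 hw)
  have h1 : S w = S (w.1, w.2.1, w₀.2.2) := h.eq_of_eq_tx hS₀ hS₀u hS hw
    (mem_ball_pt.2 ⟨hw'.1, hw'.2.1, Metric.mem_ball_self hr⟩) rfl rfl
  exact Prod.ext (h.vertical S hS w hw) (Prod.ext (hb w hw) (by rw [h1]; rfl))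

/-- The coefficient is a function of `t` alone, and rigidity against `∂_u` makes it constant. -/
theorem Tame.exists_eq_smul_genU (h : Tame (Metric.ball w₀ r) B) {S₀ : VField} (hS₀ : S₀ ∈ B)
    (hS₀u : EqOn S₀ genU (Metric.ball w₀ r)) {S : VField} (hS : S ∈ B)
    (hb : ∀ w ∈ Metric.ball w₀ r, (S w).2.1 = 0) (hr : 0 < r)
    (hx : ∀ z ∈ Metric.ball (w₀.1, w₀.2.1) r, Dx (coefOf w₀ S) z = 0) :
    ∃ α : ℝ, EqOn S (α • genU) (Metric.ball w₀ r) := by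
  have hc := contDiffOn_coefOf (h.smooth S hS) hr
  let β : ℝ → ℝ := fun t => coefOf w₀ S (t, w₀.2.1)
  have hβ : ContDiffOn ℝ ∞ β (Metric.ball w₀.1 r) :=
    hc.comp (by fun_prop) fun t ht => mem_ball_tx.2 ⟨ht, Metric.mem_ball_self hr⟩
  have hS' : ∀ w ∈ Metric.ball w₀ r, S w = β w.1 • genU w := by
    intro w hw
    have hw' := mem_ball_pt.1 hw
    rw [h.eq_coefU hS₀ hS₀u hS hb hw]
    have h1 : coefOf w₀ S (w.1, w.2.1) = β w.1 :=
      eq_of_Dx_eq_zero hc hx (mem_ball_tx.2 ⟨hw'.1, hw'.2.1⟩)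
        (mem_ball_tx.2 ⟨hw'.1, Metric.mem_ball_self hr⟩)
    simp [coefU, genU, h1]
  have hd : ∀ t ∈ Metric.ball w₀.1 r, HasDerivAt β 0 t := by
    intro t ht
    have hm : ((t, w₀.2) : Pt) ∈ Metric.ball w₀ r :=
      mem_ball_pt.2 ⟨ht, Metric.mem_ball_self hr, Metric.mem_ball_self hr⟩
    have h1 := h.timeRigid S₀ hS₀ S₀ hS₀ S hS β (fun _ => 0) _ Metric.isOpen_ball hβ
      contDiffOn_const (t, w₀.2) hm ht (by
        filter_upwards [Metric.isOpen_ball.mem_nhds hm] with q hq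
        rw [hS' q hq, hS₀u hq]; simp)
    have h2 : deriv β t = 0 := by
      have := congrArg (fun q : Pt => q.2.2) h1
      simpa [hS₀u hm, genU] using this
    rw [← h2]
    exact (differentiableAt_of_contDiffOn Metric.isOpen_ball hβ ht).hasDerivAt
  refine ⟨β w₀.1, fun w hw => ?_⟩
  rw [hS' w hw, const_of_hasDerivAt_zero hd (mem_ball_pt.1 hw).1 (Metric.mem_ball_self hr)]
  rfl

/-- Over `U` the coefficient is locally `α(t) + β(t) x`. Rigidity gives `α' + β' x = 0`, and two
values of `x` give `α' = β' = 0`. The resulting identity spreads from a small set to the whole ball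
by unique continuation. -/
theorem Tame.exists_eq_affine (h : Tame (Metric.ball w₀ r) B) {S₀ S₁ : VField} (hS₀ : S₀ ∈ B)
    (hS₀u : EqOn S₀ genU (Metric.ball w₀ r)) (hS₁ : S₁ ∈ B)
    (hS₁x : EqOn S₁ xGenU (Metric.ball w₀ r)) {S : VField} (hS : S ∈ B)
    (hb : ∀ w ∈ Metric.ball w₀ r, (S w).2.1 = 0) (hr : 0 < r) {U : Set (ℝ × ℝ)}
    (hU : U ⊆ Metric.ball (w₀.1, w₀.2.1) r) (hUo : IsOpen U) (hUne : U.Nonempty)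
    (hxx : ∀ z ∈ U, Dx (Dx (coefOf w₀ S)) z = 0) :
    ∃ α β : ℝ, EqOn S (α • genU + β • xGenU) (Metric.ball w₀ r) := by
  obtain ⟨z₁, hz₁⟩ := hUne
  obtain ⟨ρ, hρ, hρU⟩ := Metric.isOpen_iff.1 hUo z₁ hz₁
  set c := coefOf w₀ S
  have hcP := contDiffOn_coefOf (h.smooth S hS) hr
  have hc : ContDiffOn ℝ ∞ c (Metric.ball z₁ ρ) := hcP.mono (hρU.trans hU)
  have hcx := contDiffOn_Dx Metric.isOpen_ball hc
  let β : ℝ → ℝ := fun t => Dx c (t, z₁.2)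
  let α : ℝ → ℝ := fun t => c (t, z₁.2) - β t * z₁.2
  have hmaps : ∀ t ∈ Metric.ball z₁.1 ρ, (t, z₁.2) ∈ Metric.ball z₁ ρ := fun t ht =>
    mem_ball_tx.2 ⟨ht, Metric.mem_ball_self hρ⟩
  have hβ : ContDiffOn ℝ ∞ β (Metric.ball z₁.1 ρ) := hcx.comp (by fun_prop) hmaps
  have hα : ContDiffOn ℝ ∞ α (Metric.ball z₁.1 ρ) :=
    (hc.comp (by fun_prop) hmaps).sub (hβ.mul contDiffOn_const)
  have hβz : ContDiffOn ℝ ∞ (fun z : ℝ × ℝ => β z.1) (Metric.ball z₁ ρ) :=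
    hβ.comp contDiffOn_fst fun z hz => (mem_ball_tx.1 hz).1
  have hcβ : ∀ z ∈ Metric.ball z₁ ρ, Dx c z = β z.1 := fun z hz =>
    eq_of_Dx_eq_zero (t := z.1) hcx (fun z hz => hxx z (hρU hz)) hz (hmaps z.1 (mem_ball_tx.1 hz).1)
  have hcαβ : ∀ z ∈ Metric.ball z₁ ρ, c z = α z.1 + β z.1 * z.2 := by
    intro z hz
    have hsm : ContDiffOn ℝ ∞ (fun z : ℝ × ℝ => β z.1 * z.2) (Metric.ball z₁ ρ) :=
      hβz.mul contDiffOn_snd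
    have h1 : ∀ z ∈ Metric.ball z₁ ρ, Dx (fun z => c z - β z.1 * z.2) z = 0 := by
      intro z hz
      have h2 : HasDerivAt (fun x => c (z.1, x) - β z.1 * x) (Dx c z - β z.1) z.2 := by
        have h3 : HasDerivAt (fun x : ℝ => (z.1, x)) ((0 : ℝ), (1 : ℝ)) z.2 :=
          (hasDerivAt_const _ _).prodMk (hasDerivAt_id _)
        have h4 := (differentiableAt_of_contDiffOn Metric.isOpen_ball hc hz).hasFDerivAt.comp_hasDerivAt
          (f := fun x : ℝ => (z.1, x)) z.2 h3
        have h5 := (hasDerivAt_id z.2).const_mul (β z.1)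
        rw [mul_one] at h5
        exact h4.sub h5
      rw [Dx_eq_of_hasDerivAt (differentiableAt_of_contDiffOn Metric.isOpen_ball (hc.sub hsm) hz) h2,
        hcβ z hz, sub_self]
    have h2 : c (z.1, z.2) - β z.1 * z.2 = c (z.1, z₁.2) - β z.1 * z₁.2 :=
      eq_of_Dx_eq_zero (h := fun z => c z - β z.1 * z.2) (t := z.1) (hc.sub hsm) h1 hz
        (hmaps z.1 (mem_ball_tx.1 hz).1)
    have h3 : α z.1 = c (z.1, z.2) - β z.1 * z.2 := h2.symm
    rw [h3]
    ring
  let V₁ : Set Pt := Metric.ball w₀ r ∩ (fun w : Pt => (w.1, w.2.1)) ⁻¹' Metric.ball z₁ ρ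
  have hV₁ : IsOpen V₁ := Metric.isOpen_ball.inter (Metric.isOpen_ball.preimage (by fun_prop))
  have hmem : ∀ z ∈ Metric.ball z₁ ρ, ((z.1, z.2, w₀.2.2) : Pt) ∈ V₁ := by
    intro z hz
    have := mem_ball_tx.1 (hU (hρU hz))
    exact ⟨mem_ball_pt.2 ⟨this.1, this.2, Metric.mem_ball_self hr⟩, hz⟩
  have hSV : ∀ w ∈ V₁, S w = α w.1 • genU w + β w.1 • xGenU w := by
    intro w hw
    rw [h.eq_coefU hS₀ hS₀u hS hb hw.1]
    have : c (w.1, w.2.1) = α w.1 + β w.1 * w.2.1 := hcαβ _ hw.2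
    simp [coefU, genU, xGenU, c, this]
  have hrel : ∀ z ∈ Metric.ball z₁ ρ, deriv α z.1 + deriv β z.1 * z.2 = 0 := by
    intro z hz
    have hm := hmem z hz
    have h1 := h.timeRigid S₀ hS₀ S₁ hS₁ S hS α β _ Metric.isOpen_ball hα hβ
      (z.1, z.2, w₀.2.2) hm.1 (mem_ball_tx.1 hz).1 (by
        filter_upwards [hV₁.mem_nhds hm] with q hq
        rw [hSV q hq, hS₀u hq.1, hS₁x hq.1])
    have := congrArg (fun q : Pt => q.2.2) h1
    simpa [hS₀u hm.1, hS₁x hm.1, genU, xGenU, coefU] using this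
  have hd : ∀ t ∈ Metric.ball z₁.1 ρ, deriv α t = 0 ∧ deriv β t = 0 := by
    intro t ht
    have h1 := hrel (t, z₁.2) (hmaps t ht)
    have h2 := hrel (t, z₁.2 + ρ / 2) (mem_ball_tx.2 ⟨ht, by
      rw [Metric.mem_ball, dist_eq_norm, add_sub_cancel_left, Real.norm_of_nonneg (by positivity)]
      linarith⟩)
    simp only at h1 h2
    have h3 : deriv β t = 0 := by
      apply mul_left_cancel₀ hρ.ne'
      linear_combination 2 * h2 - 2 * h1
    rw [h3] at h1
    exact ⟨by linarith, h3⟩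
  have hα' : ∀ t ∈ Metric.ball z₁.1 ρ, α t = α z₁.1 := fun t ht =>
    const_of_hasDerivAt_zero (fun s hs => by
      rw [← (hd s hs).1]
      exact (differentiableAt_of_contDiffOn Metric.isOpen_ball hα hs).hasDerivAt) ht
      (Metric.mem_ball_self hρ)
  have hβ' : ∀ t ∈ Metric.ball z₁.1 ρ, β t = β z₁.1 := fun t ht =>
    const_of_hasDerivAt_zero (fun s hs => by
      rw [← (hd s hs).2]
      exact (differentiableAt_of_contDiffOn Metric.isOpen_ball hβ hs).hasDerivAt) ht
      (Metric.mem_ball_self hρ)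
  refine ⟨α z₁.1, β z₁.1, fun w hw => ?_⟩
  -- `S - α ∂_u - β x ∂_u` vanishes on `V₁` and agrees on the ball with an element of `B`, hence
  -- vanishes on the ball.
  have h1 := h.uniqueCont (S - α z₁.1 • S₀ - β z₁.1 • S₁)
    (B.sub_mem (B.sub_mem hS (B.smul_mem _ hS₀)) (B.smul_mem _ hS₁)) V₁ inter_subset_left hV₁
    ⟨_, hmem z₁ (Metric.mem_ball_self hρ)⟩ (fun q hq => by
      have hq1 := (mem_ball_tx.1 hq.2).1
      simp only [Pi.sub_apply, Pi.smul_apply]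
      rw [hSV q hq, hS₀u hq.1, hS₁x hq.1, hα' _ hq1, hβ' _ hq1]
      abel) w hw
  simp only [Pi.sub_apply, Pi.smul_apply, hS₀u hw, hS₁x hw] at h1
  rw [sub_sub, sub_eq_zero] at h1
  exact h1

end Coefficients

/-! ### A basis containing `∂_u` and `x ∂_u` -/

section Basis

theorem affine_eq_zero_on_ball {w₀ : Pt} {r : ℝ} (hr : 0 < r) {α β : ℝ}
    (h : ∀ w ∈ Metric.ball w₀ r, α • genU w + β • xGenU w = 0) : α = 0 ∧ β = 0 := by
  have h1 := congrArg (fun q : Pt => q.2.2) (h w₀ (Metric.mem_ball_self hr))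
  have h2 := congrArg (fun q : Pt => q.2.2) (h (w₀.1, w₀.2.1 + r / 2, w₀.2.2) (mem_ball_pt.2
    ⟨Metric.mem_ball_self hr, by
      rw [Metric.mem_ball, dist_eq_norm, add_sub_cancel_left, Real.norm_of_nonneg (by positivity)]
      linarith, Metric.mem_ball_self hr⟩))
  simp only [genU, xGenU, coefU, Prod.snd_add, Prod.smul_snd, smul_eq_mul, mul_one, Prod.snd_zero]
    at h1 h2
  have h3 : β = 0 := by
    apply mul_left_cancel₀ hr.ne'
    linear_combination 2 * h2 - 2 * h1
  exact ⟨by simpa [h3] using h1, h3⟩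

/-- A basis of a space of fields on a ball that contains `∂_u` and `x ∂_u`, extending these. -/
theorem exists_basis_extending {w₀ : Pt} {r : ℝ} (hr : 0 < r) (B : Submodule ℝ VField)
    (hfin : FiniteDimensional ℝ (restrictTo (Metric.ball w₀ r) B)) :
    ∃ (k : ℕ) (q : Fin k → VField), (∀ i, q i ∈ B) ∧
      (∀ (α β : ℝ) (δ : Fin k → ℝ),
        (∀ w ∈ Metric.ball w₀ r, α • genU w + β • xGenU w + ∑ i, δ i • q i w = 0) →
          α = 0 ∧ β = 0 ∧ δ = 0) ∧
      ∀ S ∈ B, ∃ (α β : ℝ) (δ : Fin k → ℝ),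
        ∀ w ∈ Metric.ball w₀ r, S w = α • genU w + β • xGenU w + ∑ i, δ i • q i w := by
  set W := Metric.ball w₀ r
  let ρ : VField →ₗ[ℝ] (W → Pt) := LinearMap.funLeft ℝ Pt (Subtype.val : W → Pt)
  let M : Submodule ℝ (W → Pt) := restrictTo W B
  -- The extra generators are lifts of a basis of the quotient of the restricted algebra by its
  -- intersection with the span of `∂_u` and `x ∂_u`.
  let N : Submodule ℝ M := (Submodule.span ℝ {ρ genU, ρ xGenU}).comap M.subtype
  let b := Module.finBasis ℝ (M ⧸ N)
  have hlift : ∀ i, ∃ q ∈ B, ∃ h : ρ q ∈ M, N.mkQ ⟨ρ q, h⟩ = b i := by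
    intro i
    obtain ⟨m, hm⟩ := N.mkQ_surjective (b i)
    obtain ⟨q, hq, hqm⟩ := m.2
    exact ⟨q, hq, ⟨q, hq, rfl⟩, by rw [← hm]; congr 1; exact Subtype.ext hqm⟩
  choose q hqB hqM hqb using hlift
  refine ⟨_, q, hqB, fun α β δ h => ?_, fun S hS => ?_⟩
  · have h1 : ∑ i, δ i • (⟨ρ (q i), hqM i⟩ : M) ∈ N := by
      change M.subtype (∑ i, δ i • (⟨ρ (q i), hqM i⟩ : M)) ∈
        Submodule.span ℝ {ρ genU, ρ xGenU}
      have h2 : M.subtype (∑ i, δ i • (⟨ρ (q i), hqM i⟩ : M)) =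
          (-α) • ρ genU + (-β) • ρ xGenU := by
        simp only [map_sum, map_smul, Submodule.subtype_apply]
        ext1 w
        have := h w w.2
        simp only [Finset.sum_apply, Pi.smul_apply, Pi.add_apply]
        change ∑ i, δ i • q i w = -α • genU w + -β • xGenU w
        rw [neg_smul, neg_smul, ← neg_add, eq_neg_iff_add_eq_zero, add_comm]
        exact this
      rw [h2]
      exact Submodule.mem_span_pair.2 ⟨_, _, rfl⟩
    have h3 : ∑ i, δ i • b i = 0 := by
      have := (Submodule.Quotient.mk_eq_zero N).2 h1
      rw [← Submodule.mkQ_apply, map_sum] at this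
      simpa only [map_smul, hqb] using this
    have hδ : δ = 0 := funext (Fintype.linearIndependent_iff.1 b.linearIndependent δ h3)
    subst hδ
    obtain ⟨h4, h5⟩ := affine_eq_zero_on_ball hr (α := α) (β := β) fun w hw => by
      simpa using h w hw
    exact ⟨h4, h5, rfl⟩
  · let s : M := ⟨ρ S, S, hS, rfl⟩
    let δ := b.repr (N.mkQ s)
    have h1 : s - ∑ i, δ i • (⟨ρ (q i), hqM i⟩ : M) ∈ N := by
      rw [← Submodule.Quotient.mk_eq_zero, ← Submodule.mkQ_apply, map_sub, map_sum]
      simp only [map_smul, hqb]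
      rw [sub_eq_zero]
      exact (b.sum_repr (N.mkQ s)).symm
    obtain ⟨α, β, h2⟩ := Submodule.mem_span_pair.1 h1
    refine ⟨α, β, δ, fun w hw => ?_⟩
    have h3 := congrFun h2 ⟨w, hw⟩
    simp only [Submodule.subtype_apply, AddSubgroupClass.coe_sub, Submodule.coe_sum, 
      Submodule.coe_smul, Pi.sub_apply, Pi.add_apply, Pi.smul_apply, Finset.sum_apply] at h3
    change α • genU w + β • xGenU w = S w - ∑ i, δ i • q i w at h3
    rw [h3]
    abel

end Basis
end EvolEq

namespace EvolEq
open Set Filter Topology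

/-! ### Classification of algebras without `∂_t` -/

section VerticalClassification

variable {w₀ : Pt} {r : ℝ} {B : Submodule ℝ VField}

theorem VerticalNormal.of_agreeOn {V : Set Pt} {A C : Submodule ℝ VField} {w : Pt} {ρ : ℝ} (hρ : 0 < ρ)
    (hsub : Metric.ball w ρ ⊆ V) (h : AgreeOn (Metric.ball w ρ) A C) {k : AlgType}
    (hk : IsCanonical (Metric.ball w ρ) C k) (hv : k.IsVertical) : VerticalNormal V A :=
  ⟨Metric.ball w ρ, hsub, Metric.isOpen_ball, ⟨w, Metric.mem_ball_self hρ⟩, w, ρ, C, k, hρ,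
    FiberEquivalent.of_agreeOn Metric.isOpen_ball h, hk, hv⟩

/-- A basis coefficient with vanishing second `x`-derivative on an open set would be affine by
`Tame.exists_eq_affine`, against independence; so on a smaller set all these second derivatives are
nonzero. The type is then decided by the number of generators besides `∂_u` and `x ∂_u`: none, one,
or at least two. -/
theorem Tame.verticalNormal_of_genU_xGenU (h : Tame (Metric.ball w₀ r) B) (hr : 0 < r)
    {S₀ S₁ : VField} (hS₀ : S₀ ∈ B) (hS₀u : EqOn S₀ genU (Metric.ball w₀ r)) (hS₁ : S₁ ∈ B)
    (hS₁x : EqOn S₁ xGenU (Metric.ball w₀ r))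
    (hb : ∀ S ∈ B, ∀ w ∈ Metric.ball w₀ r, (S w).2.1 = 0) :
    VerticalNormal (Metric.ball w₀ r) B := by
  obtain ⟨k, q, hqB, hind, hspan⟩ := exists_basis_extending hr B h.finiteDim
  set W := Metric.ball w₀ r with hW
  let c : Fin k → ℝ × ℝ → ℝ := fun i => coefOf w₀ (q i)
  have hqc : ∀ i, EqOn (q i) (coefU (c i)) W := fun i =>
    h.eq_coefU hS₀ hS₀u (hqB i) (hb _ (hqB i))
  have hc : ∀ i, ContDiffOn ℝ ∞ (c i) (Metric.ball (w₀.1, w₀.2.1) r) := fun i =>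
    contDiffOn_coefOf (h.smooth _ (hqB i)) hr
  obtain ⟨U, hUP, hU, ⟨z₁, hz₁⟩, hUc⟩ := exists_open_forall_ne_zero
    (g := fun i => Dx (Dx (c i))) Metric.isOpen_ball ⟨_, Metric.mem_ball_self hr⟩
    (fun i => (contDiffOn_Dx Metric.isOpen_ball (contDiffOn_Dx Metric.isOpen_ball (hc i))).continuousOn)
    (by
      intro i U hUP hU hUne
      by_contra! h0
      obtain ⟨α, β, he⟩ := h.exists_eq_affine hS₀ hS₀u hS₁ hS₁x (hqB i) (hb _ (hqB i)) hr hUP hU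
        hUne h0
      have := (hind (-α) (-β) (Pi.single i 1) fun w hw => by
        rw [Finset.sum_eq_single i (fun j _ hj => by simp [hj]) (by simp), he hw]
        simp only [Pi.single_eq_same, one_smul, Pi.add_apply, Pi.smul_apply, neg_smul]
        abel).2.2
      simpa using congrFun this i)
  -- a small ball over a point of `U`
  have hsmall : ∀ O : Set (ℝ × ℝ), IsOpen O → z₁ ∈ O → ∃ (w₁ : Pt) (ρ : ℝ), 0 < ρ ∧
      Metric.ball w₁ ρ ⊆ W ∧ projTX (Metric.ball w₁ ρ) ⊆ U ∧ projTX (Metric.ball w₁ ρ) ⊆ O := by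
    intro O hO hzO
    have hop : IsOpen (W ∩ (fun w : Pt => (w.1, w.2.1)) ⁻¹' (U ∩ O)) :=
      Metric.isOpen_ball.inter ((hU.inter hO).preimage (by fun_prop))
    have hz := mem_ball_tx.1 (hUP hz₁)
    obtain ⟨ρ, hρ, hsub⟩ := Metric.isOpen_iff.1 hop (z₁.1, z₁.2, w₀.2.2)
      ⟨mem_ball_pt.2 ⟨hz.1, hz.2, Metric.mem_ball_self hr⟩, hz₁, hzO⟩
    refine ⟨_, ρ, hρ, fun w hw => (hsub hw).1, ?_, ?_⟩
    · rintro _ ⟨w, hw, rfl⟩; exact (hsub hw).2.1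
    · rintro _ ⟨w, hw, rfl⟩; exact (hsub hw).2.2
  match k, q, c, hqB, hind, hspan, hqc, hc, hUc with
  | 0, q, c, hqB, hind, hspan, hqc, hc, hUc =>
    refine VerticalNormal.of_agreeOn hr Subset.rfl (k := .uxu) (agreeOn_span ?_ ?_) rfl trivial
    · rintro g (rfl | rfl)
      exacts [⟨S₀, hS₀, hS₀u⟩, ⟨S₁, hS₁, hS₁x⟩]
    · intro S hS
      obtain ⟨α, β, δ, he⟩ := hspan S hS
      exact ⟨_, Submodule.mem_span_pair.2 ⟨α, β, rfl⟩, fun w hw => by simp [he w hw]⟩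
  | 1, q, c, hqB, hind, hspan, hqc, hc, hUc =>
    obtain ⟨w₁, ρ, hρ, hW₁, hP₁, -⟩ := hsmall univ isOpen_univ trivial
    refine VerticalNormal.of_agreeOn hρ hW₁ (k := .uxuc) (agreeOn_span (s := {genU, xGenU, coefU (c 0)})
      ?_ ?_) ⟨c 0, (hc 0).mono (hP₁.trans hUP), fun z hz => hUc 0 z (hP₁ hz), rfl⟩ trivial
    · rintro g (rfl | rfl | rfl)
      exacts [⟨S₀, hS₀, hS₀u.mono hW₁⟩, ⟨S₁, hS₁, hS₁x.mono hW₁⟩, ⟨q 0, hqB 0, (hqc 0).mono hW₁⟩]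
    · intro S hS
      obtain ⟨α, β, δ, he⟩ := hspan S hS
      refine ⟨_, Submodule.mem_span_triple.2 ⟨α, β, δ 0, rfl⟩, fun w hw => ?_⟩
      rw [he w (hW₁ hw)]
      simp [hqc 0 (hW₁ hw)]
  | m + 2, q, c, hqB, hind, hspan, hqc, hc, hUc =>
    have hz₁' := mem_ball_tx.1 (hUP hz₁)
    have hm : ((z₁.1, z₁.2, w₀.2.2) : Pt) ∈ W :=
      mem_ball_pt.2 ⟨hz₁'.1, hz₁'.2, Metric.mem_ball_self hr⟩
    -- Compatibility is applied with `Q = ∂_u` and `X = x`. All coefficients satisfy `c_t = f c_xxx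
    -- + K c_xx` with the same `f` and `K`, so the quotients in the compatibility condition all
    -- equal `K`.
    obtain ⟨O, f, hO, hzO, hOsub, hf, hf0, hK⟩ := h.compatible S₀ hS₀ (fun w => w.2.1) W
      Metric.isOpen_ball Subset.rfl (by fun_prop)
      ⟨S₁, hS₁, fun w hw => by rw [hS₁x hw, hS₀u hw]; simp [xGenU, coefU, genU]⟩
      (z₁.1, z₁.2, w₀.2.2) hm (by rw [hS₀u hm]; simp [genU])
      ⟨(0, 1, 0), rfl, by
        have h1 : HasFDerivAt (fun w : Pt => w.2.1) ((ContinuousLinearMap.fst ℝ ℝ ℝ).comp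
          (ContinuousLinearMap.snd ℝ ℝ (ℝ × ℝ))) (z₁.1, z₁.2, w₀.2.2) :=
          ((ContinuousLinearMap.fst ℝ ℝ ℝ).comp (ContinuousLinearMap.snd ℝ ℝ (ℝ × ℝ))).hasFDerivAt
        rw [h1.fderiv]
        simp⟩
    obtain ⟨w₁, ρ, hρ, hW₁, hP₁, hO₁⟩ := hsmall O hO hzO
    have hOP : O ⊆ Metric.ball (w₀.1, w₀.2.1) r := by
      rw [← projTX_ball w₀ hr]; exact hOsub
    have hKc : ∀ z ∈ projTX (Metric.ball w₁ ρ), ∃ K : ℝ, ∀ i : Fin (m + 2),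
        (Dt (c i) z - f z * Dx (Dx (Dx (c i))) z) / Dx (Dx (c i)) z = K := by
      intro z hz
      obtain ⟨K, hK⟩ := hK z (hO₁ hz)
      refine ⟨K, fun i => ?_⟩
      have h1 := hK (c i) ((hc i).mono hOP) ⟨q i, hqB i, fun w hw => by
        rw [hqc i hw, hS₀u hw]; simp [coefU, genU]⟩
      rw [div_eq_iff (hUc i z (hP₁ hz)), h1]
      ring
    refine VerticalNormal.of_agreeOn hρ hW₁ (k := .series m) (agreeOn_span
      (s := {genU, xGenU, coefU (c 0)} ∪ range fun i : Fin (m + 1) => coefU (c i.succ)) ?_ ?_)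
      ⟨c 0, fun i => c i.succ, (hc 0).mono (hP₁.trans hUP), fun i => (hc i.succ).mono (hP₁.trans hUP),
        fun z hz => hUc 0 z (hP₁ hz), fun i z hz => hUc i.succ z (hP₁ hz), ?_,
        ⟨f, hf.mono hO₁, fun z hz => hf0 z (hO₁ hz), fun i z hz => ?_⟩, rfl⟩ trivial
    · rintro g ((rfl | rfl | rfl) | ⟨i, rfl⟩)
      exacts [⟨S₀, hS₀, hS₀u.mono hW₁⟩, ⟨S₁, hS₁, hS₁x.mono hW₁⟩, ⟨q 0, hqB 0, (hqc 0).mono hW₁⟩,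
        ⟨q i.succ, hqB _, (hqc i.succ).mono hW₁⟩]
    · intro S hS
      obtain ⟨α, β, δ, he⟩ := hspan S hS
      refine ⟨α • genU + β • xGenU + ∑ i, δ i • coefU (c i), ?_, fun w hw => ?_⟩
      · refine add_mem (add_mem ?_ ?_) (sum_mem fun i _ => Submodule.smul_mem _ _ ?_)
        · exact Submodule.smul_mem _ _ (Submodule.subset_span (by simp))
        · exact Submodule.smul_mem _ _ (Submodule.subset_span (by simp))
        · refine Fin.cases ?_ (fun j => ?_) i
          · exact Submodule.subset_span (by simp)
          · exact Submodule.subset_span (Or.inr ⟨j, rfl⟩)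
      · rw [he w (hW₁ hw)]
        simp only [Pi.add_apply, Pi.smul_apply, Finset.sum_apply]
        congr 1
        exact Finset.sum_congr rfl fun i _ => by rw [hqc i (hW₁ hw)]
    · intro α β γ δ h0
      -- Independence is known on `W` but required on the smaller ball; a relation there extends to
      -- `W` by unique continuation.
      have h1 := h.uniqueCont (α • S₀ + β • S₁ + ∑ i, (Fin.cons γ δ : Fin (m + 2) → ℝ) i • q i)
        (B.add_mem (B.add_mem (B.smul_mem _ hS₀) (B.smul_mem _ hS₁))
          (B.sum_mem fun i _ => B.smul_mem _ (hqB i))) _ hW₁ Metric.isOpen_ball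
        ⟨w₁, Metric.mem_ball_self hρ⟩ (fun w hw => by
          have h2 := h0 (w.1, w.2.1) ⟨w, hw, rfl⟩
          have hw' := hW₁ hw
          simp only [Pi.add_apply, Pi.smul_apply, Finset.sum_apply, Fin.sum_univ_succ (n := m + 1),
            Fin.cons_zero, Fin.cons_succ, hS₀u hw', hS₁x hw', fun i => hqc i hw']
          refine Prod.ext ?_ (Prod.ext ?_ ?_)
          · simp [genU, xGenU, coefU, Prod.fst_sum]
          · simp [genU, xGenU, coefU, Prod.fst_sum, Prod.snd_sum]
          · simp only [genU, xGenU, coefU, Prod.snd_add, Prod.smul_snd, smul_eq_mul, mul_one,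
              Prod.snd_sum, Prod.snd_zero]
            linear_combination h2)
      obtain ⟨h3, h4, h5⟩ := hind α β (Fin.cons γ δ) fun w hw => by
        have := h1 w hw
        simp only [Pi.add_apply, Pi.smul_apply, Finset.sum_apply, hS₀u hw, hS₁x hw] at this
        exact this
      have h6 : γ = 0 := by simpa using congrFun h5 0
      have h7 : δ = 0 := funext fun i => by simpa using congrFun h5 i.succ
      exact ⟨h3, h4, h6, h7⟩
    · obtain ⟨K, hK⟩ := hKc z hz
      rw [hK 0, hK i.succ]

/-- Unless all fields are constant multiples of `∂_u`, some `c(t,x) ∂_u` has `c_x ≠ 0` at a point.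
Taking `c` as the new `x` turns it into `x ∂_u` and leaves `∂_u` unchanged. -/
theorem Tame.verticalNormal_of_genU (h : Tame (Metric.ball w₀ r) B) (hr : 0 < r)
    {S₀ : VField} (hS₀ : S₀ ∈ B) (hS₀u : EqOn S₀ genU (Metric.ball w₀ r))
    (hb : ∀ S ∈ B, ∀ w ∈ Metric.ball w₀ r, (S w).2.1 = 0) :
    VerticalNormal (Metric.ball w₀ r) B := by
  by_cases hall : ∀ S ∈ B, ∃ α : ℝ, EqOn S (α • genU) (Metric.ball w₀ r)
  · refine VerticalNormal.of_agreeOn hr Subset.rfl (k := .u) (agreeOn_span ?_ ?_) rfl trivial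
    · rintro g rfl
      exact ⟨S₀, hS₀, hS₀u⟩
    · intro S hS
      obtain ⟨α, hα⟩ := hall S hS
      exact ⟨_, Submodule.mem_span_singleton.2 ⟨α, rfl⟩, hα⟩
  push Not at hall
  obtain ⟨S, hS, hSα⟩ := hall
  have : ∃ z ∈ Metric.ball (w₀.1, w₀.2.1) r, Dx (coefOf w₀ S) z ≠ 0 := by
    by_contra! h0
    obtain ⟨α, hα⟩ := h.exists_eq_smul_genU hS₀ hS₀u hS (hb S hS) hr h0
    exact hSα α hα
  obtain ⟨z₁, hz₁, hz₁x⟩ := this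
  have hc := contDiffOn_coefOf (h.smooth S hS) hr
  have hSc := h.eq_coefU hS₀ hS₀u hS (hb S hS)
  set c := coefOf w₀ S
  set W := Metric.ball w₀ r
  have hmW : ∀ w ∈ W, (w.1, w.2.1) ∈ Metric.ball (w₀.1, w₀.2.1) r := fun w hw =>
    mem_ball_tx.2 ⟨(mem_ball_pt.1 hw).1, (mem_ball_pt.1 hw).2.1⟩
  let χ : Pt → Pt := fun w => (w.1, c (w.1, w.2.1), w.2.2)
  have hχ : ContDiffOn ℝ ∞ χ W :=
    contDiffOn_fst.prodMk ((hc.comp (f := fun w : Pt => (w.1, w.2.1)) (by fun_prop) hmW).prodMk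
      (by fun_prop))
  have hχ' : ∀ w ∈ W, ∀ v, fderiv ℝ χ w v =
      (v.1, fderiv ℝ c (w.1, w.2.1) (v.1, v.2.1), v.2.2) := by
    intro w hw v
    let L : Pt →L[ℝ] ℝ × ℝ := (ContinuousLinearMap.fst ℝ ℝ (ℝ × ℝ)).prod
      ((ContinuousLinearMap.fst ℝ ℝ ℝ).comp (ContinuousLinearMap.snd ℝ ℝ (ℝ × ℝ)))
    have h1 : HasFDerivAt (fun w : Pt => c (L w)) ((fderiv ℝ c (L w)).comp L) w :=
      HasFDerivAt.comp (g := c) (f := L) w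
        (differentiableAt_of_contDiffOn Metric.isOpen_ball hc (hmW w hw)).hasFDerivAt L.hasFDerivAt
    have h2 : HasFDerivAt χ ((ContinuousLinearMap.fst ℝ ℝ (ℝ × ℝ)).prod
        (((fderiv ℝ c (L w)).comp L).prod
          ((ContinuousLinearMap.snd ℝ ℝ ℝ).comp (ContinuousLinearMap.snd ℝ ℝ (ℝ × ℝ))))) w :=
      (ContinuousLinearMap.fst ℝ ℝ (ℝ × ℝ)).hasFDerivAt.prodMk (h1.prodMk
        ((ContinuousLinearMap.snd ℝ ℝ ℝ).comp (ContinuousLinearMap.snd ℝ ℝ (ℝ × ℝ))).hasFDerivAt)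
    rw [h2.fderiv]
    rfl
  have hz₁' := mem_ball_tx.1 hz₁
  have hw₁ : ((z₁.1, z₁.2, w₀.2.2) : Pt) ∈ W :=
    mem_ball_pt.2 ⟨hz₁'.1, hz₁'.2, Metric.mem_ball_self hr⟩
  obtain ⟨ρ, hρ, V', Φ, -, hbW, hd⟩ := exists_chart Metric.isOpen_ball hχ hw₁ isOpen_univ trivial (by
    intro v hv
    rw [hχ' _ hw₁] at hv
    have h1 : v.1 = 0 := congrArg Prod.fst hv
    have h2 : fderiv ℝ c z₁ (v.1, v.2.1) = 0 := congrArg (fun q : Pt => q.2.1) hv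
    have h3 : v.2.2 = 0 := congrArg (fun q : Pt => q.2.2) hv
    have h4 : ((v.1, v.2.1) : ℝ × ℝ) = v.2.1 • (0, 1) := by ext <;> simp [h1]
    rw [h4, map_smul, smul_eq_mul] at h2
    exact Prod.ext h1 (Prod.ext ((mul_eq_zero.1 h2).resolve_right hz₁x) h3))
  -- transport to a ball in the image
  obtain ⟨ρ', hρ', hbV'⟩ := Metric.isOpen_iff.1 hd.isOpen_source (χ (z₁.1, z₁.2, w₀.2.2))
    (hd.symm.mapsTo (Metric.mem_ball_self hρ))
  set w₂ := χ (z₁.1, z₁.2, w₀.2.2)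
  have hd' : IsDiffeo (Metric.ball (z₁.1, z₁.2, w₀.2.2) ρ ∩ χ ⁻¹' Metric.ball w₂ ρ')
      (Metric.ball w₂ ρ') χ Φ := (hd.restrict Metric.isOpen_ball hbV').symm
  have hsub : Metric.ball ((z₁.1, z₁.2, w₀.2.2) : Pt) ρ ∩ χ ⁻¹' Metric.ball w₂ ρ' ⊆ W :=
    inter_subset_left.trans hbW
  have hT := (h.restrict hd'.isOpen_source hsub).push hd' fun _ _ => rfl
  have hpush : ∀ S ∈ B, ∀ w ∈ Metric.ball w₂ ρ', pushField χ Φ S w = (0, 0, (S (Φ w)).2.2) := by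
    intro S hS w hw
    have hΦ := hsub (hd'.mapsTo_inv hw)
    rw [pushField_apply, hχ' _ hΦ, h.vertical S hS _ hΦ, hb S hS _ hΦ]
    exact Prod.ext rfl (Prod.ext (map_zero _) rfl)
  refine VerticalNormal.of_push hd' (fun _ _ => rfl) hsub
    (hT.verticalNormal_of_genU_xGenU hρ' (Submodule.mem_map_of_mem hS₀) (fun w hw => ?_)
      (Submodule.mem_map_of_mem hS) (fun w hw => ?_) ?_)
  · rw [hpush S₀ hS₀ w hw, hS₀u (hsub (hd'.mapsTo_inv hw))]
    rfl
  · have hΦ := hsub (hd'.mapsTo_inv hw)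
    have h1 : (χ (Φ w)).2.1 = w.2.1 := by rw [hd'.right_inv hw]
    rw [hpush S hS w hw, hSc hΦ]
    exact Prod.ext rfl (Prod.ext rfl h1)
  · rintro _ ⟨S, hS, rfl⟩ w hw
    rw [hpush S hS w hw]

/-- Two commuting independent fields are straightened together to `∂_x` and `∂_u`. Any other field
commutes with both, so its components depend on `t` only and are constant by rigidity. -/
theorem Tame.verticalNormal_of_genX (h : Tame (Metric.ball w₀ r) B)
    {S₀ : VField} (hS₀ : S₀ ∈ B) (hS₀u : EqOn S₀ genU (Metric.ball w₀ r)) {S : VField}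
    (hS : S ∈ B) {p : Pt} (hp : p ∈ Metric.ball w₀ r) (hSp : (S p).2.1 ≠ 0) :
    VerticalNormal (Metric.ball w₀ r) B := by
  set W := Metric.ball w₀ r
  obtain ⟨Fl, ε, hε, hsm, hFl⟩ := exists_smooth_flow h.isOpen (h.smooth S hS) hp
  let L : Pt →L[ℝ] ℝ × Pt := ((ContinuousLinearMap.fst ℝ ℝ ℝ).comp
    (ContinuousLinearMap.snd ℝ ℝ (ℝ × ℝ))).prod
      ((ContinuousLinearMap.fst ℝ ℝ (ℝ × ℝ)).prod 0)
  have hLv : ∀ v : Pt, L v = (v.2.1, v.1, 0, 0) := fun v => rfl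
  let E : Pt →L[ℝ] Pt := (0 : Pt →L[ℝ] ℝ).prod ((0 : Pt →L[ℝ] ℝ).prod
    ((ContinuousLinearMap.snd ℝ ℝ ℝ).comp (ContinuousLinearMap.snd ℝ ℝ (ℝ × ℝ))))
  have hEv : ∀ v : Pt, E v = (0, 0, v.2.2) := fun v => rfl
  let ι : Pt → ℝ × Pt := fun w => L w + (0, 0, p.2.1, p.2.2)
  have hι : ∀ w, HasFDerivAt ι L w := fun w => L.hasFDerivAt.add_const _
  have hιsm : ContDiff ℝ ∞ ι := L.contDiff.add contDiff_const
  let w₁ : Pt := (p.1, 0, 0)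
  have hι0 : ι w₁ = (0, p) := by ext <;> simp [ι, hLv, w₁]
  have hFl0 : Fl (0, p) = p := (hFl (0, p) (Metric.mem_ball_self hε)).2.1
  -- Flow along `S` for time `x`, then translation by `u`, which is the flow of `∂_u`.
  let Ψ : Pt → Pt := fun w => Fl (ι w) + E w
  let N₀ : Set Pt := ι ⁻¹' Metric.ball (0, p) ε
  have hN₀ : IsOpen N₀ := Metric.isOpen_ball.preimage hιsm.continuous
  have hΨ₀ : ContDiffOn ℝ ∞ Ψ N₀ :=
    (hsm.comp hιsm.contDiffOn fun w hw => hw).add E.contDiff.contDiffOn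
  let N : Set Pt := N₀ ∩ Ψ ⁻¹' W
  have hN : IsOpen N := hΨ₀.continuousOn.isOpen_inter_preimage hN₀ Metric.isOpen_ball
  have hΨ : ContDiffOn ℝ ∞ Ψ N := hΨ₀.mono inter_subset_left
  have hΨw₁ : Ψ w₁ = p := by
    simp only [Ψ, hι0, hFl0, hEv, w₁]
    ext <;> simp
  have hw₁ : w₁ ∈ N :=
    ⟨by rw [mem_preimage, hι0]; exact Metric.mem_ball_self hε, by rw [mem_preimage, hΨw₁]; exact hp⟩
  have hΨ' : ∀ w ∈ N, ∀ v, fderiv ℝ Ψ w v = fderiv ℝ Fl (ι w) (L v) + E v := fun w hw v =>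
    DFunLike.congr_fun (((differentiableAt_of_contDiffOn Metric.isOpen_ball hsm hw.1).hasFDerivAt.comp
      w (hι w)).add E.hasFDerivAt).fderiv v
  obtain ⟨ρ, hρ, V', Φ, hV', hbN, hd⟩ := exists_chart hN hΨ hw₁ h.isOpen (by rw [hΨw₁]; exact hp) (by
      intro v hv
      rw [hΨ' _ hw₁, hι0, fderiv_flow_zero hε hsm fun z hz => (hFl z hz).2] at hv
      have h1 := congrArg Prod.fst hv
      have h2 := congrArg (fun q : Pt => q.2.1) hv
      have h3 := congrArg (fun q : Pt => q.2.2) hv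
      simp only [hLv, hEv, Prod.fst_add, Prod.snd_add, Prod.smul_fst, Prod.smul_snd, smul_eq_mul,
        Prod.fst_zero, Prod.snd_zero, h.vertical S hS p hp, mul_zero, zero_add, add_zero] at h1 h2 h3
      have h4 : v.2.1 = 0 := (mul_eq_zero.1 h2).resolve_right hSp
      rw [h4, zero_mul, zero_add] at h3
      exact Prod.ext h1 (Prod.ext h4 h3))
  have htΨ : ∀ w ∈ Metric.ball w₁ ρ, (Ψ w).1 = w.1 := by
    intro w hw
    have := flow_time_eq (h.vertical S hS) hFl (hbN hw).1
    change (Fl (ι w)).1 + (E w).1 = w.1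
    rw [this, hEv]
    simp [ι, hLv]
  have htΦ : ∀ q ∈ V', (Φ q).1 = q.1 := fun q hq => hd.symm.time_inv htΨ hq
  have hT := (h.restrict hd.isOpen_source hV').push hd htΦ
  have hu : EqOn (pushField Φ Ψ S₀) genU (Metric.ball w₁ ρ) := by
    intro w hw
    rw [hd.pushField_eq_iff hw, hΨ' w (hbN hw), hS₀u (hV' (hd.mapsTo_inv hw))]
    have h1 : L (genU w) = 0 := by simp [hLv, genU]
    rw [h1, map_zero, zero_add, hEv]
    rfl
  have hx : EqOn (pushField Φ Ψ S) genX (Metric.ball w₁ ρ) := by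
    intro w hw
    rw [hd.pushField_eq_iff hw, hΨ' w (hbN hw)]
    have h1 : L (genX w) = (1, 0) := by simp [hLv, genX]
    have h2 : E (genX w) = 0 := by simp [hEv, genX]
    rw [h1, h2, add_zero]
    have h3 : HasDerivAt (fun τ : ℝ => (τ, (ι w).2)) ((1 : ℝ), (0 : Pt)) (ι w).1 :=
      (hasDerivAt_id _).prodMk (hasDerivAt_const _ _)
    have h4 := ((differentiableAt_of_contDiffOn Metric.isOpen_ball hsm
      (hbN hw).1).hasFDerivAt.comp_hasDerivAt
      (f := fun τ : ℝ => (τ, (ι w).2)) _ h3).unique (hFl _ (hbN hw).1).2.2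
    -- The derivative of `Ψ` in the direction `x` is `S` before the translation in `u`; since `S`
    -- does not depend on `u`, it is also `S` at the translated point.
    refine h4.trans (h.eq_of_eq_tx hS₀ hS₀u hS (hFl _ (hbN hw).1).1 (hV' (hd.mapsTo_inv hw)) ?_ ?_)
    · simp [Ψ, hEv]
    · simp [Ψ, hEv]
  refine VerticalNormal.of_push hd htΦ hV' (VerticalNormal.of_agreeOn hρ Subset.rfl (k := .xu)
    (agreeOn_span (s := {genX, genU}) ?_ ?_) rfl trivial)
  · rintro g (rfl | rfl)
    exacts [⟨_, Submodule.mem_map_of_mem hS, hx⟩, ⟨_, Submodule.mem_map_of_mem hS₀, hu⟩]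
  intro R hR
  have hSm := Submodule.mem_map_of_mem (f := pushField Φ Ψ) hS
  have hS₀m := Submodule.mem_map_of_mem (f := pushField Φ Ψ) hS₀
  let β : ℝ → ℝ := fun t => (R (t, w₁.2)).2.1
  let γ : ℝ → ℝ := fun t => (R (t, w₁.2)).2.2
  have hmaps : ∀ t ∈ Metric.ball w₁.1 ρ, ((t, w₁.2) : Pt) ∈ Metric.ball w₁ ρ := fun t ht =>
    mem_ball_pt.2 ⟨ht, Metric.mem_ball_self hρ, Metric.mem_ball_self hρ⟩
  have hRsm : ContDiffOn ℝ ∞ (fun t : ℝ => R (t, w₁.2)) (Metric.ball w₁.1 ρ) :=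
    (hT.smooth R hR).comp (by fun_prop) hmaps
  have hβ : ContDiffOn ℝ ∞ β (Metric.ball w₁.1 ρ) := hRsm.snd.fst
  have hγ : ContDiffOn ℝ ∞ γ (Metric.ball w₁.1 ρ) := hRsm.snd.snd
  have hRβγ : ∀ w ∈ Metric.ball w₁ ρ, R w = β w.1 • genX w + γ w.1 • genU w := by
    intro w hw
    have hw' := mem_ball_pt.1 hw
    have hm1 : ((w.1, w.2.1, w₁.2.2) : Pt) ∈ Metric.ball w₁ ρ :=
      mem_ball_pt.2 ⟨hw'.1, hw'.2.1, Metric.mem_ball_self hρ⟩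
    have h1 : R w = R (w.1, w.2.1, w₁.2.2) := hT.eq_of_eq_tx hS₀m hu hR hw hm1 rfl rfl
    have h2 : R (w.1, w.2.1, w₁.2.2) = R (w.1, w₁.2) :=
      eq_of_fderiv_direction_eq_zero (hT.smooth R hR) (v := (0, 1, 0)) (fun w hw =>
        fderiv_eq_zero_of_lieBracket hT.isOpen hx hw (hT.abelian _ hSm R hR w hw)) (hmaps _ hw'.1) hm1
        ⟨w.2.1 - w₁.2.1, by ext <;> simp⟩
    have h3 : (R (w.1, w₁.2)).1 = 0 := hT.vertical R hR _ (hmaps _ hw'.1)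
    rw [h1, h2]
    refine Prod.ext ?_ (Prod.ext ?_ ?_) <;> simp [genX, genU, β, γ, h3]
  have hd0 : ∀ t ∈ Metric.ball w₁.1 ρ, deriv β t = 0 ∧ deriv γ t = 0 := by
    intro t ht
    have hm := hmaps t ht
    have h1 := hT.timeRigid _ hSm _ hS₀m R hR β γ _ Metric.isOpen_ball hβ hγ (t, w₁.2) hm ht (by
      filter_upwards [Metric.isOpen_ball.mem_nhds hm] with q hq
      rw [hRβγ q hq, hx hq, hu hq])
    rw [hx hm, hu hm] at h1
    have h2 := congrArg (fun q : Pt => q.2.1) h1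
    have h3 := congrArg (fun q : Pt => q.2.2) h1
    simp only [genX, genU, Prod.snd_add, Prod.fst_add, Prod.smul_snd, Prod.smul_fst, smul_eq_mul,
      mul_one, mul_zero, add_zero, zero_add, Prod.fst_zero, Prod.snd_zero] at h2 h3
    exact ⟨h2, h3⟩
  refine ⟨_, Submodule.mem_span_pair.2 ⟨β w₁.1, γ w₁.1, rfl⟩, fun w hw => ?_⟩
  have hw' := mem_ball_pt.1 hw
  have hβ' : β w.1 = β w₁.1 := const_of_hasDerivAt_zero (fun s hs => by
      rw [← (hd0 s hs).1]
      exact (differentiableAt_of_contDiffOn Metric.isOpen_ball hβ hs).hasDerivAt) hw'.1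
      (Metric.mem_ball_self hρ)
  have hγ' : γ w.1 = γ w₁.1 := const_of_hasDerivAt_zero (fun s hs => by
      rw [← (hd0 s hs).2]
      exact (differentiableAt_of_contDiffOn Metric.isOpen_ball hγ hs).hasDerivAt) hw'.1
      (Metric.mem_ball_self hρ)
  rw [hRβγ w hw, hβ', hγ']
  rfl

/-- An algebra without `∂_t` is, near some point, zero or equivalent to a canonical one. -/
theorem Tame.eq_zero_or_verticalNormal {V : Set Pt} {A : Submodule ℝ VField} (h : Tame V A) :
    (∀ Q ∈ A, ∀ p ∈ V, Q p = 0) ∨ VerticalNormal V A := by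
  by_cases h0 : ∀ Q ∈ A, ∀ p ∈ V, Q p = 0
  · exact Or.inl h0
  push Not at h0
  obtain ⟨Q, hQ, p, hp, hQp⟩ := h0
  obtain ⟨V', Φ, Ψ, w₀, r, hr, hV', hd, ht, hu⟩ := h.exists_straighten_u hQ hp hQp
  have hT := (h.restrict hd.isOpen_source hV').push hd ht
  have hQm := Submodule.mem_map_of_mem (f := pushField Φ Ψ) hQ
  refine Or.inr (VerticalNormal.of_push hd ht hV' ?_)
  by_cases hb : ∀ S ∈ A.map (pushField Φ Ψ), ∀ w ∈ Metric.ball w₀ r, (S w).2.1 = 0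
  · exact hT.verticalNormal_of_genU hr hQm hu hb
  · push Not at hb
    obtain ⟨S, hS, w, hw, hSw⟩ := hb
    exact hT.verticalNormal_of_genX hQm hu hS hw hSw

end VerticalClassification
end EvolEq

namespace EvolEq
open Set Filter Topology

/-! ### Straightening a field with a `∂_t`-component -/

section Freeze

/-- Equivalence asks only that the new `t` be some function of the old one; its regularity comes
from that of the transformation. -/
theorem exists_function_of_factors {ι : Type*} {s : Set ι} {f g : ι → ℝ}
    (h : ∀ p ∈ s, ∀ q ∈ s, f p = f q → g p = g q) : ∃ T : ℝ → ℝ, ∀ p ∈ s, g p = T (f p) := by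
  classical
  refine ⟨fun t => if ht : ∃ p ∈ s, f p = t then g ht.choose else 0, fun p hp => ?_⟩
  have ht : ∃ q ∈ s, f q = f p := ⟨p, hp, rfl⟩
  simp only [dif_pos ht]
  exact h _ hp _ ht.choose_spec.1 ht.choose_spec.2.symm

/-- A field with nonvanishing `∂_t`-component is transformed into `∂_t`, and the fields without
`∂_t`-component that commute with it become their values at a fixed time. -/
theorem exists_straighten_t {W : Set Pt} (hW : IsOpen W) {Q : VField} (hQ : ContDiffOn ℝ ∞ Q W)
    {a : ℝ → ℝ} (ha : ∀ p ∈ W, (Q p).1 = a p.1) (ha0 : ∀ p ∈ W, a p.1 ≠ 0) {p : Pt} (hp : p ∈ W) :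
    ∃ (r : ℝ) (w₁ : Pt) (V : Set Pt) (Φ Ψ : Pt → Pt), 0 < r ∧ V ⊆ W ∧
      IsDiffeo V (Metric.ball w₁ r) Φ Ψ ∧ (∃ T : ℝ → ℝ, ∀ q ∈ V, (Φ q).1 = T q.1) ∧
      (∃ S : ℝ → ℝ, ∀ w ∈ Metric.ball w₁ r, (Ψ w).1 = S w.1) ∧
      (∀ w ∈ Metric.ball w₁ r, ((p.1, w.2) : Pt) ∈ W) ∧
      EqOn (pushField Φ Ψ Q) genT (Metric.ball w₁ r) ∧
      ∀ g : VField, ContDiffOn ℝ ∞ g W → (∀ q ∈ W, (g q).1 = 0) →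
        (∀ q ∈ W, VectorField.lieBracket ℝ Q g q = 0) →
        EqOn (pushField Φ Ψ g) (fun w => g (p.1, w.2)) (Metric.ball w₁ r) := by
  obtain ⟨Fl, ε, hε, hsm, hFl⟩ := exists_smooth_flow hW hQ hp
  let L : Pt →L[ℝ] ℝ × Pt := (ContinuousLinearMap.fst ℝ ℝ (ℝ × ℝ)).prod
    ((0 : Pt →L[ℝ] ℝ).prod (ContinuousLinearMap.snd ℝ ℝ (ℝ × ℝ)))
  have hLv : ∀ v : Pt, L v = (v.1, 0, v.2) := fun v => rfl
  -- The parameter `(t, x, u)` is sent to the point reached in time `t` from `(p.1, x, u)`.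
  let ι : Pt → ℝ × Pt := fun w => L w + (0, p.1, 0)
  have hιw : ∀ w, ι w = (w.1, p.1, w.2) := fun w => by ext <;> simp [ι, hLv]
  have hι : ∀ w, HasFDerivAt ι L w := fun w => L.hasFDerivAt.add_const _
  have hιsm : ContDiff ℝ ∞ ι := L.contDiff.add contDiff_const
  let w₁ : Pt := (0, p.2)
  have hι0 : ι w₁ = (0, p) := by rw [hιw]
  have hFl0 : Fl (0, p) = p := (hFl (0, p) (Metric.mem_ball_self hε)).2.1
  let N₀ : Set Pt := ι ⁻¹' Metric.ball (0, p) ε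
  have hN₀ : IsOpen N₀ := Metric.isOpen_ball.preimage hιsm.continuous
  let Ψ : Pt → Pt := fun w => Fl (ι w)
  have hΨ₀ : ContDiffOn ℝ ∞ Ψ N₀ := hsm.comp hιsm.contDiffOn fun w hw => hw
  -- the coefficient `a` is smooth near `p.1`, hence locally Lipschitz
  have haL : ∃ K, ∃ s ∈ 𝓝 p.1, LipschitzOnWith K a s := by
    have h1 : ∀ᶠ t in 𝓝 p.1, ((t, p.2) : Pt) ∈ W :=
      (show ContinuousAt (fun t : ℝ => ((t, p.2) : Pt)) p.1 by fun_prop).eventually_mem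
        (hW.mem_nhds hp)
    have h2 : ContDiffAt ℝ ∞ (fun t : ℝ => (Q (t, p.2)).1) p.1 :=
      contDiffAt_fst.comp p.1 ((hQ.contDiffAt (hW.mem_nhds hp)).comp p.1 (f := fun t : ℝ => (t, p.2))
        (by fun_prop))
    have h3 : ContDiffAt ℝ ∞ a p.1 := h2.congr_of_eventuallyEq <| by
      filter_upwards [h1] with t ht
      rw [ha _ ht]
    exact (h3.of_le (by simp)).exists_lipschitzOnWith
  obtain ⟨K, s, hs, haK⟩ := haL
  obtain ⟨s', hs's, hs'o, hps'⟩ := mem_nhds_iff.1 hs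
  let N : Set Pt := N₀ ∩ Ψ ⁻¹' (Prod.fst ⁻¹' s')
  have hN : IsOpen N :=
    hΨ₀.continuousOn.isOpen_inter_preimage hN₀ (hs'o.preimage continuous_fst)
  have hΨ : ContDiffOn ℝ ∞ Ψ N := hΨ₀.mono inter_subset_left
  have hΨw₁ : Ψ w₁ = p := by simp only [Ψ, hι0, hFl0]
  have hw₁ : w₁ ∈ N :=
    ⟨by rw [mem_preimage, hι0]; exact Metric.mem_ball_self hε,
      by rw [mem_preimage, hΨw₁]; exact hps'⟩
  have hΨ' : ∀ w ∈ N, ∀ v, fderiv ℝ Ψ w v = fderiv ℝ Fl (ι w) (L v) := fun w hw v =>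
    DFunLike.congr_fun ((differentiableAt_of_contDiffOn Metric.isOpen_ball hsm hw.1).hasFDerivAt.comp w
      (hι w)).fderiv v
  have hQp : (Q p).1 ≠ 0 := by rw [ha p hp]; exact ha0 p hp
  obtain ⟨r, hr, V', Φ, hV', hbN, hd⟩ := exists_chart hN hΨ hw₁ hW (by rw [hΨw₁]; exact hp) (by
      intro v hv
      rw [hΨ' _ hw₁, hι0, fderiv_flow_zero hε hsm fun z hz => (hFl z hz).2] at hv
      have h1 := congrArg Prod.fst hv
      have h2 := congrArg Prod.snd hv
      simp only [hLv, Prod.fst_add, Prod.snd_add, Prod.smul_fst, Prod.smul_snd, smul_eq_mul,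
        Prod.fst_zero, Prod.snd_zero, add_zero] at h1 h2
      have h4 : v.1 = 0 := (mul_eq_zero.1 h1).resolve_right hQp
      rw [h4, zero_smul, zero_add] at h2
      exact Prod.ext h4 h2)
  -- lines in the direction of `t`
  have hline : ∀ w ∈ Metric.ball w₁ r, ∀ τ ∈ Ioo (-r) r, ((τ, w.2) : Pt) ∈ Metric.ball w₁ r := by
    intro w hw τ hτ
    have h1 := mem_ball_pt.1 hw
    refine mem_ball_pt.2 ⟨?_, h1.2⟩
    change τ ∈ Metric.ball 0 r
    rwa [Real.ball_eq_Ioo, zero_sub, zero_add]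
  have hτ : ∀ w ∈ Metric.ball w₁ r, w.1 ∈ Ioo (-r) r := by
    intro w hw
    have h1 : w.1 ∈ Metric.ball 0 r := (mem_ball_pt.1 hw).1
    rwa [Real.ball_eq_Ioo, zero_sub, zero_add] at h1
  have h0r : (0 : ℝ) ∈ Ioo (-r) r := ⟨by linarith, hr⟩
  have hΨ0 : ∀ w ∈ Metric.ball w₁ r, Ψ (0, w.2) = (p.1, w.2) := by
    intro w hw
    have hm := (hbN (hline w hw 0 h0r)).1
    have := (hFl _ hm).2.1
    rw [hιw] at this
    simp only [Ψ, hιw]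
    exact this
  have hcurve : ∀ w ∈ Metric.ball w₁ r, ∀ τ ∈ Ioo (-r) r,
      HasDerivAt (fun τ => Ψ (τ, w.2)) (Q (Ψ (τ, w.2))) τ := by
    intro w hw τ hτ
    have := (hFl _ (hbN (hline w hw τ hτ)).1).2.2
    simp only [hιw] at this
    simp only [Ψ, hιw]
    exact this
  have hcurve₁ : ∀ w ∈ Metric.ball w₁ r, ∀ τ ∈ Ioo (-r) r,
      HasDerivAt (fun τ => (Ψ (τ, w.2)).1) (a (Ψ (τ, w.2)).1) τ := by
    intro w hw τ hτ
    have h1 := (ContinuousLinearMap.fst ℝ ℝ (ℝ × ℝ)).hasFDerivAt.comp_hasDerivAt τ (hcurve w hw τ hτ)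
    have h2 := ha _ (hV' (hd.mapsTo_inv (hline w hw τ hτ)))
    rw [← h2]
    exact h1
  -- The `t`-coordinate of the flow solves the scalar equation with right-hand side `a` and initial
  -- value `p.1`. By uniqueness it depends only on the flow time, so the chart has the required
  -- form.
  have hΨt : ∀ w ∈ Metric.ball w₁ r, ∀ w' ∈ Metric.ball w₁ r, w.1 = w'.1 → (Ψ w).1 = (Ψ w').1 := by
    intro w hw w' hw' e
    have key : EqOn (fun τ => (Ψ (τ, w.2)).1) (fun τ => (Ψ (τ, w'.2)).1) (Ioo (-r) r) :=
      ODE_solution_unique_of_mem_Ioo (v := fun _ => a) (s := fun _ => s) (fun _ _ => haK) h0r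
        (fun τ hτ => ⟨hcurve₁ w hw τ hτ, hs's (hbN (hline w hw τ hτ)).2⟩)
        (fun τ hτ => ⟨hcurve₁ w' hw' τ hτ, hs's (hbN (hline w' hw' τ hτ)).2⟩)
        (by simp only [hΨ0 w hw, hΨ0 w' hw'])
    have := key (hτ w hw)
    simp only at this
    rw [show Ψ w = Ψ (w.1, w.2) from rfl, this, e]
  -- Conversely the flow time is determined by `t`: equal values at two times would, by Rolle's
  -- theorem, give a zero of `a` in between.
  have hΨinj : ∀ w ∈ Metric.ball w₁ r, ∀ w' ∈ Metric.ball w₁ r, (Ψ w).1 = (Ψ w').1 → w.1 = w'.1 := by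
    suffices ∀ w ∈ Metric.ball w₁ r, ∀ w' ∈ Metric.ball w₁ r, w.1 < w'.1 → (Ψ w).1 ≠ (Ψ w').1 by
      intro w hw w' hw' e
      rcases lt_trichotomy w.1 w'.1 with h1 | h1 | h1
      exacts [absurd e (this w hw w' hw' h1), h1, absurd e.symm (this w' hw' w hw h1)]
    intro w hw w' hw' hlt e
    have hm := hline w hw _ (hτ w' hw')
    rw [hΨt w' hw' _ hm rfl] at e
    have hI : Icc w.1 w'.1 ⊆ Ioo (-r) r := fun τ h => ⟨(hτ w hw).1.trans_le h.1, h.2.trans_lt (hτ w' hw').2⟩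
    obtain ⟨τ, hτI, h0⟩ := exists_hasDerivAt_eq_zero hlt
      (fun τ h => (hcurve₁ w hw τ (hI h)).continuousAt.continuousWithinAt) e
      (fun τ h => hcurve₁ w hw τ (hI (Ioo_subset_Icc_self h)))
    exact ha0 _ (hV' (hd.mapsTo_inv (hline w hw τ (hI (Ioo_subset_Icc_self hτI))))) h0
  have hpush : EqOn (pushField Φ Ψ Q) genT (Metric.ball w₁ r) := by
    intro w hw
    rw [hd.pushField_eq_iff hw]
    have h1 : HasDerivAt (fun τ : ℝ => ((τ, w.2) : Pt)) (genT w) w.1 :=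
      (hasDerivAt_id _).prodMk (hasDerivAt_const _ _)
    exact ((differentiableAt_of_contDiffOn hN hΨ (hbN hw)).hasFDerivAt.comp_hasDerivAt
      (f := fun τ : ℝ => ((τ, w.2) : Pt)) w.1 h1).unique (hcurve w hw w.1 (hτ w hw))
  refine ⟨r, w₁, V', Φ, Ψ, hr, hV', hd, ?_, exists_function_of_factors hΨt, ?_, hpush, ?_⟩
  · refine exists_function_of_factors fun q hq q' hq' e => ?_
    refine hΨinj _ (hd.mapsTo hq) _ (hd.mapsTo hq') ?_
    rw [hd.left_inv hq, hd.left_inv hq', e]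
  · intro w hw
    rw [← hΨ0 w hw]
    exact hV' (hd.mapsTo_inv (hline w hw 0 h0r))
  · intro g hg hg1 hgQ w hw
    have hsmg := hd.contDiffOn_pushField (hg.mono hV')
    have hm := hline w hw 0 h0r
    -- The transported field commutes with `∂_t`, so it equals its value on the slice at parameter
    -- time `0`. There `Ψ` is the translation to the slice `t = p.1`, to which `g` is tangent.
    have h1 : pushField Φ Ψ g (0, w.2) = pushField Φ Ψ g w :=
      eq_of_fderiv_direction_eq_zero hsmg (v := (1, 0, 0)) (fun q hq =>
        fderiv_eq_zero_of_lieBracket Metric.isOpen_ball hpush hq (by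
          rw [hd.lieBracket_pushField (hQ.mono hV') (hg.mono hV') hq,
            hgQ _ (hV' (hd.mapsTo_inv hq)), map_zero])) hw hm ⟨-w.1, by ext <;> simp⟩
    rw [← h1, hd.pushField_eq_iff hm, hΨ0 w hw]
    have hg0 := hg1 (p.1, w.2) (by
      rw [← hΨ0 w hw]; exact hV' (hd.mapsTo_inv hm))
    set v := g (p.1, w.2)
    -- the line through `(0, w.2)` in the direction of `v`
    have h2 : HasDerivAt (fun τ : ℝ => ((0, w.2) : Pt) + τ • v) v 0 := by
      have := ((hasDerivAt_id (0 : ℝ)).smul_const v).const_add ((0, w.2) : Pt)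
      rwa [one_smul] at this
    have h3 : HasDerivAt (fun τ : ℝ => Ψ (((0, w.2) : Pt) + τ • v)) (fderiv ℝ Ψ (0, w.2) v) 0 := by
      have h4 : DifferentiableAt ℝ Ψ (((0, w.2) : Pt) + (0 : ℝ) • v) := by
        rw [zero_smul, add_zero]
        exact differentiableAt_of_contDiffOn hN hΨ (hbN hm)
      have h5 := h4.hasFDerivAt.comp_hasDerivAt (f := fun τ : ℝ => ((0, w.2) : Pt) + τ • v) 0 h2
      rwa [zero_smul, add_zero] at h5
    have h6 : HasDerivAt (fun τ : ℝ => ((p.1, w.2) : Pt) + τ • v) v 0 := by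
      have := ((hasDerivAt_id (0 : ℝ)).smul_const v).const_add ((p.1, w.2) : Pt)
      rwa [one_smul] at this
    refine h3.unique (h6.congr_of_eventuallyEq ?_)
    have h7 : ∀ᶠ τ in 𝓝 (0 : ℝ), ((0, w.2) : Pt) + τ • v ∈ Metric.ball w₁ r :=
      (show ContinuousAt (fun τ : ℝ => ((0, w.2) : Pt) + τ • v) 0 by fun_prop).eventually_mem
        (Metric.isOpen_ball.mem_nhds (by rwa [zero_smul, add_zero]))
    filter_upwards [h7] with τ hτ'
    have h8 := hΨ0 _ hτ'
    have h9 : ((0, w.2) : Pt) + τ • v = (0, (((0, w.2) : Pt) + τ • v).2) := by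
      ext <;> simp [hg0]
    have h10 : ((p.1, w.2) : Pt) + τ • v = (p.1, (((0, w.2) : Pt) + τ • v).2) := by
      ext <;> simp [hg0]
    rw [h10, ← h8, ← h9]

/-- Freezing the generators at one time is linear, so it carries the span of `s` to the span of the
frozen fields while `Q` becomes `∂_t`. The generators need only agree on `W` with elements of `A`,
which suffices for the brackets. -/
theorem exists_equivalent_freeze {W : Set Pt} (hW : IsOpen W) {A : Submodule ℝ VField}
    (hA : ∀ R ∈ A, ContDiffOn ℝ ∞ R W) (hab : IsAbelianOn W A) {Q : VField} (hQ : Q ∈ A)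
    {a : ℝ → ℝ} (ha : ∀ p ∈ W, (Q p).1 = a p.1) (ha0 : ∀ p ∈ W, a p.1 ≠ 0) {s : Set VField}
    (hs : ∀ g ∈ s, ∀ p ∈ W, (g p).1 = 0) (h₁ : ∀ g ∈ s, ∃ R ∈ A, EqOn R g W)
    (h₂ : ∀ R ∈ A, ∃ k : ℝ, ∃ S ∈ Submodule.span ℝ s, EqOn R (k • Q + S) W) {p : Pt} (hp : p ∈ W) :
    ∃ (r : ℝ) (w₁ : Pt) (V : Set Pt), 0 < r ∧ V ⊆ W ∧ IsOpen V ∧ V.Nonempty ∧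
      (∀ w ∈ Metric.ball w₁ r, ((p.1, w.2) : Pt) ∈ W) ∧
      Equivalent V A (Metric.ball w₁ r)
        (Submodule.span ℝ (insert genT ((fun (g : VField) (w : Pt) => g (p.1, w.2)) '' s))) := by
  obtain ⟨r, w₁, V, Φ, Ψ, hr, hVW, hd, hT, hS, hsl, hpQ, hpg⟩ := exists_straighten_t hW (hA Q hQ) ha ha0 hp
  have hpg' : ∀ g ∈ s, EqOn (pushField Φ Ψ g) (fun w => g (p.1, w.2)) (Metric.ball w₁ r) := by
    intro g hg
    obtain ⟨R, hR, e⟩ := h₁ g hg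
    refine hpg g ((hA R hR).congr fun q hq => (e hq).symm) (hs g hg) fun q hq => ?_
    rw [← (EventuallyEq.refl (𝓝 q) Q).lieBracket_vectorField_eq
      (e.eventuallyEq_of_mem (hW.mem_nhds hq))]
    exact hab Q hQ R hR q hq
  have hpush : ∀ {R R' : VField}, EqOn R R' W → EqOn (pushField Φ Ψ R) (pushField Φ Ψ R')
      (Metric.ball w₁ r) := fun e w hw => by
    rw [pushField_apply, pushField_apply, e (hVW (hd.mapsTo_inv hw))]
  refine ⟨r, w₁, V, hr, hVW, hd.isOpen_source, ⟨Ψ w₁, hd.mapsTo_inv (Metric.mem_ball_self hr)⟩, hsl, ?_⟩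
  have hag : AgreeOn (Metric.ball w₁ r) (A.map (pushField Φ Ψ))
      (Submodule.span ℝ (insert genT ((fun (g : VField) (w : Pt) => g (p.1, w.2)) '' s))) := by
    refine agreeOn_span ?_ ?_
    · rintro g (rfl | ⟨g, hg, rfl⟩)
      · exact ⟨_, Submodule.mem_map_of_mem hQ, hpQ⟩
      · obtain ⟨R, hR, e⟩ := h₁ g hg
        exact ⟨_, Submodule.mem_map_of_mem hR, (hpush e).trans (hpg' g hg)⟩
    · rintro _ ⟨R, hR, rfl⟩
      obtain ⟨k, S, hS, e⟩ := h₂ R hR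
      have hSS : ∃ S' ∈ Submodule.span ℝ ((fun (g : VField) (w : Pt) => g (p.1, w.2)) '' s),
          EqOn (pushField Φ Ψ S) S' (Metric.ball w₁ r) := by
        clear e
        induction hS using Submodule.span_induction with
        | mem g hg => exact ⟨_, Submodule.subset_span ⟨g, hg, rfl⟩, hpg' g hg⟩
        | zero => exact ⟨0, Submodule.zero_mem _, fun w _ => by simp⟩
        | add x y _ _ hx hy =>
          obtain ⟨x', hx', ex⟩ := hx
          obtain ⟨y', hy', ey⟩ := hy
          exact ⟨_, add_mem hx' hy', fun w hw => by simp [ex hw, ey hw]⟩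
        | smul c x _ hx =>
          obtain ⟨x', hx', ex⟩ := hx
          exact ⟨_, Submodule.smul_mem _ c hx', fun w hw => by simp [ex hw]⟩
      obtain ⟨S', hS', e'⟩ := hSS
      refine ⟨k • genT + S', add_mem (Submodule.smul_mem _ _ (Submodule.subset_span (mem_insert _ _)))
        (Submodule.span_mono (subset_insert _ _) hS'), fun w hw => ?_⟩
      rw [hpush e hw]
      simp [hpQ hw, e' hw]
  refine ⟨Φ, Ψ, hd.3, hd.4, hd.5, hd.6, hd.7, hd.8, hT, hS, ?_, ?_⟩
  · intro R hR
    obtain ⟨R', hR', e⟩ := hag.1 _ (Submodule.mem_map_of_mem hR)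
    refine ⟨R', hR', fun q hq => ?_⟩
    rw [← e (hd.3 hq), pushField_apply, hd.5 hq]
  · intro R' hR'
    obtain ⟨_, ⟨R, hR, rfl⟩, e⟩ := hag.2 R' hR'
    refine ⟨R, hR, fun q hq => ?_⟩
    rw [← e (hd.3 hq), pushField_apply, hd.5 hq]

end Freeze
end EvolEq

namespace EvolEq
open Set Filter Topology

/-! ### Commuting with a field that has a `∂_t`-component -/

section Commuting

theorem isOpen_projTX {W : Set Pt} (hW : IsOpen W) : IsOpen (projTX W) :=
  (IsOpenMap.id.prodMap isOpenMap_fst : IsOpenMap (Prod.map id Prod.fst : Pt → ℝ × ℝ)) W hW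

theorem hasDerivAt_slice_x {N : Set (ℝ × ℝ)} (hN : IsOpen N) {h : ℝ × ℝ → ℝ}
    (hh : ContDiffOn ℝ ∞ h N) {z : ℝ × ℝ} (hz : z ∈ N) :
    HasDerivAt (fun x => h (z.1, x)) (Dx h z) z.2 :=
  (differentiableAt_of_contDiffOn hN hh hz).hasFDerivAt.comp_hasDerivAt (f := fun x : ℝ => (z.1, x))
    z.2 ((hasDerivAt_const _ _).prodMk (hasDerivAt_id _))

theorem hasDerivAt_slice_t {N : Set (ℝ × ℝ)} (hN : IsOpen N) {h : ℝ × ℝ → ℝ}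
    (hh : ContDiffOn ℝ ∞ h N) {z : ℝ × ℝ} (hz : z ∈ N) :
    HasDerivAt (fun t => h (t, z.2)) (Dt h z) z.1 :=
  (differentiableAt_of_contDiffOn hN hh hz).hasFDerivAt.comp_hasDerivAt (f := fun t : ℝ => (t, z.2))
    z.1 ((hasDerivAt_id _).prodMk (hasDerivAt_const _ _))

theorem fderiv_coefU {W : Set Pt} (hW : IsOpen W) {h : ℝ × ℝ → ℝ} (hh : ContDiffOn ℝ ∞ h (projTX W))
    {p : Pt} (hp : p ∈ W) (v : Pt) :
    fderiv ℝ (coefU h) p v = (0, 0, Dt h (p.1, p.2.1) * v.1 + Dx h (p.1, p.2.1) * v.2.1) := by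
  let L : Pt →L[ℝ] ℝ × ℝ := (ContinuousLinearMap.fst ℝ ℝ (ℝ × ℝ)).prod
    ((ContinuousLinearMap.fst ℝ ℝ ℝ).comp (ContinuousLinearMap.snd ℝ ℝ (ℝ × ℝ)))
  have hm : L p ∈ projTX W := ⟨p, hp, rfl⟩
  have h1 : HasFDerivAt (fun w : Pt => h (L w)) ((fderiv ℝ h (L p)).comp L) p :=
    HasFDerivAt.comp (g := h) (f := L) p
      (differentiableAt_of_contDiffOn (isOpen_projTX hW) hh hm).hasFDerivAt L.hasFDerivAt
  have h2 : HasFDerivAt (coefU h) ((0 : Pt →L[ℝ] ℝ).prod ((0 : Pt →L[ℝ] ℝ).prod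
      ((fderiv ℝ h (L p)).comp L))) p :=
    (hasFDerivAt_const _ _).prodMk ((hasFDerivAt_const _ _).prodMk h1)
  rw [h2.fderiv]
  refine Prod.ext rfl (Prod.ext rfl ?_)
  change fderiv ℝ h (p.1, p.2.1) (v.1, v.2.1) = _
  have e : ((v.1, v.2.1) : ℝ × ℝ) = v.1 • (1, 0) + v.2.1 • (0, 1) := by ext <;> simp
  rw [e, map_add, map_smul, map_smul, Dt, Dx, smul_eq_mul, smul_eq_mul]
  ring

/-- If a field with nonzero `∂_t`-component commutes with `∂_u`, `x ∂_u` and `h ∂_u`, then `h_t = 0`. -/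
theorem Dt_eq_zero_of_commute {W : Set Pt} (hW : IsOpen W) {Q : VField} {h : ℝ × ℝ → ℝ}
    (hh : ContDiffOn ℝ ∞ h (projTX W)) {p : Pt} (hp : p ∈ W)
    (hu : VectorField.lieBracket ℝ genU Q p = 0) (hx : VectorField.lieBracket ℝ xGenU Q p = 0)
    (hc : VectorField.lieBracket ℝ (coefU h) Q p = 0) (hQ : (Q p).1 ≠ 0) :
    Dt h (p.1, p.2.1) = 0 := by
  have h1 : fderiv ℝ Q p (0, 0, 1) = 0 :=
    fderiv_eq_zero_of_lieBracket hW (S₀ := genU) (v := (0, 0, 1)) (fun _ _ => rfl) hp hu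
  have h2 : ∀ k : ℝ, fderiv ℝ Q p (0, 0, k) = 0 := fun k => by
    have e : ((0, 0, k) : Pt) = k • (0, 0, 1) := by ext <;> simp
    rw [e, map_smul, h1, smul_zero]
  have hsx : ContDiffOn ℝ ∞ (fun z : ℝ × ℝ => z.2) (projTX W) := contDiffOn_snd
  have hDx : Dx (fun z : ℝ × ℝ => z.2) (p.1, p.2.1) = 1 :=
    Dx_eq_of_hasDerivAt differentiableAt_snd (hasDerivAt_id _)
  have hDt : Dt (fun z : ℝ × ℝ => z.2) (p.1, p.2.1) = 0 :=
    Dt_eq_of_hasDerivAt differentiableAt_snd (hasDerivAt_const _ _)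
  rw [VectorField.lieBracket, xGenU, fderiv_coefU hW hsx hp, hDx, hDt] at hx
  rw [VectorField.lieBracket, fderiv_coefU hW hh hp] at hc
  simp only [coefU, h2, zero_sub, neg_eq_zero, Prod.mk_eq_zero, true_and, zero_mul, one_mul,
    zero_add] at hx hc
  -- `Q` does not depend on `u`, so commuting with `x ∂_u` says that its `∂_x`-component vanishes;
  -- the last bracket then reduces to `h_t` times the `∂_t`-component.
  rw [hx, mul_zero, add_zero] at hc
  exact (mul_eq_zero.1 hc).resolve_right hQ

/-- Two functions of `x` whose second derivatives are proportional in the sense of the compatibility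
condition are related by an affine function. -/
theorem affine_relation {z₀ : ℝ × ℝ} {r : ℝ} (hr : 0 < r) {c q f : ℝ × ℝ → ℝ}
    (hc : ContDiffOn ℝ ∞ c (Metric.ball z₀ r)) (hq : ContDiffOn ℝ ∞ q (Metric.ball z₀ r))
    (hcx : ∀ z ∈ Metric.ball z₀ r, Dx (Dx c) z ≠ 0)
    (hqx : ∀ z ∈ Metric.ball z₀ r, Dx (Dx q) z ≠ 0) (hf : ∀ z ∈ Metric.ball z₀ r, f z ≠ 0)
    (hct : ∀ z ∈ Metric.ball z₀ r, Dt c z = 0) (hqt : ∀ z ∈ Metric.ball z₀ r, Dt q z = 0)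
    (h : ∀ z ∈ Metric.ball z₀ r, (Dt c z - f z * Dx (Dx (Dx c)) z) / Dx (Dx c) z =
      (Dt q z - f z * Dx (Dx (Dx q)) z) / Dx (Dx q) z) :
    ∃ α β k : ℝ, ∀ z ∈ Metric.ball z₀ r, q z = k * c z + β * z.2 + α := by
  have ho : IsOpen (Metric.ball z₀ r) := Metric.isOpen_ball
  have hm : ∀ x ∈ Metric.ball z₀.2 r, (z₀.1, x) ∈ Metric.ball z₀ r := fun x hx =>
    mem_ball_tx.2 ⟨Metric.mem_ball_self hr, hx⟩
  have hz : z₀.2 ∈ Metric.ball z₀.2 r := Metric.mem_ball_self hr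
  have hc1 := contDiffOn_Dx ho hc
  have hc2 := contDiffOn_Dx ho hc1
  have hq1 := contDiffOn_Dx ho hq
  have hq2 := contDiffOn_Dx ho hq1
  -- Without `t`-derivatives the condition says `q_xxx c_xx = q_xx c_xxx`, that is, `q_xx / c_xx` is
  -- constant in `x`; two integrations give the affine terms.
  let k : ℝ := Dx (Dx q) z₀ / Dx (Dx c) z₀
  have hk : ∀ x ∈ Metric.ball z₀.2 r, Dx (Dx q) (z₀.1, x) - k * Dx (Dx c) (z₀.1, x) = 0 := by
    intro x hx
    have h1 : Dx (Dx q) (z₀.1, x) / Dx (Dx c) (z₀.1, x) = k :=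
      const_of_hasDerivAt_zero (g := fun x => Dx (Dx q) (z₀.1, x) / Dx (Dx c) (z₀.1, x))
        (fun y hy => by
          have hy' := hm y hy
          have h2 := (hasDerivAt_slice_x ho hq2 hy').div (hasDerivAt_slice_x ho hc2 hy') (hcx _ hy')
          have h3 := h _ hy'
          rw [hct _ hy', hqt _ hy', div_eq_div_iff (hcx _ hy') (hqx _ hy')] at h3
          have h4 : Dx (Dx (Dx q)) (z₀.1, y) * Dx (Dx c) (z₀.1, y) -
              Dx (Dx q) (z₀.1, y) * Dx (Dx (Dx c)) (z₀.1, y) = 0 := by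
            apply mul_left_cancel₀ (hf _ hy')
            linear_combination h3
          simp only [h4, zero_div] at h2
          exact h2) hx hz
    rw [← h1, div_mul_cancel₀ _ (hcx _ (hm x hx)), sub_self]
  let β : ℝ := Dx q z₀ - k * Dx c z₀
  have hβ : ∀ x ∈ Metric.ball z₀.2 r, Dx q (z₀.1, x) - k * Dx c (z₀.1, x) - β = 0 := by
    intro x hx
    have h1 : Dx q (z₀.1, x) - k * Dx c (z₀.1, x) = β :=
      const_of_hasDerivAt_zero (g := fun x => Dx q (z₀.1, x) - k * Dx c (z₀.1, x))
        (fun y hy => by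
          have h2 := (hasDerivAt_slice_x ho hq1 (hm y hy)).sub
            ((hasDerivAt_slice_x ho hc1 (hm y hy)).const_mul k)
          rw [hk y hy] at h2
          exact h2) hx hz
    rw [h1, sub_self]
  let α : ℝ := q z₀ - k * c z₀ - β * z₀.2
  have hα : ∀ x ∈ Metric.ball z₀.2 r, q (z₀.1, x) - k * c (z₀.1, x) - β * x = α := by
    intro x hx
    exact const_of_hasDerivAt_zero (g := fun x => q (z₀.1, x) - k * c (z₀.1, x) - β * x)
        (fun y hy => by
          have h2 := ((hasDerivAt_slice_x ho hq (hm y hy)).sub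
            ((hasDerivAt_slice_x ho hc (hm y hy)).const_mul k)).sub ((hasDerivAt_id y).const_mul β)
          rw [mul_one, hβ y hy] at h2
          exact h2) hx hz
  have hfreeze : ∀ {g : ℝ × ℝ → ℝ}, ContDiffOn ℝ ∞ g (Metric.ball z₀ r) →
      (∀ z ∈ Metric.ball z₀ r, Dt g z = 0) → ∀ z ∈ Metric.ball z₀ r, g z = g (z₀.1, z.2) := by
    intro g hg hg0 z hzz
    have hz' := mem_ball_tx.1 hzz
    exact const_of_hasDerivAt_zero (g := fun t => g (t, z.2)) (fun t ht => by
      have hm' : (t, z.2) ∈ Metric.ball z₀ r := mem_ball_tx.2 ⟨ht, hz'.2⟩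
      have := hasDerivAt_slice_t ho hg hm'
      rwa [hg0 _ hm'] at this) hz'.1 (Metric.mem_ball_self hr)
  refine ⟨α, β, k, fun z hzz => ?_⟩
  rw [hfreeze hc hct z hzz, hfreeze hq hqt z hzz, ← hα z.2 (mem_ball_tx.1 hzz).2]
  ring

end Commuting

/-! ### Classification of algebras with `∂_t` -/

section WithTime

theorem deriv_deriv_slice {c : ℝ × ℝ → ℝ} {N : Set (ℝ × ℝ)} (hN : IsOpen N)
    (hc : ContDiffOn ℝ ∞ c N) {z : ℝ × ℝ} (hz : z ∈ N) :
    deriv (deriv fun x => c (z.1, x)) z.2 = Dx (Dx c) z := by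
  have h1 : ∀ᶠ x in 𝓝 z.2, (z.1, x) ∈ N :=
    (show ContinuousAt (fun x : ℝ => (z.1, x)) z.2 by fun_prop).eventually_mem (hN.mem_nhds hz)
  have h2 : deriv (fun x => c (z.1, x)) =ᶠ[𝓝 z.2] fun x => Dx c (z.1, x) := by
    filter_upwards [h1] with x hx using (hasDerivAt_slice_x hN hc hx).deriv
  rw [h2.deriv_eq, (hasDerivAt_slice_x hN (contDiffOn_Dx hN hc) hz).deriv]

/-- Some restriction of `A` to an open subset of `V` is equivalent to an algebra of the list. -/
def HasNormalForm (V : Set Pt) (A : Submodule ℝ VField) : Prop :=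
  ∃ V' ⊆ V, IsOpen V' ∧ V'.Nonempty ∧ ∃ (k : AlgType) (W : Set Pt) (B : Submodule ℝ VField),
    IsOpen W ∧ IsCanonical W B k ∧ Equivalent V' A W B

theorem hasNormalForm_of_time_of_span {W : Set Pt} (hW : IsOpen W) {A : Submodule ℝ VField}
    (hA : ∀ R ∈ A, ContDiffOn ℝ ∞ R W) (hab : IsAbelianOn W A) {Q : VField} (hQ : Q ∈ A)
    {a : ℝ → ℝ} (ha : ∀ p ∈ W, (Q p).1 = a p.1) (ha0 : ∀ p ∈ W, a p.1 ≠ 0) {s : Set VField}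
    (hs : ∀ g ∈ s, ∀ p ∈ W, (g p).1 = 0) (h₁ : ∀ g ∈ s, ∃ R ∈ A, EqOn R g W)
    (h₂ : ∀ R ∈ A, ∃ k : ℝ, ∃ S ∈ Submodule.span ℝ s, EqOn R (k • Q + S) W) {p : Pt} (hp : p ∈ W)
    {k : AlgType} (hk : ∀ (w₁ : Pt) (r : ℝ), (∀ w ∈ Metric.ball w₁ r, ((p.1, w.2) : Pt) ∈ W) →
      IsCanonical (Metric.ball w₁ r) (Submodule.span ℝ
        (insert genT ((fun (g : VField) (w : Pt) => g (p.1, w.2)) '' s))) k) :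
    HasNormalForm W A := by
  obtain ⟨r, w₁, V, -, hVW, hV, hne, hsl, he⟩ :=
    exists_equivalent_freeze hW hA hab hQ ha ha0 hs h₁ h₂ hp
  exact ⟨V, hVW, hV, hne, k, _, _, Metric.isOpen_ball, hk w₁ r hsl, he⟩

/-- Straightening `Q` adds `∂_t` to the canonical form `B`, with the function `c` frozen at the time
`w₀.1`. So each type without `∂_t` has at most one extension by `∂_t`, and the series types have
none. -/
theorem hasNormalForm_of_time {w₀ : Pt} {r : ℝ} (hr : 0 < r) {A : Submodule ℝ VField}
    (hA : ∀ R ∈ A, ContDiffOn ℝ ∞ R (Metric.ball w₀ r)) (hab : IsAbelianOn (Metric.ball w₀ r) A)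
    {Q : VField} (hQ : Q ∈ A) {a : ℝ → ℝ} (ha : ∀ p ∈ Metric.ball w₀ r, (Q p).1 = a p.1)
    (ha0 : ∀ p ∈ Metric.ball w₀ r, a p.1 ≠ 0) {B : Submodule ℝ VField}
    (hB : ∀ S ∈ B, ∃ R ∈ A, EqOn R S (Metric.ball w₀ r))
    (hAB : ∀ R ∈ A, ∃ k : ℝ, ∃ S ∈ B, EqOn R (k • Q + S) (Metric.ball w₀ r)) {k : AlgType}
    (hBk : IsCanonical (Metric.ball w₀ r) B k) (hk : k.IsVertical) :
    HasNormalForm (Metric.ball w₀ r) A := by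
  have hw₀ : w₀ ∈ Metric.ball w₀ r := Metric.mem_ball_self hr
  have hgen : ∀ {s : Set VField}, B = Submodule.span ℝ s →
      (∀ g ∈ s, ∃ R ∈ A, EqOn R g (Metric.ball w₀ r)) := fun e g hg =>
    hB g (e ▸ Submodule.subset_span hg)
  have hspan : ∀ {s : Set VField}, B = Submodule.span ℝ s →
      ∀ R ∈ A, ∃ k : ℝ, ∃ S ∈ Submodule.span ℝ s, EqOn R (k • Q + S) (Metric.ball w₀ r) :=
    fun e => e ▸ hAB
  match k, hBk, hk with
  | .u, hBk, _ =>
    refine hasNormalForm_of_time_of_span Metric.isOpen_ball hA hab hQ ha ha0 (s := {genU}) ?_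
      (hgen hBk) (hspan hBk) hw₀ (k := .tu) fun w₁ r' _ => ?_
    · rintro g rfl p _; rfl
    · rw [image_singleton]; rfl
  | .xu, hBk, _ =>
    refine hasNormalForm_of_time_of_span Metric.isOpen_ball hA hab hQ ha ha0 (s := {genX, genU}) ?_
      (hgen hBk) (hspan hBk) hw₀ (k := .txu) fun w₁ r' _ => ?_
    · rintro g (rfl | rfl) p _ <;> rfl
    · rw [image_pair]; rfl
  | .uxu, hBk, _ =>
    refine hasNormalForm_of_time_of_span Metric.isOpen_ball hA hab hQ ha ha0 (s := {genU, xGenU}) ?_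
      (hgen hBk) (hspan hBk) hw₀ (k := .tuxu) fun w₁ r' _ => ?_
    · rintro g (rfl | rfl) p _ <;> rfl
    · rw [image_pair]; rfl
  | .uxuc, ⟨c, hc, hcx, hBk⟩, _ =>
    refine hasNormalForm_of_time_of_span Metric.isOpen_ball hA hab hQ ha ha0
      (s := {genU, xGenU, coefU c}) ?_
      (hgen hBk) (hspan hBk) hw₀ (k := .tuxuc) fun w₁ r' hsl => ⟨fun x => c (w₀.1, x), ?_, ?_, ?_⟩
    · rintro g (rfl | rfl | rfl) p _ <;> rfl
    · refine hc.comp (by fun_prop) ?_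
      rintro _ ⟨w, hw, rfl⟩
      exact ⟨_, hsl w hw, rfl⟩
    · rintro _ ⟨w, hw, rfl⟩
      have hm : (w₀.1, w.2.1) ∈ projTX (Metric.ball w₀ r) := ⟨_, hsl w hw, rfl⟩
      have := deriv_deriv_slice (isOpen_projTX Metric.isOpen_ball) hc hm
      simp only at this
      rw [this]
      exact hcx _ hm
    · rw [image_insert_eq, image_pair]; rfl
  | .series m, ⟨c, q, hc, hq, hcx, hqx, hind, ⟨f, hf, hf0, hfq⟩, hBk⟩, _ =>
    -- Commuting with `Q` forces `c_t = (q 0)_t = 0`; compatibility then makes `q 0` a combination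
    -- of `1`, `x` and `c`, against independence.
    exfalso
    have hcomm : ∀ g ∈ ({genU, xGenU, coefU c} ∪ range fun i => coefU (q i) : Set VField),
        ∀ p ∈ Metric.ball w₀ r, VectorField.lieBracket ℝ g Q p = 0 := by
      intro g hg p hp
      obtain ⟨R, hR, e⟩ := hgen hBk g hg
      rw [← (e.eventuallyEq_of_mem (Metric.isOpen_ball.mem_nhds hp)).lieBracket_vectorField_eq
        (EventuallyEq.refl (𝓝 p) Q)]
      exact hab R hR Q hQ p hp
    have hDt : ∀ h : ℝ × ℝ → ℝ, ContDiffOn ℝ ∞ h (projTX (Metric.ball w₀ r)) →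
        coefU h ∈ ({genU, xGenU, coefU c} ∪ range fun i => coefU (q i) : Set VField) →
        ∀ z ∈ Metric.ball (w₀.1, w₀.2.1) r, Dt h z = 0 := by
      intro h hh hm z hz
      rw [← projTX_ball w₀ hr] at hz
      obtain ⟨p, hp, rfl⟩ := hz
      exact Dt_eq_zero_of_commute Metric.isOpen_ball hh hp (hcomm _ (by simp) p hp)
        (hcomm _ (by simp) p hp) (hcomm _ hm p hp) (by rw [ha p hp]; exact ha0 p hp)
    have hct := hDt c hc (by simp)
    have hqt := hDt (q 0) (hq 0) (Or.inr ⟨0, rfl⟩)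
    rw [projTX_ball w₀ hr] at *
    obtain ⟨α, β, κ, hrel⟩ := affine_relation hr hc (hq 0) hcx (hqx 0) hf0 hct hqt (hfq 0)
    have := (hind α β κ (Pi.single 0 (-1)) fun z hz => by
      rw [Finset.sum_eq_single 0 (fun j _ hj => by simp [hj]) (by simp), hrel z hz]
      simp
      ring).2.2.2
    have := congrFun this 0
    simp at this

end WithTime
end EvolEq

namespace EvolEq
open Set Filter Topology

/-! ### Completeness of the list near generic points -/

section Completeness

/-- The function `b` is only known pointwise from the allowed form of `R`; its differentiability is
inherited from `R` along a line in the direction `t`. -/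
theorem exists_hasDerivAt_time {W : Set Pt} (hW : IsOpen W) {R : Pt → Pt} (hR : ContDiffOn ℝ ∞ R W)
    {b : ℝ → ℝ} (hb : ∀ p ∈ W, (R p).1 = b p.1) {p : Pt} (hp : p ∈ W) :
    ∃ b', HasDerivAt b b' p.1 ∧ ∀ v, (fderiv ℝ R p v).1 = b' * v.1 := by
  have hd := (differentiableAt_of_contDiffOn hW hR hp).hasFDerivAt
  have h1 : HasFDerivAt (fun q => (R q).1) ((ContinuousLinearMap.fst ℝ ℝ (ℝ × ℝ)).comp
      (fderiv ℝ R p)) p :=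
    (ContinuousLinearMap.fst ℝ ℝ (ℝ × ℝ)).hasFDerivAt.comp p hd
  have h2 : HasDerivAt (fun t : ℝ => (R (t, p.2)).1) (fderiv ℝ R p (1, 0)).1 p.1 :=
    h1.comp_hasDerivAt (f := fun t : ℝ => (t, p.2)) p.1 ((hasDerivAt_id _).prodMk
      (hasDerivAt_const _ _))
  have h3 : HasDerivAt b (fderiv ℝ R p (1, 0)).1 p.1 := by
    refine h2.congr_of_eventuallyEq ?_
    have : ∀ᶠ t in 𝓝 p.1, ((t, p.2) : Pt) ∈ W :=
      (show ContinuousAt (fun t : ℝ => ((t, p.2) : Pt)) p.1 by fun_prop).eventually_mem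
        (hW.mem_nhds hp)
    filter_upwards [this] with t ht
    rw [hb _ ht]
  refine ⟨_, h3, fun v => ?_⟩
  have h4 : HasFDerivAt (fun q : Pt => b q.1) ((fderiv ℝ R p (1, 0)).1 •
      ContinuousLinearMap.fst ℝ ℝ (ℝ × ℝ)) p :=
    h3.comp_hasFDerivAt (f := fun q : Pt => q.1) p (ContinuousLinearMap.fst ℝ ℝ (ℝ × ℝ)).hasFDerivAt
  have h5 : (fun q => (R q).1) =ᶠ[𝓝 p] fun q : Pt => b q.1 := by
    filter_upwards [hW.mem_nhds hp] with q hq using hb q hq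
  have := DFunLike.congr_fun (h1.unique (h4.congr_of_eventuallyEq h5)) v
  exact this

theorem IsAdmissible.restrict {Ω V : Set Pt} {A A₀ : Submodule ℝ VField} (h : IsAdmissible Ω A)
    (hV : IsOpen V) (hsub : V ⊆ Ω) (hA : A₀ ≤ A) : IsAdmissible V A₀ := by
  obtain ⟨h1, D, F, G, hD, hDΩ, hF, hG, hF0, hsym⟩ := h
  let π : Jet → Pt := fun j => (j.1, j.2.1, j.2.2.1)
  have hπ : Continuous π := by fun_prop
  refine ⟨fun Q hQ => ?_, D ∩ π ⁻¹' V, F, G, hD.inter (hV.preimage hπ), ?_,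
    hF.mono inter_subset_left, hG.mono inter_subset_left, fun j hj => hF0 j hj.1,
    fun Q hQ u hu z hz => hsym Q (hA hQ) u hu z hz.1⟩
  · obtain ⟨h2, a, ha⟩ := h1 Q (hA hQ)
    exact ⟨h2.mono hsub, a, fun p hp => ha p (hsub hp)⟩
  · change π '' (D ∩ π ⁻¹' V) = V
    rw [image_inter_preimage]
    exact inter_eq_right.2 (hDΩ.symm ▸ hsub : V ⊆ π '' D)

theorem IsAdmissible.tame {V : Set Pt} {A : Submodule ℝ VField} (h : IsAdmissible V A)
    (hV : IsOpen V) (hab : IsAbelianOn V A) (hfin : FiniteDimensional ℝ (restrictTo V A))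
    (hvert : ∀ Q ∈ A, ∀ p ∈ V, (Q p).1 = 0)
    (huc : ∀ Q ∈ A, ∀ U ⊆ V, IsOpen U → U.Nonempty → (∀ p ∈ U, Q p = 0) → ∀ p ∈ V, Q p = 0) :
    Tame V A := by
  obtain ⟨h1, D, F, G, hD, hDV, hF, hG, hF0, hsym⟩ := h
  have hsm : ∀ Q ∈ A, ContDiffOn ℝ ∞ Q V := fun Q hQ => (h1 Q hQ).1
  exact ⟨hV, hsm, hvert, hab, huc, hfin, timeRigid_of_symmetries hV hsm hvert hD hDV hsym,
    linearCompatible_of_symmetries hsm hvert hD hDV hF hF0 hsym⟩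

theorem restrictTo_mono_finiteDimensional {V : Set Pt} {A A₀ : Submodule ℝ VField} (hA : A₀ ≤ A)
    (h : FiniteDimensional ℝ (restrictTo V A)) : FiniteDimensional ℝ (restrictTo V A₀) :=
  have := h
  Submodule.finiteDimensional_of_le (S₂ := restrictTo V A) (Submodule.map_mono hA)

/-- Unique continuation holds on a suitable open subset. -/
theorem exists_uniqueCont {Ω : Set Pt} {A : Submodule ℝ VField} (hΩ : IsOpen Ω) (hne : Ω.Nonempty)
    (hfin : FiniteDimensional ℝ (restrictTo Ω A)) :
    ∃ V ⊆ Ω, IsOpen V ∧ V.Nonempty ∧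
      ∀ Q ∈ A, ∀ U ⊆ V, IsOpen U → U.Nonempty → (∀ p ∈ U, Q p = 0) → ∀ p ∈ V, Q p = 0 := by
  classical
  -- Take `V` of minimal dimension `dimOn V A`. Restriction to an open `U ⊆ V` then cannot lower the
  -- dimension, so it is injective.
  have hex : ∃ n, ∃ V ⊆ Ω, IsOpen V ∧ V.Nonempty ∧ dimOn V A = n := ⟨_, Ω, Subset.rfl, hΩ, hne, rfl⟩
  obtain ⟨V, hVΩ, hV, hVne, hn⟩ := Nat.find_spec hex
  refine ⟨V, hVΩ, hV, hVne, fun Q hQ U hUV hU hUne h0 => ?_⟩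
  have hmin : dimOn V A ≤ dimOn U A := hn ▸ Nat.find_min' hex ⟨U, hUV.trans hVΩ, hU, hUne, rfl⟩
  have := finiteDimensional_restrictTo_mono hVΩ hfin
  let ρ : (V → Pt) →ₗ[ℝ] (U → Pt) := LinearMap.funLeft ℝ Pt (Set.inclusion hUV)
  have h1 : restrictTo U A = (restrictTo V A).map ρ := by
    rw [restrictTo, restrictTo, ← Submodule.map_comp]
    rfl
  let ρ' := ρ.domRestrict (restrictTo V A)
  have h2 : Module.finrank ℝ (LinearMap.range ρ') = dimOn U A := by
    rw [dimOn, h1, LinearMap.range_domRestrict]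
  have h3 := LinearMap.finrank_range_add_finrank_ker ρ'
  have h4 : Module.finrank ℝ (LinearMap.ker ρ') = 0 := by
    rw [h2] at h3
    change _ = dimOn V A at h3
    omega
  have h5 : LinearMap.ker ρ' = ⊥ := Submodule.finrank_eq_zero.1 h4
  have h6 : (⟨_, Submodule.mem_map_of_mem hQ⟩ : restrictTo V A) ∈ LinearMap.ker ρ' := by
    rw [LinearMap.mem_ker]
    funext p
    exact h0 p p.2
  rw [h5, Submodule.mem_bot] at h6
  intro p hp
  exact congrFun (congrArg Subtype.val h6) ⟨p, hp⟩

/-- The `∂_t`-component of the bracket is `a b' - a' b`, so `b / a` has zero derivative. -/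
theorem time_components_proportional {W : Set Pt} {w₀ : Pt} {r : ℝ} (hW : W = Metric.ball w₀ r)
    (hr : 0 < r) {Q R : VField} (hQ : ContDiffOn ℝ ∞ Q W) (hR : ContDiffOn ℝ ∞ R W) {a b : ℝ → ℝ}
    (ha : ∀ p ∈ W, (Q p).1 = a p.1) (hb : ∀ p ∈ W, (R p).1 = b p.1) (ha0 : ∀ p ∈ W, a p.1 ≠ 0)
    (hQR : ∀ p ∈ W, VectorField.lieBracket ℝ Q R p = 0) :
    ∃ k : ℝ, ∀ p ∈ W, (R p).1 = k * (Q p).1 := by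
  have hWo : IsOpen W := hW ▸ Metric.isOpen_ball
  have hm : ∀ t ∈ Metric.ball w₀.1 r, ((t, w₀.2) : Pt) ∈ W := fun t ht => hW ▸
    mem_ball_pt.2 ⟨ht, Metric.mem_ball_self hr, Metric.mem_ball_self hr⟩
  refine ⟨b w₀.1 / a w₀.1, fun p hp => ?_⟩
  have hp' : p.1 ∈ Metric.ball w₀.1 r := (mem_ball_pt.1 (hW ▸ hp)).1
  have h1 : b p.1 / a p.1 = b w₀.1 / a w₀.1 :=
    const_of_hasDerivAt_zero (g := fun t => b t / a t) (fun t ht => by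
      obtain ⟨a', ha', hav⟩ := exists_hasDerivAt_time hWo hQ ha (hm t ht)
      obtain ⟨b', hb', hbv⟩ := exists_hasDerivAt_time hWo hR hb (hm t ht)
      have h2 := congrArg Prod.fst (hQR _ (hm t ht))
      rw [VectorField.lieBracket, Prod.fst_sub, hav, hbv, ha _ (hm t ht), hb _ (hm t ht)] at h2
      have h3 := hb'.div ha' (ha0 _ (hm t ht))
      have h4 : b' * a t - b t * a' = 0 := by
        simp only [Prod.fst_zero] at h2
        linear_combination h2
      simp only [h4, zero_div] at h3
      exact h3) hp' (Metric.mem_ball_self hr)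
  rw [ha p hp, hb p hp, ← h1, div_mul_cancel₀ _ (ha0 p hp)]

theorem HasNormalForm.mono {V V' : Set Pt} {A : Submodule ℝ VField} (h : HasNormalForm V' A)
    (hsub : V' ⊆ V) : HasNormalForm V A :=
  let ⟨U, hU, h⟩ := h
  ⟨U, hU.trans hsub, h⟩

theorem HasNormalForm.of_equivalent {V W : Set Pt} {A B : Submodule ℝ VField} (hV : IsOpen V)
    (h : Equivalent V A W B) (hB : HasNormalForm W B) : HasNormalForm V A := by
  obtain ⟨W', hW', hW'o, hne, k, X, C, hX, hC, he⟩ := hB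
  obtain ⟨V', hV', hV'o, hV'ne, he'⟩ := h.restrict hV hW'o hW' hne
  exact ⟨V', hV', hV'o, hV'ne, k, X, C, hX, hC, he'.trans he hV'o hW'o⟩

/-- If some `Q` has a nonzero `∂_t`-component near a point, `A` is `ℝ Q` plus the subalgebra `A₀` of
fields without `∂_t` there. The normalization of `A₀` preserves `t`, so `Q` keeps its coefficient
`a(t)` and can be straightened afterwards. -/
theorem exists_hasNormalForm {Ω : Set Pt} {A : Submodule ℝ VField} (hΩ : IsOpen Ω)
    (hne : Ω.Nonempty) (hfin : FiniteDimensional ℝ (restrictTo Ω A)) (hab : IsAbelianOn Ω A)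
    (hadm : IsAdmissible Ω A) :
    (∃ V ⊆ Ω, IsOpen V ∧ V.Nonempty ∧ ∀ Q ∈ A, ∀ p ∈ V, Q p = 0) ∨ HasNormalForm Ω A := by
  obtain ⟨V, hVΩ, hV, hVne, huc⟩ := exists_uniqueCont hΩ hne hfin
  by_cases hvert : ∀ Q ∈ A, ∀ p ∈ V, (Q p).1 = 0
  · have hT : Tame V A := (hadm.restrict hV hVΩ le_rfl).tame hV
      (fun Q hQ R hR p hp => hab Q hQ R hR p (hVΩ hp)) (finiteDimensional_restrictTo_mono hVΩ hfin)
      hvert huc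
    rcases hT.eq_zero_or_verticalNormal with h0 | ⟨V', hV', hV'o, hV'ne, w, r, B, k, hr, he, hB, -⟩
    · exact Or.inl ⟨V, hVΩ, hV, hVne, h0⟩
    · exact Or.inr ⟨V', hV'.trans hVΩ, hV'o, hV'ne, k, _, B, Metric.isOpen_ball, hB, he.equivalent⟩
  push Not at hvert
  obtain ⟨Q, hQ, p, hp, hQp⟩ := hvert
  refine Or.inr ?_
  have hsm : ∀ R ∈ A, ContDiffOn ℝ ∞ R V := fun R hR => (hadm.1 R hR).1.mono hVΩ
  obtain ⟨ρ, hρ, hρV⟩ := Metric.isOpen_iff.1 ((hsm Q hQ).continuousOn.isOpen_inter_preimage hV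
    (isOpen_compl_singleton.preimage continuous_fst : IsOpen (Prod.fst ⁻¹' {(0 : ℝ)}ᶜ : Set Pt))) p
    ⟨hp, hQp⟩
  set V₁ := Metric.ball p ρ with hV₁def
  have hV₁ : IsOpen V₁ := Metric.isOpen_ball
  have hV₁V : V₁ ⊆ V := fun q hq => (hρV hq).1
  have hV₁Ω := hV₁V.trans hVΩ
  have hpV₁ : p ∈ V₁ := Metric.mem_ball_self hρ
  have hQ0 : ∀ q ∈ V₁, (Q q).1 ≠ 0 := fun q hq => (hρV hq).2
  have hab₁ : IsAbelianOn V₁ A := fun Q hQ R hR p hp => hab Q hQ R hR p (hV₁Ω hp)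
  obtain ⟨a, ha⟩ := (hadm.1 Q hQ).2
  have ha₁ : ∀ q ∈ V₁, (Q q).1 = a q.1 := fun q hq => ha q (hV₁Ω hq)
  have ha0 : ∀ q ∈ V₁, a q.1 ≠ 0 := fun q hq => ha₁ q hq ▸ hQ0 q hq
  have hprop : ∀ R ∈ A, ∃ k : ℝ, ∀ q ∈ V₁, (R q).1 = k * (Q q).1 := by
    intro R hR
    obtain ⟨b, hb⟩ := (hadm.1 R hR).2
    exact time_components_proportional rfl hρ ((hsm Q hQ).mono hV₁V) ((hsm R hR).mono hV₁V) ha₁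
      (fun q hq => hb q (hV₁Ω hq)) ha0 (hab₁ Q hQ R hR)
  let A₀ : Submodule ℝ VField :=
    { carrier := {R | R ∈ A ∧ ∀ q ∈ V₁, (R q).1 = 0}
      zero_mem' := ⟨A.zero_mem, fun _ _ => rfl⟩
      add_mem' := fun hx hy => ⟨A.add_mem hx.1 hy.1, fun q hq => by
        simp [hx.2 q hq, hy.2 q hq]⟩
      smul_mem' := fun c x hx => ⟨A.smul_mem c hx.1, fun q hq => by simp [hx.2 q hq]⟩ }
  have hA₀ : A₀ ≤ A := fun R hR => hR.1
  have hdec : ∀ R ∈ A, ∃ k : ℝ, R - k • Q ∈ A₀ := by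
    intro R hR
    obtain ⟨k, hk⟩ := hprop R hR
    exact ⟨k, A.sub_mem hR (A.smul_mem k hQ), fun q hq => by simp [hk q hq]⟩
  have hT : Tame V₁ A₀ := (hadm.restrict hV₁ hV₁Ω hA₀).tame hV₁
    (fun Q hQ R hR => hab₁ Q hQ.1 R hR.1)
    (restrictTo_mono_finiteDimensional hA₀ (finiteDimensional_restrictTo_mono hV₁Ω hfin))
    (fun R hR => hR.2) (fun R hR U hU hUo hUne h0 q hq =>
      huc R hR.1 U (hU.trans hV₁V) hUo hUne h0 q (hV₁V hq))
  refine HasNormalForm.mono ?_ hV₁Ω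
  rcases hT.eq_zero_or_verticalNormal with h0 | ⟨V', hV', hV'o, hV'ne, w, r, B, k, hr, he, hB, hk⟩
  · refine hasNormalForm_of_time_of_span hV₁ (fun R hR => (hsm R hR).mono hV₁V) hab₁ hQ ha₁ ha0
      (s := ∅) (by simp) (by simp) (fun R hR => ?_) hpV₁ (k := .t) fun w r _ => ?_
    · obtain ⟨k, hk⟩ := hdec R hR
      refine ⟨k, 0, Submodule.zero_mem _, fun q hq => ?_⟩
      have := h0 _ hk q hq
      simpa [sub_eq_zero] using this
    · rw [image_empty, insert_empty_eq]; rfl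
  obtain ⟨Φ, Ψ, hd, ht, hag⟩ := he
  -- The diffeomorphism that normalizes `A₀` is applied to the whole of `A`.
  refine HasNormalForm.mono (HasNormalForm.of_equivalent hV'o
    (hd.fiberEquivalent_push ht A).equivalent ?_) hV'
  have htinv : ∀ w' ∈ Metric.ball w r, (Ψ w').1 = w'.1 := fun w' hw' => hd.time_inv ht hw'
  have hfst : ∀ (R : VField), ∀ w' ∈ Metric.ball w r, (pushField Φ Ψ R w').1 = (R (Ψ w')).1 := by
    intro R w' hw'
    obtain ⟨b', hb', hbv⟩ := exists_hasDerivAt_time hd.1 hd.smooth (b := id) ht (hd.mapsTo_inv hw')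
    rw [pushField_apply, hbv, hb'.unique (hasDerivAt_id _), one_mul]
  have hm : ∀ w' ∈ Metric.ball w r, Ψ w' ∈ V₁ := fun w' hw' => hV' (hd.mapsTo_inv hw')
  have hsm' : ∀ R ∈ A, ContDiffOn ℝ ∞ R V' := fun R hR => (hsm R hR).mono (hV'.trans hV₁V)
  refine hasNormalForm_of_time hr (Q := pushField Φ Ψ Q) (a := a) ?_ ?_
    (Submodule.mem_map_of_mem hQ) ?_ ?_ ?_ ?_ hB hk
  · rintro _ ⟨R, hR, rfl⟩
    exact hd.contDiffOn_pushField (hsm' R hR)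
  · rintro _ ⟨R, hR, rfl⟩ _ ⟨S, hS, rfl⟩ w' hw'
    rw [hd.lieBracket_pushField (hsm' R hR) (hsm' S hS) hw', hab₁ R hR S hS _ (hm w' hw'), map_zero]
  · intro w' hw'
    rw [hfst Q w' hw', ha₁ _ (hm w' hw'), htinv w' hw']
  · intro w' hw'
    rw [← htinv w' hw']
    exact ha0 _ (hm w' hw')
  · intro S hS
    obtain ⟨_, ⟨R, hR, rfl⟩, e⟩ := hag.2 S hS
    exact ⟨_, Submodule.mem_map_of_mem hR.1, e⟩
  · rintro _ ⟨R, hR, rfl⟩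
    obtain ⟨k, hk⟩ := hdec R hR
    obtain ⟨S, hS, e⟩ := hag.1 _ (Submodule.mem_map_of_mem hk)
    refine ⟨k, S, hS, fun w' hw' => ?_⟩
    have := e hw'
    rw [map_sub, map_smul, Pi.sub_apply, sub_eq_iff_eq_add'] at this
    exact this

/-- The normal form is found inside every nonempty open subset of `Ω`, so the union of all good open
sets is dense. -/
theorem exists_dense_normal_forms {Ω : Set Pt} {A : Submodule ℝ VField} (hΩ : IsOpen Ω)
    (hfin : FiniteDimensional ℝ (restrictTo Ω A)) (hab : IsAbelianOn Ω A)
    (hadm : IsAdmissible Ω A) :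
    ∃ Ω' : Set Pt, IsOpen Ω' ∧ Ω' ⊆ Ω ∧ Ω ⊆ closure Ω' ∧
      ∀ p ∈ Ω', ∃ V : Set Pt, IsOpen V ∧ p ∈ V ∧ V ⊆ Ω ∧
        ((∀ Q ∈ A, ∀ q ∈ V, Q q = 0) ∨ ∃ (k : AlgType) (W : Set Pt) (B : Submodule ℝ VField),
            IsOpen W ∧ IsCanonical W B k ∧ Equivalent V A W B) := by
  let good : Set (Set Pt) := {V | IsOpen V ∧ V ⊆ Ω ∧
    ((∀ Q ∈ A, ∀ q ∈ V, Q q = 0) ∨ ∃ (k : AlgType) (W : Set Pt) (B : Submodule ℝ VField),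
            IsOpen W ∧ IsCanonical W B k ∧ Equivalent V A W B)}
  refine ⟨⋃₀ good, isOpen_sUnion fun V hV => hV.1, sUnion_subset fun V hV => hV.2.1, ?_, ?_⟩
  · intro p hp
    rw [mem_closure_iff]
    intro U hU hpU
    have hUΩ : U ∩ Ω ⊆ Ω := inter_subset_right
    have hUo := hU.inter hΩ
    rcases exists_hasNormalForm hUo ⟨p, hpU, hp⟩ (finiteDimensional_restrictTo_mono hUΩ hfin)
      (fun Q hQ R hR p hp => hab Q hQ R hR p (hUΩ hp)) (hadm.restrict hUo hUΩ le_rfl) with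
      ⟨V, hV, hVo, ⟨q, hq⟩, h0⟩ | ⟨V, hV, hVo, ⟨q, hq⟩, h⟩
    · exact ⟨q, (hV hq).1, V, ⟨hVo, hV.trans hUΩ, Or.inl h0⟩, hq⟩
    · exact ⟨q, (hV hq).1, V, ⟨hVo, hV.trans hUΩ, Or.inr h⟩, hq⟩
  · rintro p ⟨V, hV, hpV⟩
    exact ⟨V, hV.1, hpV, hV.2⟩

end Completeness
end EvolEq

namespace EvolEq
open Set Filter Topology

/-! ### Symmetries of linear equations -/

section StandardFields

/-- The field `a ∂_t + b ∂_x + h(t,x) ∂_u`. -/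
def stdField (a b : ℝ) (h : ℝ × ℝ → ℝ) : VField := fun p => (a, b, h (p.1, p.2.1))

variable {W : Set Pt} {N : Set (ℝ × ℝ)}

theorem stdField_eq (a b : ℝ) (h : ℝ × ℝ → ℝ) :
    stdField a b h = (fun _ => (a, b, 0)) + coefU h := by
  ext p <;> simp [stdField, coefU]

theorem contDiffOn_stdField {a b : ℝ} {h : ℝ × ℝ → ℝ} (hh : ContDiffOn ℝ ∞ h (projTX W)) :
    ContDiffOn ℝ ∞ (stdField a b h) W :=
  contDiffOn_const.prodMk (contDiffOn_const.prodMk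
    (hh.comp (f := fun p : Pt => (p.1, p.2.1)) (by fun_prop) fun p hp => ⟨p, hp, rfl⟩))

theorem fderiv_stdField (hW : IsOpen W) {a b : ℝ} {h : ℝ × ℝ → ℝ} (hh : ContDiffOn ℝ ∞ h (projTX W))
    {p : Pt} (hp : p ∈ W) (v : Pt) :
    fderiv ℝ (stdField a b h) p v =
      (0, 0, Dt h (p.1, p.2.1) * v.1 + Dx h (p.1, p.2.1) * v.2.1) := by
  rw [stdField_eq, ← fderiv_coefU hW hh hp v]
  change fderiv ℝ (fun q => (a, b, 0) + coefU h q) p v = _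
  rw [fderiv_const_add]

theorem lieBracket_stdField (hW : IsOpen W) {a b a' b' : ℝ} {h h' : ℝ × ℝ → ℝ}
    (hh : ContDiffOn ℝ ∞ h (projTX W)) (hh' : ContDiffOn ℝ ∞ h' (projTX W)) {p : Pt} (hp : p ∈ W) :
    VectorField.lieBracket ℝ (stdField a b h) (stdField a' b' h') p =
      (0, 0, a * Dt h' (p.1, p.2.1) + b * Dx h' (p.1, p.2.1)
        - (a' * Dt h (p.1, p.2.1) + b' * Dx h (p.1, p.2.1))) := by
  rw [VectorField.lieBracket, fderiv_stdField hW hh hp, fderiv_stdField hW hh' hp]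
  simp only [stdField, Prod.mk_sub_mk, sub_self, Prod.mk.injEq, true_and]
  ring

theorem isAbelianOn_span {s : Set VField} (hs : ∀ g ∈ s, ∀ p ∈ W, DifferentiableAt ℝ g p)
    (h : ∀ g ∈ s, ∀ g' ∈ s, ∀ p ∈ W, VectorField.lieBracket ℝ g g' p = 0) :
    IsAbelianOn W (Submodule.span ℝ s) := by
  have hd : ∀ Q ∈ Submodule.span ℝ s, ∀ p ∈ W, DifferentiableAt ℝ Q p := by
    intro Q hQ p hp
    induction hQ using Submodule.span_induction with
    | mem g hg => exact hs g hg p hp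
    | zero => exact differentiableAt_const 0
    | add x y _ _ hx hy => exact hx.add hy
    | smul c x _ hx => exact hx.const_smul c
  intro Q hQ R hR p hp
  have hstep : ∀ g ∈ s, VectorField.lieBracket ℝ g R p = 0 := by
    intro g hg
    induction hR using Submodule.span_induction with
    | mem g' hg' => exact h g hg g' hg' p hp
    | zero => exact congrFun VectorField.lieBracket_zero_right p
    | add x y hx' hy' hx hy =>
      rw [VectorField.lieBracket_add_right (hd x hx' p hp) (hd y hy' p hp), hx, hy, add_zero]
    | smul c x hx' hx =>
      rw [VectorField.lieBracket_const_smul_right (hd x hx' p hp), hx, smul_zero]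
  induction hQ using Submodule.span_induction with
  | mem g hg => exact hstep g hg
  | zero => exact congrFun VectorField.lieBracket_zero_left p
  | add x y hx' hy' hx hy =>
    rw [VectorField.lieBracket_add_left (hd x hx' p hp) (hd y hy' p hp), hx, hy, add_zero]
  | smul c x hx' hx =>
    rw [VectorField.lieBracket_const_smul_left (hd x hx' p hp), hx, smul_zero]

theorem Dx_linear (hN : IsOpen N) {h p q : ℝ × ℝ → ℝ} (hh : ContDiffOn ℝ ∞ h N)
    (hp : ContDiffOn ℝ ∞ p N) (hq : ContDiffOn ℝ ∞ q N) (a b c : ℝ) :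
    EqOn (Dx fun z => c * h z + a * p z + b * q z) (fun z => c * Dx h z + a * Dx p z + b * Dx q z)
      N := by
  intro z hz
  have hd : ContDiffOn ℝ ∞ (fun z => c * h z + a * p z + b * q z) N :=
    ((contDiffOn_const.mul hh).add (contDiffOn_const.mul hp)).add (contDiffOn_const.mul hq)
  exact Dx_eq_of_hasDerivAt (differentiableAt_of_contDiffOn hN hd hz)
    ((((hasDerivAt_slice_x hN hh hz).const_mul c).add ((hasDerivAt_slice_x hN hp hz).const_mul a)).add
      ((hasDerivAt_slice_x hN hq hz).const_mul b))

theorem Dt_linear (hN : IsOpen N) {h p q : ℝ × ℝ → ℝ} (hh : ContDiffOn ℝ ∞ h N)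
    (hp : ContDiffOn ℝ ∞ p N) (hq : ContDiffOn ℝ ∞ q N) (a b c : ℝ) :
    EqOn (Dt fun z => c * h z + a * p z + b * q z) (fun z => c * Dt h z + a * Dt p z + b * Dt q z)
      N := by
  intro z hz
  have hd : ContDiffOn ℝ ∞ (fun z => c * h z + a * p z + b * q z) N :=
    ((contDiffOn_const.mul hh).add (contDiffOn_const.mul hp)).add (contDiffOn_const.mul hq)
  exact Dt_eq_of_hasDerivAt (differentiableAt_of_contDiffOn hN hd hz)
    ((((hasDerivAt_slice_t hN hh hz).const_mul c).add ((hasDerivAt_slice_t hN hp hz).const_mul a)).add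
      ((hasDerivAt_slice_t hN hq hz).const_mul b))

theorem Dx_Dx_linear (hN : IsOpen N) {h p q : ℝ × ℝ → ℝ} (hh : ContDiffOn ℝ ∞ h N)
    (hp : ContDiffOn ℝ ∞ p N) (hq : ContDiffOn ℝ ∞ q N) (a b c : ℝ) :
    EqOn (Dx (Dx fun z => c * h z + a * p z + b * q z))
      (fun z => c * Dx (Dx h) z + a * Dx (Dx p) z + b * Dx (Dx q) z) N :=
  (Dx_congr hN (Dx_linear hN hh hp hq a b c)).trans
    (Dx_linear hN (contDiffOn_Dx hN hh) (contDiffOn_Dx hN hp) (contDiffOn_Dx hN hq) a b c)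

theorem Dx_Dx_Dx_linear (hN : IsOpen N) {h p q : ℝ × ℝ → ℝ} (hh : ContDiffOn ℝ ∞ h N)
    (hp : ContDiffOn ℝ ∞ p N) (hq : ContDiffOn ℝ ∞ q N) (a b c : ℝ) :
    EqOn (Dx (Dx (Dx fun z => c * h z + a * p z + b * q z)))
      (fun z => c * Dx (Dx (Dx h)) z + a * Dx (Dx (Dx p)) z + b * Dx (Dx (Dx q)) z) N :=
  (Dx_congr hN (Dx_Dx_linear hN hh hp hq a b c)).trans
    (Dx_linear hN (contDiffOn_Dx hN (contDiffOn_Dx hN hh)) (contDiffOn_Dx hN (contDiffOn_Dx hN hp))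
      (contDiffOn_Dx hN (contDiffOn_Dx hN hq)) a b c)

theorem fderiv_of_tx {f : ℝ × ℝ → ℝ} (hN : IsOpen N) (hf : ContDiffOn ℝ ∞ f N) {j : Jet}
    (hj : (j.1, j.2.1) ∈ N) (v : Jet) :
    HasFDerivAt (fun j : Jet => f (j.1, j.2.1)) ((fderiv ℝ f (j.1, j.2.1)).comp
      ((ContinuousLinearMap.fst ℝ ℝ (ℝ × ℝ × ℝ × ℝ)).prod ((ContinuousLinearMap.fst ℝ ℝ (ℝ × ℝ × ℝ)).comp
        (ContinuousLinearMap.snd ℝ ℝ (ℝ × ℝ × ℝ × ℝ))))) j ∧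
    fderiv ℝ f (j.1, j.2.1) (v.1, v.2.1) = v.1 * Dt f (j.1, j.2.1) + v.2.1 * Dx f (j.1, j.2.1) := by
  let L : Jet →L[ℝ] ℝ × ℝ := (ContinuousLinearMap.fst ℝ ℝ (ℝ × ℝ × ℝ × ℝ)).prod
    ((ContinuousLinearMap.fst ℝ ℝ (ℝ × ℝ × ℝ)).comp (ContinuousLinearMap.snd ℝ ℝ (ℝ × ℝ × ℝ × ℝ)))
  refine ⟨HasFDerivAt.comp (g := f) (f := L) j
    (differentiableAt_of_contDiffOn hN hf hj).hasFDerivAt L.hasFDerivAt, ?_⟩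
  have e : ((v.1, v.2.1) : ℝ × ℝ) = v.1 • (1, 0) + v.2.1 • (0, 1) := by ext <;> simp
  rw [e, map_add, map_smul, map_smul, Dt, Dx, smul_eq_mul, smul_eq_mul]

/-- With constant `a`, `b` the prolongation coefficients are just derivatives of `h`. The condition
splits into invariance of `f` and `g` under `a ∂_t + b ∂_x` and the requirement that `h` solve the
linear equation. -/
theorem isSymmetry_of_linear (hW : IsOpen W) {f g : ℝ × ℝ → ℝ} (hf : ContDiffOn ℝ ∞ f (projTX W))
    (hg : ContDiffOn ℝ ∞ g (projTX W)) {a b : ℝ} {h : ℝ × ℝ → ℝ} (hh : ContDiffOn ℝ ∞ h (projTX W))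
    (hft : ∀ z ∈ projTX W, a * Dt f z + b * Dx f z = 0)
    (hgt : ∀ z ∈ projTX W, a * Dt g z + b * Dx g z = 0)
    (hht : ∀ z ∈ projTX W, Dt h z = f z * Dx (Dx (Dx h)) z + g z * Dx (Dx h) z) :
    IsSymmetry ((fun j : Jet => ((j.1, j.2.1, j.2.2.1) : Pt)) ⁻¹' W) (fun j => f (j.1, j.2.1))
      (fun j => g (j.1, j.2.1) * j.2.2.2.2) (stdField a b h) := by
  intro u hu z hz _
  have hP := isOpen_projTX hW
  have hzP : z ∈ projTX W := ⟨_, hz, rfl⟩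
  have hut := (contDiff_Dt hu).contDiffOn (s := projTX W)
  have hux := (contDiff_Dx hu).contDiffOn (s := projTX W)
  have hchar : characteristic (stdField a b h) u =
      fun z => 1 * h z + -a * Dt u z + -b * Dx u z := by
    funext z
    simp only [characteristic, stdField, graphPt]
    ring
  have e0 : prCoeff (stdField a b h) u Dt z = Dt h z := by
    rw [prCoeff, hchar, Dt_linear hP hh hut hux _ _ _ hzP]
    simp only [stdField]
    ring
  have e1 : prCoeff (stdField a b h) u Dx z = Dx h z := by
    rw [prCoeff, hchar, Dx_linear hP hh hut hux _ _ _ hzP]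
    simp only [stdField]
    ring
  have e2 : prCoeff (stdField a b h) u (fun h => Dx (Dx h)) z = Dx (Dx h) z := by
    rw [prCoeff, hchar, Dx_Dx_linear hP hh hut hux _ _ _ hzP]
    simp only [stdField]
    ring
  have e3 : prCoeff (stdField a b h) u (fun h => Dx (Dx (Dx h))) z = Dx (Dx (Dx h)) z := by
    rw [prCoeff, hchar, Dx_Dx_Dx_linear hP hh hut hux _ _ _ hzP]
    simp only [stdField]
    ring
  have ej : prJet (stdField a b h) u z = (a, b, h z, Dx h z, Dx (Dx h) z) := by
    rw [prJet, e1, e2]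
    rfl
  have hjz : ((jet u z).1, (jet u z).2.1) = z := rfl
  obtain ⟨h1, h1'⟩ := fderiv_of_tx hP hf (j := jet u z) hzP (prJet (stdField a b h) u z)
  obtain ⟨h2, h2'⟩ := fderiv_of_tx hP hg (j := jet u z) hzP (prJet (stdField a b h) u z)
  let π : Jet →L[ℝ] ℝ := (ContinuousLinearMap.snd ℝ ℝ ℝ).comp ((ContinuousLinearMap.snd ℝ ℝ (ℝ × ℝ)).comp
    ((ContinuousLinearMap.snd ℝ ℝ (ℝ × ℝ × ℝ)).comp (ContinuousLinearMap.snd ℝ ℝ (ℝ × ℝ × ℝ × ℝ))))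
  have h3 := h2.mul (π.hasFDerivAt (x := jet u z))
  have e4 : fderiv ℝ (fun j : Jet => f (j.1, j.2.1)) (jet u z) (prJet (stdField a b h) u z) = 0 := by
    rw [h1.fderiv]
    refine h1'.trans ?_
    rw [hjz, ej]
    exact hft z hzP
  have e5 : fderiv ℝ (fun j : Jet => g (j.1, j.2.1) * j.2.2.2.2) (jet u z)
      (prJet (stdField a b h) u z) = g z * Dx (Dx h) z := by
    have e6 : fderiv ℝ (fun j : Jet => g (j.1, j.2.1) * j.2.2.2.2) (jet u z)
        (prJet (stdField a b h) u z) = g z * (prJet (stdField a b h) u z).2.2.2.2 +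
          Dx (Dx u) z * fderiv ℝ g z ((prJet (stdField a b h) u z).1,
            (prJet (stdField a b h) u z).2.1) := by
      exact DFunLike.congr_fun h3.fderiv _
    rw [e6]
    rw [hjz] at h2'
    rw [h2', ej]
    simp only [hgt z hzP, mul_zero, add_zero]
  rw [e0, e3, e4, e5, hht z hzP]
  change f z * _ + _ - (0 * _ + f z * _ + _) = 0
  ring

/-- A family of fields `aᵢ ∂_t + bᵢ ∂_x + hᵢ(t,x) ∂_u` that commute, are linearly independent, and
are symmetries of one equation `u_t = f(t,x) u₃ + g(t,x) u₂`. -/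
structure StdFamily (W : Set Pt) {ι : Type} [Fintype ι] (a b : ι → ℝ) (h : ι → ℝ × ℝ → ℝ) :
    Prop where
  smooth : ∀ i, ContDiffOn ℝ ∞ (h i) (projTX W)
  comm : ∀ i j, ∀ z ∈ projTX W, a i * Dt (h j) z + b i * Dx (h j) z =
    a j * Dt (h i) z + b j * Dx (h i) z
  symm : ∃ f g : ℝ × ℝ → ℝ, ContDiffOn ℝ ∞ f (projTX W) ∧ ContDiffOn ℝ ∞ g (projTX W) ∧
    (∀ z ∈ projTX W, f z ≠ 0) ∧ ∀ i, ∀ z ∈ projTX W, a i * Dt f z + b i * Dx f z = 0 ∧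
      a i * Dt g z + b i * Dx g z = 0 ∧ Dt (h i) z = f z * Dx (Dx (Dx (h i))) z + g z * Dx (Dx (h i)) z
  indep : ∀ δ : ι → ℝ, ∑ i, δ i * a i = 0 → ∑ i, δ i * b i = 0 →
    (∀ z ∈ projTX W, ∑ i, δ i * h i z = 0) → δ = 0

variable {ι : Type} [Fintype ι] {a b : ι → ℝ} {h : ι → ℝ × ℝ → ℝ}

theorem sum_smul_stdField (δ : ι → ℝ) (p : Pt) :
    ∑ i, δ i • stdField (a i) (b i) (h i) p =
      (∑ i, δ i * a i, ∑ i, δ i * b i, ∑ i, δ i * h i (p.1, p.2.1)) := by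
  refine Prod.ext ?_ (Prod.ext ?_ ?_) <;> simp [Prod.fst_sum, Prod.snd_sum, stdField]

theorem StdFamily.isAbelianOn (H : StdFamily W a b h) (hW : IsOpen W) :
    IsAbelianOn W (Submodule.span ℝ (range fun i => stdField (a i) (b i) (h i))) := by
  refine isAbelianOn_span ?_ ?_
  · rintro _ ⟨i, rfl⟩ p hp
    exact differentiableAt_of_contDiffOn hW (contDiffOn_stdField (H.smooth i)) hp
  · rintro _ ⟨i, rfl⟩ _ ⟨j, rfl⟩ p hp
    rw [lieBracket_stdField hW (H.smooth i) (H.smooth j) hp, H.comm i j _ ⟨p, hp, rfl⟩, sub_self]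
    rfl

theorem StdFamily.isAdmissible (H : StdFamily W a b h) (hW : IsOpen W) :
    IsAdmissible W (Submodule.span ℝ (range fun i => stdField (a i) (b i) (h i))) := by
  obtain ⟨f, g, hf, hg, hf0, hfg⟩ := H.symm
  have hP := isOpen_projTX hW
  -- The conditions on `(α, β, η)` are linear, so they pass from the generators to the whole span.
  have hlin : ∀ Q ∈ Submodule.span ℝ (range fun i => stdField (a i) (b i) (h i)),
      ∃ (α β : ℝ) (η : ℝ × ℝ → ℝ), ContDiffOn ℝ ∞ η (projTX W) ∧ Q = stdField α β η ∧
        ∀ z ∈ projTX W, α * Dt f z + β * Dx f z = 0 ∧ α * Dt g z + β * Dx g z = 0 ∧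
          Dt η z = f z * Dx (Dx (Dx η)) z + g z * Dx (Dx η) z := by
    intro Q hQ
    have hzero : ContDiffOn ℝ ∞ (fun _ : ℝ × ℝ => (0 : ℝ)) (projTX W) := contDiffOn_const
    have hcomb : ∀ (α β α' β' : ℝ) (η η' : ℝ × ℝ → ℝ) (c c' : ℝ), ContDiffOn ℝ ∞ η (projTX W) →
        ContDiffOn ℝ ∞ η' (projTX W) →
        (∀ z ∈ projTX W, α * Dt f z + β * Dx f z = 0 ∧ α * Dt g z + β * Dx g z = 0 ∧
          Dt η z = f z * Dx (Dx (Dx η)) z + g z * Dx (Dx η) z) →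
        (∀ z ∈ projTX W, α' * Dt f z + β' * Dx f z = 0 ∧ α' * Dt g z + β' * Dx g z = 0 ∧
          Dt η' z = f z * Dx (Dx (Dx η')) z + g z * Dx (Dx η') z) →
        ∃ (α₀ β₀ : ℝ) (η₀ : ℝ × ℝ → ℝ), ContDiffOn ℝ ∞ η₀ (projTX W) ∧
          c • stdField α β η + c' • stdField α' β' η' = stdField α₀ β₀ η₀ ∧
          ∀ z ∈ projTX W, α₀ * Dt f z + β₀ * Dx f z = 0 ∧ α₀ * Dt g z + β₀ * Dx g z = 0 ∧
            Dt η₀ z = f z * Dx (Dx (Dx η₀)) z + g z * Dx (Dx η₀) z := by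
      intro α β α' β' η η' c c' hη hη' h1 h2
      -- The summand `0 * 0` puts the combination into the three-term shape of `Dx_linear` and
      -- `Dt_linear`.
      refine ⟨c * α + c' * α', c * β + c' * β', fun z => c * η z + c' * η' z + 0 * 0,
        ((contDiffOn_const.mul hη).add (contDiffOn_const.mul hη')).add contDiffOn_const, ?_, ?_⟩
      · ext p <;> simp [stdField]
      · intro z hz
        obtain ⟨h3, h4, h5⟩ := h1 z hz
        obtain ⟨h6, h7, h8⟩ := h2 z hz
        refine ⟨by linear_combination c * h3 + c' * h6, by linear_combination c * h4 + c' * h7, ?_⟩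
        rw [Dt_linear hP hη hη' hzero _ _ _ hz, Dx_Dx_linear hP hη hη' hzero _ _ _ hz,
          Dx_Dx_Dx_linear hP hη hη' hzero _ _ _ hz]
        linear_combination c * h5 + c' * h8
    induction hQ using Submodule.span_induction with
    | mem g hg =>
      obtain ⟨i, rfl⟩ := hg
      exact ⟨_, _, _, H.smooth i, rfl, hfg i⟩
    | zero =>
      refine ⟨0, 0, fun _ => 0, hzero, rfl, fun z _ => ?_⟩
      have h1 : Dx (fun _ : ℝ × ℝ => (0 : ℝ)) = fun _ => 0 := by funext z; simp [Dx]
      have h2 : Dt (fun _ : ℝ × ℝ => (0 : ℝ)) = fun _ => 0 := by funext z; simp [Dt]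
      simp [h1, h2]
    | add x y _ _ hx hy =>
      obtain ⟨α, β, η, hη, rfl, h1⟩ := hx
      obtain ⟨α', β', η', hη', rfl, h2⟩ := hy
      have := hcomb α β α' β' η η' 1 1 hη hη' h1 h2
      rwa [one_smul, one_smul] at this
    | smul c x _ hx =>
      obtain ⟨α, β, η, hη, rfl, h1⟩ := hx
      have := hcomb α β α β η η c 0 hη hη h1 h1
      rwa [zero_smul, add_zero] at this
  have hπ : Continuous fun j : Jet => ((j.1, j.2.1, j.2.2.1) : Pt) := by fun_prop
  refine ⟨fun Q hQ => ?_, (fun j : Jet => ((j.1, j.2.1, j.2.2.1) : Pt)) ⁻¹' W,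
    fun j => f (j.1, j.2.1), fun j => g (j.1, j.2.1) * j.2.2.2.2, hW.preimage hπ, ?_, ?_, ?_, ?_,
    fun Q hQ => ?_⟩
  · obtain ⟨α, β, η, hη, rfl, -⟩ := hlin Q hQ
    exact ⟨contDiffOn_stdField hη, fun _ => α, fun _ _ => rfl⟩
  · exact image_preimage_eq W fun p => ⟨(p.1, p.2.1, p.2.2, 0, 0), rfl⟩
  · exact hf.comp (f := fun j : Jet => (j.1, j.2.1)) (by fun_prop) fun j hj => ⟨_, hj, rfl⟩
  · exact (hg.comp (f := fun j : Jet => (j.1, j.2.1)) (by fun_prop) fun j hj => ⟨_, hj, rfl⟩).mul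
      (by fun_prop)
  · exact fun j hj => hf0 _ ⟨_, hj, rfl⟩
  · obtain ⟨α, β, η, hη, rfl, h1⟩ := hlin Q hQ
    exact isSymmetry_of_linear hW hf hg hη (fun z hz => (h1 z hz).1) (fun z hz => (h1 z hz).2.1)
      fun z hz => (h1 z hz).2.2

theorem StdFamily.dimOn_eq (H : StdFamily W a b h) (hne : W.Nonempty) :
    dimOn W (Submodule.span ℝ (range fun i => stdField (a i) (b i) (h i))) = Fintype.card ι := by
  obtain ⟨p₀, hp₀⟩ := hne
  let v : ι → W → Pt := fun i p => stdField (a i) (b i) (h i) p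
  have hv : LinearIndependent ℝ v := by
    rw [Fintype.linearIndependent_iff]
    intro δ hδ
    have h1 : ∀ p ∈ W, ∑ i, δ i • stdField (a i) (b i) (h i) p = 0 := fun p hp => by
      have := congrFun hδ ⟨p, hp⟩
      simpa [v] using this
    simp only [sum_smul_stdField] at h1
    have h2 := h1 p₀ hp₀
    exact congrFun (H.indep δ (congrArg Prod.fst h2) (congrArg (fun q : Pt => q.2.1) h2)
      (by rintro _ ⟨p, hp, rfl⟩; exact congrArg (fun q : Pt => q.2.2) (h1 p hp)))
  rw [dimOn, restrictTo, Submodule.map_span, ← range_comp]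
  exact finrank_span_eq_card hv

end StandardFields
end EvolEq

namespace EvolEq
open Set Filter Topology

/-! ### Functions independent of `t` -/

section TimeIndependence

variable {N : Set (ℝ × ℝ)} {f : ℝ × ℝ → ℝ}

/-- `f` does not depend on `t`. -/
def TimeIndep (N : Set (ℝ × ℝ)) (f : ℝ × ℝ → ℝ) : Prop :=
  ∀ z ∈ N, ∀ z' ∈ N, z.2 = z'.2 → f z = f z'

theorem TimeIndep.Dx (hN : IsOpen N) (hf : ContDiffOn ℝ ∞ f N) (h : TimeIndep N f) :
    TimeIndep N (Dx f) := by
  intro z hz z' hz' e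
  have h1 := hasDerivAt_slice_x hN hf hz
  have h2 := hasDerivAt_slice_x hN hf hz'
  rw [← e] at h2
  have hev : ∀ {w : ℝ × ℝ}, w ∈ N → w.2 = z.2 → ∀ᶠ x in 𝓝 z.2, (w.1, x) ∈ N := fun {w} hw ew =>
    (show ContinuousAt (fun x : ℝ => (w.1, x)) z.2 by fun_prop).eventually_mem
      (hN.mem_nhds (by rw [← ew]; exact hw))
  refine h1.unique (h2.congr_of_eventuallyEq ?_)
  filter_upwards [hev hz rfl, hev hz' e.symm] with x hx hx' using h _ hx _ hx' rfl

theorem TimeIndep.Dt_eq_zero (hN : IsOpen N) (hf : ContDiffOn ℝ ∞ f N) (h : TimeIndep N f) :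
    ∀ z ∈ N, Dt f z = 0 := by
  intro z hz
  refine (hasDerivAt_slice_t hN hf hz).unique
    ((hasDerivAt_const z.1 (f z)).congr_of_eventuallyEq ?_)
  have : ∀ᶠ t in 𝓝 z.1, (t, z.2) ∈ N :=
    (show ContinuousAt (fun t : ℝ => (t, z.2)) z.1 by fun_prop).eventually_mem (hN.mem_nhds hz)
  filter_upwards [this] with t ht using h _ ht _ hz rfl

end TimeIndependence

/-! ### The listed algebras as families of symmetries -/

section CanonicalFamilies

theorem Dx_const (k : ℝ) : Dx (fun _ => k) = fun _ => 0 := by funext z; simp [Dx]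

theorem Dt_const (k : ℝ) : Dt (fun _ => k) = fun _ => 0 := by funext z; simp [Dt]

theorem Dx_snd : Dx (fun z => z.2) = fun _ => 1 := by
  funext z
  exact Dx_eq_of_hasDerivAt differentiableAt_snd (hasDerivAt_id _)

theorem Dt_snd : Dt (fun z => z.2) = fun _ => 0 := by
  funext z
  exact Dt_eq_of_hasDerivAt differentiableAt_snd (hasDerivAt_const _ _)

variable {W : Set Pt}

theorem affine_indep {N : Set (ℝ × ℝ)} (hN : IsOpen N) (hne : N.Nonempty) {α β : ℝ}
    (h : ∀ z ∈ N, α + β * z.2 = 0) : α = 0 ∧ β = 0 := by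
  obtain ⟨z, hz⟩ := hne
  have h1 : HasDerivAt (fun x : ℝ => α + β * x) β z.2 := by
    have := ((hasDerivAt_id z.2).const_mul β).const_add α
    rwa [mul_one] at this
  have h2 : ∀ᶠ x in 𝓝 z.2, (z.1, x) ∈ N :=
    (show ContinuousAt (fun x : ℝ => (z.1, x)) z.2 by fun_prop).eventually_mem (hN.mem_nhds hz)
  have h3 : β = 0 := h1.unique ((hasDerivAt_const z.2 (0 : ℝ)).congr_of_eventuallyEq (by
    filter_upwards [h2] with x hx using h _ hx))
  have h4 := h z hz
  rw [h3, zero_mul, add_zero] at h4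
  exact ⟨h4, h3⟩

/-- Two `x`-derivatives of the relation leave `γ c_xx = 0`. -/
theorem affine_indep_of_ne_zero {N : Set (ℝ × ℝ)} (hN : IsOpen N) (hne : N.Nonempty) {α β γ : ℝ}
    {c : ℝ × ℝ → ℝ} (hc : ContDiffOn ℝ ∞ c N) (hcx : ∀ z ∈ N, Dx (Dx c) z ≠ 0)
    (h : ∀ z ∈ N, α + β * z.2 + γ * c z = 0) : α = 0 ∧ β = 0 ∧ γ = 0 := by
  obtain ⟨z, hz⟩ := hne
  have h1 : EqOn (fun z => α * 1 + β * z.2 + γ * c z) (fun _ => 0) N := fun z hz => by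
    rw [mul_one]; exact h z hz
  have h2 := Dx_congr hN (Dx_congr hN h1) hz
  rw [Dx_Dx_linear hN contDiffOn_const contDiffOn_snd hc β γ α hz, Dx_const, Dx_const, Dx_const,
    Dx_snd, Dx_const] at h2
  have h3 : γ = 0 := by
    have := hcx z hz
    simpa [this] using h2
  subst h3
  obtain ⟨h4, h5⟩ := affine_indep hN ⟨z, hz⟩ (α := α) (β := β) fun z hz => by simpa using h z hz
  exact ⟨h4, h5, rfl⟩

/-- The coefficient of `u_xx` is chosen so that `c` solves the equation. Fields `h ∂_u` always
commute and impose no invariance on the coefficients. -/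
theorem stdFamily_vertical_of_equation {ι : Type} [Fintype ι] (hW : IsOpen W)
    {h : ι → ℝ × ℝ → ℝ} {c f : ℝ × ℝ → ℝ} (hc : ContDiffOn ℝ ∞ c (projTX W))
    (hcx : ∀ z ∈ projTX W, Dx (Dx c) z ≠ 0) (hf : ContDiffOn ℝ ∞ f (projTX W))
    (hf0 : ∀ z ∈ projTX W, f z ≠ 0) (hh : ∀ i, ContDiffOn ℝ ∞ (h i) (projTX W))
    (hht : ∀ i, ∀ z ∈ projTX W, Dt (h i) z = f z * Dx (Dx (Dx (h i))) z +
      (Dt c z - f z * Dx (Dx (Dx c)) z) / Dx (Dx c) z * Dx (Dx (h i)) z)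
    (hind : ∀ δ : ι → ℝ, (∀ z ∈ projTX W, ∑ i, δ i * h i z = 0) → δ = 0) :
    StdFamily W (fun _ : ι => 0) (fun _ => 0) h := by
  have hP := isOpen_projTX hW
  have hc1 := contDiffOn_Dx hP hc
  have hc2 := contDiffOn_Dx hP hc1
  have hc3 := contDiffOn_Dx hP hc2
  refine ⟨hh, by simp, ⟨f, fun z => (Dt c z - f z * Dx (Dx (Dx c)) z) / Dx (Dx c) z, hf,
    ((contDiffOn_Dt hP hc).sub (hf.mul hc3)).div hc2 hcx, hf0,
    fun i z hz => ⟨by simp, by simp, hht i z hz⟩⟩, fun δ _ _ h0 => hind δ h0⟩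

/-- Coefficients that are affine in `x` and constant in `t` solve `u_t = u_xxx`, whose coefficients
are invariant under all translations. The condition on `b` is what commutativity requires when `∂_x`
occurs. -/
theorem stdFamily_affine {n : ℕ} {a b : Fin n → ℝ} {h : Fin n → ℝ × ℝ → ℝ}
    (hh : ∀ i, ContDiffOn ℝ ∞ (h i) (projTX W)) (hxx : ∀ i, Dx (Dx (h i)) = fun _ => 0)
    (ht : ∀ i, Dt (h i) = fun _ => 0) (hb : ∀ i j z, b i * Dx (h j) z = 0)
    (hind : ∀ δ : Fin n → ℝ, ∑ i, δ i * a i = 0 → ∑ i, δ i * b i = 0 →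
      (∀ z ∈ projTX W, ∑ i, δ i * h i z = 0) → δ = 0) : StdFamily W a b h :=
  ⟨hh, fun i j z _ => by simp [ht, hb], ⟨fun _ => 1, fun _ => 0, contDiffOn_const, contDiffOn_const,
    by simp, fun i z _ => ⟨by simp [Dt_const, Dx_const], by simp [Dt_const, Dx_const],
      by simp [hxx, ht, Dx_const]⟩⟩, hind⟩


theorem range_fin_one {α : Type*} (f : Fin 1 → α) : range f = {f 0} := by
  ext y; simp [eq_comm]

theorem range_fin_two {α : Type*} (f : Fin 2 → α) : range f = {f 0, f 1} := by
  ext y; simp [Fin.exists_fin_two, eq_comm]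

theorem range_fin_three {α : Type*} (f : Fin 3 → α) : range f = {f 0, f 1, f 2} := by
  ext y; simp [Fin.exists_fin_succ, eq_comm]

theorem range_fin_four {α : Type*} (f : Fin 4 → α) : range f = {f 0, f 1, f 2, f 3} := by
  ext y
  simp only [mem_range, Fin.exists_fin_succ, mem_insert_iff, mem_singleton_iff, eq_comm (a := y)]
  simp [Fin.succ]

/-- Affine coefficients use `u_t = u_xxx`; for a single function `c` the equation has `f = 1` and
`g` determined by `c`; the series types use the `f` of the compatibility condition, which says that
every `q i` solves the equation adapted to `c`. -/
theorem IsCanonical.exists_stdFamily {B : Submodule ℝ VField} {k : AlgType} (hW : IsOpen W)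
    (hne : W.Nonempty) (h : IsCanonical W B k) :
    ∃ (ι : Type) (_ : Fintype ι) (a b : ι → ℝ) (h : ι → ℝ × ℝ → ℝ), StdFamily W a b h ∧
      Fintype.card ι = k.dim ∧ B = Submodule.span ℝ (range fun i => stdField (a i) (b i) (h i)) := by
  have hP := isOpen_projTX hW
  have hPne : (projTX W).Nonempty := hne.image _
  obtain ⟨z₀, hz₀⟩ := hPne
  match k, h with
  | .t, h =>
    refine ⟨Fin 1, inferInstance, ![1], ![0], ![fun _ => 0], stdFamily_affine ?_ ?_ ?_ ?_ ?_, rfl, ?_⟩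
    · simp [contDiffOn_const]
    · simp [Dx_const]
    · simp [Dt_const]
    · simp
    · intro δ h1 _ _
      ext i
      fin_cases i
      simpa using h1
    · rw [range_fin_one]; exact h
  | .u, h =>
    refine ⟨Fin 1, inferInstance, ![0], ![0], ![fun _ => 1], stdFamily_affine ?_ ?_ ?_ ?_ ?_, rfl, ?_⟩
    · simp [contDiffOn_const]
    · simp [Dx_const]
    · simp [Dt_const]
    · simp
    · intro δ _ _ h1
      ext i
      fin_cases i
      simpa using h1 _ hz₀
    · rw [range_fin_one]; exact h
  | .tu, h =>
    refine ⟨Fin 2, inferInstance, ![1, 0], ![0, 0], ![fun _ => 0, fun _ => 1],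
      stdFamily_affine ?_ ?_ ?_ ?_ ?_, rfl, ?_⟩
    · simp [Fin.forall_fin_two, contDiffOn_const]
    · simp [Fin.forall_fin_two, Dx_const]
    · simp [Fin.forall_fin_two, Dt_const]
    · simp [Fin.forall_fin_two]
    · intro δ h1 _ h2
      have h2 := h2 _ hz₀
      simp only [Fin.sum_univ_two] at h1 h2
      ext i
      fin_cases i
      · simpa using h1
      · simpa using h2
    · rw [range_fin_two]; exact h
  | .xu, h =>
    refine ⟨Fin 2, inferInstance, ![0, 0], ![1, 0], ![fun _ => 0, fun _ => 1],
      stdFamily_affine ?_ ?_ ?_ ?_ ?_, rfl, ?_⟩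
    · simp [Fin.forall_fin_two, contDiffOn_const]
    · simp [Fin.forall_fin_two, Dx_const]
    · simp [Fin.forall_fin_two, Dt_const]
    · simp [Fin.forall_fin_two, Dx_const]
    · intro δ _ h1 h2
      have h2 := h2 _ hz₀
      simp only [Fin.sum_univ_two] at h1 h2
      ext i
      fin_cases i
      · simpa using h1
      · simpa using h2
    · rw [range_fin_two]; exact h
  | .uxu, h =>
    refine ⟨Fin 2, inferInstance, ![0, 0], ![0, 0], ![fun _ => 1, fun z => z.2],
      stdFamily_affine ?_ ?_ ?_ ?_ ?_, rfl, ?_⟩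
    · simp [Fin.forall_fin_two, contDiffOn_const, contDiffOn_snd]
    · simp [Fin.forall_fin_two, Dx_const, Dx_snd]
    · simp [Fin.forall_fin_two, Dt_const, Dt_snd]
    · simp [Fin.forall_fin_two]
    · intro δ _ _ h2
      obtain ⟨h3, h4⟩ := affine_indep hP ⟨z₀, hz₀⟩ (α := δ 0) (β := δ 1) fun z hz => by
        simpa [Fin.sum_univ_two] using h2 z hz
      ext i
      fin_cases i
      exacts [h3, h4]
    · rw [range_fin_two]; exact h
  | .txu, h =>
    refine ⟨Fin 3, inferInstance, ![1, 0, 0], ![0, 1, 0], ![fun _ => 0, fun _ => 0, fun _ => 1],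
      stdFamily_affine ?_ ?_ ?_ ?_ ?_, rfl, ?_⟩
    · simp [Fin.forall_fin_succ, contDiffOn_const]
    · simp [Fin.forall_fin_succ, Dx_const]
    · simp [Fin.forall_fin_succ, Dt_const]
    · simp [Fin.forall_fin_succ, Dx_const]
    · intro δ h1 h2 h3
      have h3 := h3 _ hz₀
      simp only [Fin.sum_univ_three] at h1 h2 h3
      ext i
      fin_cases i
      · simpa using h1
      · simpa using h2
      · simpa using h3
    · rw [range_fin_three]; exact h
  | .tuxu, h =>
    refine ⟨Fin 3, inferInstance, ![1, 0, 0], ![0, 0, 0], ![fun _ => 0, fun _ => 1, fun z => z.2],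
      stdFamily_affine ?_ ?_ ?_ ?_ ?_, rfl, ?_⟩
    · simp [Fin.forall_fin_succ, contDiffOn_const, contDiffOn_snd]
    · simp [Fin.forall_fin_succ, Dx_const, Dx_snd]
    · simp [Fin.forall_fin_succ, Dt_const, Dt_snd]
    · simp [Fin.forall_fin_succ]
    · intro δ h1 _ h2
      obtain ⟨h3, h4⟩ := affine_indep hP ⟨z₀, hz₀⟩ (α := δ 1) (β := δ 2) fun z hz => by
        simpa [Fin.sum_univ_three] using h2 z hz
      ext i
      fin_cases i
      · simpa [Fin.sum_univ_three] using h1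
      · exact h3
      · exact h4
    · rw [range_fin_three]; exact h
  | .uxuc, ⟨c, hc, hcx, h⟩ =>
    refine ⟨Fin 3, inferInstance, fun _ => 0, fun _ => 0, ![fun _ => 1, fun z => z.2, c],
      stdFamily_vertical_of_equation hW hc hcx (f := fun _ => 1) contDiffOn_const (by simp) ?_ ?_ ?_,
      rfl, ?_⟩
    · simp [Fin.forall_fin_succ, contDiffOn_const, contDiffOn_snd, hc]
    · simp only [Fin.forall_fin_succ, Matrix.cons_val_zero, Matrix.cons_val_succ, Dt_const, Dt_snd,
        Dx_const, Dx_snd, IsEmpty.forall_iff, and_true]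
      refine ⟨by simp, by simp, fun z hz => ?_⟩
      rw [div_mul_cancel₀ _ (hcx z hz)]
      ring
    · intro δ h2
      obtain ⟨h3, h4, h5⟩ := affine_indep_of_ne_zero hP ⟨z₀, hz₀⟩ (α := δ 0) (β := δ 1) (γ := δ 2)
        hc hcx fun z hz => by simpa [Fin.sum_univ_three] using h2 z hz
      ext i
      fin_cases i
      exacts [h3, h4, h5]
    · rw [range_fin_three]; exact h
  | .tuxuc, ⟨c, hc, hcx, h⟩ =>
    let C : ℝ × ℝ → ℝ := fun z => c z.2
    have hC : ContDiffOn ℝ ∞ C (projTX W) := hc.comp contDiffOn_snd (by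
      rintro _ ⟨p, hp, rfl⟩; exact ⟨p, hp, rfl⟩)
    have hCx : ∀ z ∈ projTX W, Dx (Dx C) z ≠ 0 := by
      intro z hz
      rw [← deriv_deriv_slice hP hC hz]
      obtain ⟨p, hp, rfl⟩ := hz
      exact hcx _ ⟨p, hp, rfl⟩
    have hti : TimeIndep (projTX W) C := fun z _ z' _ e => by simp only [C, e]
    have hCt := hti.Dt_eq_zero hP hC
    have hC1 := contDiffOn_Dx hP hC
    have hC2 := contDiffOn_Dx hP hC1
    have hC3 := contDiffOn_Dx hP hC2
    have ht1 := hti.Dx hP hC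
    have ht2 := ht1.Dx hP hC1
    have ht3 := ht2.Dx hP hC2
    -- With `f = 1` and `c_t = 0` this `g` makes `c` a solution; it is independent of `t`, as the
    -- symmetry `∂_t` requires.
    let g : ℝ × ℝ → ℝ := fun z => -Dx (Dx (Dx C)) z / Dx (Dx C) z
    have hg : ContDiffOn ℝ ∞ g (projTX W) := hC3.neg.div hC2 hCx
    have hgt : TimeIndep (projTX W) g := fun z hz z' hz' e => by
      simp only [g, ht3 z hz z' hz' e, ht2 z hz z' hz' e]
    refine ⟨Fin 4, inferInstance, ![1, 0, 0, 0], fun _ => 0,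
      ![fun _ => 0, fun _ => 1, fun z => z.2, C], ⟨?_, ?_, ⟨fun _ => 1, g, contDiffOn_const, hg,
        by simp, ?_⟩, ?_⟩, rfl, ?_⟩
    · simp [Fin.forall_fin_succ, contDiffOn_const, contDiffOn_snd, hC]
    · have : ∀ i z, z ∈ projTX W → Dt ((![fun _ => 0, fun _ => 1, fun z => z.2, C] :
          Fin 4 → ℝ × ℝ → ℝ) i) z = 0 := by
        simp only [Fin.forall_fin_succ, Matrix.cons_val_zero, Matrix.cons_val_succ, Dt_const, Dt_snd,
          IsEmpty.forall_iff, and_true]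
        exact ⟨fun _ _ => trivial, fun _ _ => trivial, fun _ _ => trivial, hCt⟩
      intro i j z hz
      rw [this i z hz, this j z hz]
      ring
    · intro i z hz
      refine ⟨by simp [Dt_const, Dx_const], by simp [hgt.Dt_eq_zero hP hg z hz], ?_⟩
      revert i
      simp only [Fin.forall_fin_succ, Matrix.cons_val_zero, Matrix.cons_val_succ, Dt_const, Dt_snd,
        Dx_const, Dx_snd, IsEmpty.forall_iff, and_true]
      refine ⟨by simp, by simp, by simp, ?_⟩
      rw [hCt z hz, div_mul_cancel₀ _ (hCx z hz)]
      ring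
    · intro δ h1 _ h2
      obtain ⟨h3, h4, h5⟩ := affine_indep_of_ne_zero hP ⟨z₀, hz₀⟩ (α := δ 1) (β := δ 2) (γ := δ 3)
        hC hCx fun z hz => by simpa [Fin.sum_univ_four] using h2 z hz
      ext i
      fin_cases i
      · simpa [Fin.sum_univ_four] using h1
      exacts [h3, h4, h5]
    · rw [range_fin_four]; exact h
  | .series m, ⟨c, q, hc, hq, hcx, hqx, hind, ⟨f, hf, hf0, hfq⟩, h⟩ =>
    refine ⟨Fin 3 ⊕ Fin (m + 1), inferInstance, fun _ => 0, fun _ => 0,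
      Sum.elim ![fun _ => 1, fun z => z.2, c] q,
      stdFamily_vertical_of_equation hW hc hcx hf hf0 ?_ ?_ ?_, ?_, ?_⟩
    · simp [Fin.forall_fin_succ, contDiffOn_const, contDiffOn_snd, hc, hq]
    · rintro (i | i)
      · revert i
        simp only [Sum.elim_inl, Fin.forall_fin_succ, Matrix.cons_val_zero, Matrix.cons_val_succ,
          Dt_const, Dt_snd, Dx_const, Dx_snd, IsEmpty.forall_iff, and_true]
        refine ⟨by simp, by simp, fun z hz => ?_⟩
        rw [div_mul_cancel₀ _ (hcx z hz)]
        ring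
      · intro z hz
        rw [hfq i z hz, Sum.elim_inr, div_mul_cancel₀ _ (hqx i z hz)]
        ring
    · intro δ h2
      obtain ⟨h3, h4, h5, h6⟩ := hind (δ (.inl 0)) (δ (.inl 1)) (δ (.inl 2)) (fun i => δ (.inr i))
        fun z hz => by
          have := h2 z hz
          rw [Fintype.sum_sum_type, Fin.sum_univ_three] at this
          simpa using this
      ext i
      rcases i with i | i
      · fin_cases i
        exacts [h3, h4, h5]
      · exact congrFun h6 i
    · simp [AlgType.dim]
      ring
    · have e : (range fun i : Fin 3 ⊕ Fin (m + 1) => stdField 0 0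
          ((Sum.elim ![fun _ => 1, fun z => z.2, c] q : Fin 3 ⊕ Fin (m + 1) → ℝ × ℝ → ℝ) i)) =
          {genU, xGenU, coefU c} ∪ range fun i => coefU (q i) := by
        refine (Sum.range_eq _).trans (congrArg₂ (· ∪ ·) ?_ rfl)
        exact range_fin_three _
      rw [e]
      exact h

end CanonicalFamilies

/-! ### Every type occurs -/

section Existence

theorem contDiff_expWave (l : ℝ) : ContDiff ℝ ∞ fun z : ℝ × ℝ => Real.exp (l * z.2 + l ^ 3 * z.1) := by
  fun_prop

theorem Dx_expWave (k l : ℝ) : Dx (fun z => k * Real.exp (l * z.2 + l ^ 3 * z.1)) =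
    fun z => (k * l) * Real.exp (l * z.2 + l ^ 3 * z.1) := by
  funext z
  refine Dx_eq_of_hasDerivAt ((contDiff_const.mul (contDiff_expWave l)).differentiable (by simp) z) ?_
  have h1 : HasDerivAt (fun x : ℝ => l * x + l ^ 3 * z.1) l z.2 := by
    have := ((hasDerivAt_id z.2).const_mul l).add_const (l ^ 3 * z.1)
    rwa [mul_one] at this
  have := (h1.exp).const_mul k
  exact this.congr_deriv (by ring)

theorem Dt_expWave (k l : ℝ) : Dt (fun z => k * Real.exp (l * z.2 + l ^ 3 * z.1)) =
    fun z => (k * l ^ 3) * Real.exp (l * z.2 + l ^ 3 * z.1) := by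
  funext z
  refine Dt_eq_of_hasDerivAt ((contDiff_const.mul (contDiff_expWave l)).differentiable (by simp) z) ?_
  have h1 : HasDerivAt (fun t : ℝ => l * z.2 + l ^ 3 * t) (l ^ 3) z.1 := by
    have := ((hasDerivAt_id z.1).const_mul (l ^ 3)).const_add (l * z.2)
    rwa [mul_one] at this
  have := (h1.exp).const_mul k
  exact this.congr_deriv (by ring)

/-- The functions `t ↦ exp(μ t)` are distinct characters of the additive group `ℝ`, hence
independent by Dedekind's theorem. -/
theorem linearIndependent_exp {n : ℕ} {μ : Fin n → ℝ} (hμ : Function.Injective μ) {δ : Fin n → ℝ}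
    (h : ∀ t : ℝ, ∑ i, δ i * Real.exp (μ i * t) = 0) : δ = 0 := by
  let φ : Fin n → (Multiplicative ℝ →* ℝ) := fun i =>
    { toFun := fun t => Real.exp (μ i * t.toAdd)
      map_one' := by simp
      map_mul' := fun s t => by rw [toAdd_mul, mul_add, Real.exp_add] }
  have hφ : Function.Injective φ := by
    intro i j e
    have := DFunLike.congr_fun e (Multiplicative.ofAdd 1)
    simp only [φ, MonoidHom.coe_mk, OneHom.coe_mk, toAdd_ofAdd, mul_one] at this
    exact hμ (Real.exp_injective this)
  have h1 := (linearIndependent_monoidHom (Multiplicative ℝ) ℝ).comp φ hφ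
  rw [Fintype.linearIndependent_iff] at h1
  refine funext fun i => h1 δ ?_ i
  funext t
  simpa [φ] using h t.toAdd

/-- For a single function, `x²` serves as `c`. For the series, `exp(l x + l³ t)` with `l = 1, …, m +
2` solve `u_t = u_xxx`, so with `f = 1` all the quotients in the compatibility condition vanish. -/
theorem exists_isCanonical (k : AlgType) :
    ∃ (W : Set Pt) (B : Submodule ℝ VField), IsOpen W ∧ W.Nonempty ∧ IsCanonical W B k := by
  have hx1 : Dx (fun z : ℝ × ℝ => z.2 ^ 2) = fun z => 2 * z.2 := by
    funext z
    refine Dx_eq_of_hasDerivAt (by fun_prop) ?_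
    have := hasDerivAt_pow 2 z.2
    simpa using this
  have hx2 : Dx (fun z : ℝ × ℝ => 2 * z.2) = fun _ => 2 := by
    funext z
    refine Dx_eq_of_hasDerivAt (by fun_prop) ?_
    have := (hasDerivAt_id z.2).const_mul 2
    simpa using this
  refine ⟨univ, ?_⟩
  match k with
  | .t => exact ⟨_, isOpen_univ, univ_nonempty, rfl⟩
  | .u => exact ⟨_, isOpen_univ, univ_nonempty, rfl⟩
  | .tu => exact ⟨_, isOpen_univ, univ_nonempty, rfl⟩
  | .xu => exact ⟨_, isOpen_univ, univ_nonempty, rfl⟩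
  | .uxu => exact ⟨_, isOpen_univ, univ_nonempty, rfl⟩
  | .txu => exact ⟨_, isOpen_univ, univ_nonempty, rfl⟩
  | .tuxu => exact ⟨_, isOpen_univ, univ_nonempty, rfl⟩
  | .uxuc =>
    refine ⟨_, isOpen_univ, univ_nonempty, fun z => z.2 ^ 2, by fun_prop, fun z _ => ?_, rfl⟩
    rw [hx1, hx2]
    exact two_ne_zero
  | .tuxuc =>
    refine ⟨_, isOpen_univ, univ_nonempty, fun x => x ^ 2, by fun_prop, fun x _ => ?_, rfl⟩
    have h1 : deriv (fun x : ℝ => x ^ 2) = fun x => 2 * x := by funext x; simp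
    rw [h1]
    simp
  | .series m =>
    let w : ℝ → ℝ × ℝ → ℝ := fun l z => Real.exp (l * z.2 + l ^ 3 * z.1)
    have hw : ∀ l, w l = fun z => 1 * Real.exp (l * z.2 + l ^ 3 * z.1) := fun l => by
      funext z; rw [one_mul]
    have h1 : ∀ l, Dx (Dx (w l)) = fun z => l ^ 2 * w l z := fun l => by
      rw [hw, Dx_expWave, Dx_expWave]
      funext z
      ring
    have h2 : ∀ l, Dx (Dx (Dx (w l))) = fun z => l ^ 3 * w l z := fun l => by
      rw [hw, Dx_expWave, Dx_expWave, Dx_expWave]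
      funext z
      ring
    have h3 : ∀ l, Dt (w l) = fun z => l ^ 3 * w l z := fun l => by
      rw [hw, Dt_expWave]
      funext z
      ring
    have hpos : ∀ l z, w l z ≠ 0 := fun l z => (Real.exp_pos _).ne'
    refine ⟨_, isOpen_univ, univ_nonempty, w 1, fun i => w (i + 2), (contDiff_expWave _).contDiffOn,
      fun i => (contDiff_expWave _).contDiffOn, fun z _ => ?_, fun i z _ => ?_, ?_,
      ⟨fun _ => 1, contDiffOn_const, by simp, fun i z _ => ?_⟩, rfl⟩
    · simp [h1, hpos]
    · have : ((i : ℕ) : ℝ) + 2 ≠ 0 := by positivity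
      simp [h1, hpos, this]
    · intro α β γ δ h0
      have hmem : ∀ z : ℝ × ℝ, z ∈ projTX univ := fun z => ⟨(z.1, z.2, 0), trivial, rfl⟩
      -- On the line `x = 0` the relation involves only the exponentials `exp(j³ t)`, where `j = 0`
      -- stands for the constant `α`. The coefficient `β` is recovered afterwards at the point `(0,
      -- 1)`.
      let μ : Fin (m + 3) → ℝ := fun j => (j : ℝ) ^ 3
      have hμ : Function.Injective μ := by
        intro i j e
        have e' : ((i : ℕ) : ℝ) = (j : ℕ) :=
          (Odd.pow_injective (R := ℝ) (n := 3) (by decide)) e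
        exact Fin.ext (by exact_mod_cast e')
      have h4 := linearIndependent_exp hμ (δ := Fin.cons α (Fin.cons γ δ)) fun t => by
        have := h0 (t, 0) (hmem _)
        rw [Fin.sum_univ_succ, Fin.sum_univ_succ]
        simp only [w, mul_zero, zero_add, add_zero, one_pow, one_mul] at this
        simp only [Fin.cons_zero, Fin.cons_succ, μ, Fin.val_zero, Fin.val_succ, Nat.cast_add,
          Nat.cast_zero, Nat.cast_one, zero_add, one_pow, one_mul, add_assoc, one_add_one_eq_two]
        refine Eq.trans ?_ this
        simp [add_assoc]
      have h5 : α = 0 := by simpa using congrFun h4 0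
      have h6 : γ = 0 := by simpa using congrFun h4 1
      have h7 : δ = 0 := funext fun i => by simpa using congrFun h4 i.succ.succ
      subst h5 h6 h7
      exact ⟨rfl, by simpa using h0 (0, 1) (hmem _), rfl, rfl⟩
    · simp [h2, h3]

end Existence
end EvolEq

namespace EvolEq
open Set Filter Topology

/-! ### Rank as the dimension of the space of values -/

section PointwiseRank

/-- The space of the values at `p` of the elements of `A`. -/
def valuesAt (A : Submodule ℝ VField) (p : Pt) : Submodule ℝ Pt :=
  A.map (LinearMap.proj p : VField →ₗ[ℝ] Pt)

theorem ιMulti_eq_zero_iff {n : ℕ} {v : Fin n → Pt} :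
    ExteriorAlgebra.ιMulti ℝ n v = 0 ↔ ¬ LinearIndependent ℝ v := by
  constructor
  · intro h hv
    have h1 := exteriorPower.ιMulti_family_linearIndependent_field (n := n) hv
    refine h1.ne_zero (powersetCard.ofFinEmbEquiv (RelEmbedding.refl _)) (Subtype.ext ?_)
    rw [exteriorPower.ιMulti_family_apply_coe, ExteriorAlgebra.ιMulti_family,
      Equiv.symm_apply_apply]
    exact h
  · intro hv
    exact AlternatingMap.map_linearDependent _ _ hv

/-- A wedge product vanishes exactly when its factors are dependent, so the wedge condition bounds
the dimension of the space of values at each point. -/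
theorem wedge_vanishing_iff {Ω : Set Pt} {A : Submodule ℝ VField} {r : ℕ} :
    (∀ Q : Fin (r + 1) → VField, (∀ i, Q i ∈ A) →
      ∀ p ∈ Ω, ExteriorAlgebra.ιMulti ℝ (r + 1) (fun i => Q i p) = 0) ↔
    ∀ p ∈ Ω, Module.finrank ℝ (valuesAt A p) ≤ r := by
  constructor
  · intro h p hp
    by_contra! hlt
    obtain ⟨v, hv⟩ := exists_linearIndependent_of_le_finrank (R := ℝ) hlt
    have h1 : ∀ i, ∃ Q ∈ A, Q p = v i := fun i => (v i).2
    choose Q hQ hQv using h1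
    refine ιMulti_eq_zero_iff.1 (h Q hQ p hp) ?_
    have : (fun i => Q i p) = (valuesAt A p).subtype ∘ v := funext hQv
    rw [this]
    exact hv.map' _ (Submodule.ker_subtype _)
  · intro h Q hQ p hp
    rw [ιMulti_eq_zero_iff]
    intro hv
    let v : Fin (r + 1) → valuesAt A p := fun i => ⟨Q i p, Q i, hQ i, rfl⟩
    have hv' : LinearIndependent ℝ v := LinearIndependent.of_comp (valuesAt A p).subtype hv
    have := hv'.fintype_card_le_finrank
    rw [Fintype.card_fin] at this
    have := h p hp
    omega

theorem rankOn_eq_sInf (Ω : Set Pt) (A : Submodule ℝ VField) :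
    rankOn Ω A = sInf {r | 0 < r ∧ ∀ p ∈ Ω, Module.finrank ℝ (valuesAt A p) ≤ r} := by
  rw [rankOn]
  simp only [wedge_vanishing_iff]

theorem rankOn_eq {Ω : Set Pt} {A : Submodule ℝ VField} {r : ℕ} (hr : 0 < r) (hne : Ω.Nonempty)
    (h : ∀ p ∈ Ω, Module.finrank ℝ (valuesAt A p) = r) : rankOn Ω A = r := by
  rw [rankOn_eq_sInf]
  have hmem : r ∈ {r | 0 < r ∧ ∀ p ∈ Ω, Module.finrank ℝ (valuesAt A p) ≤ r} :=
    ⟨hr, fun p hp => (h p hp).le⟩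
  refine le_antisymm (Nat.sInf_le hmem) (le_csInf ⟨r, hmem⟩ fun s hs => ?_)
  obtain ⟨p, hp⟩ := hne
  exact (h p hp).symm.le.trans (hs.2 p hp)

theorem exists_lt_of_lt_rankOn {Ω : Set Pt} {A : Submodule ℝ VField} {r : ℕ} (hr : 0 < r)
    (h : r < rankOn Ω A) : ∃ p ∈ Ω, r < Module.finrank ℝ (valuesAt A p) := by
  by_contra! h0
  rw [rankOn_eq_sInf] at h
  exact absurd (Nat.sInf_le (s := {r | 0 < r ∧ ∀ p ∈ Ω, Module.finrank ℝ (valuesAt A p) ≤ r})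
    ⟨hr, h0⟩) (not_le.2 h)

/-- Lower semicontinuity: independent values of continuous fields stay independent nearby. -/
theorem eventually_le_finrank_valuesAt {Ω : Set Pt} (hΩ : IsOpen Ω) {A : Submodule ℝ VField}
    (hA : ∀ Q ∈ A, ContinuousOn Q Ω) {p : Pt} (hp : p ∈ Ω) {r : ℕ}
    (h : r ≤ Module.finrank ℝ (valuesAt A p)) :
    ∀ᶠ q in 𝓝 p, r ≤ Module.finrank ℝ (valuesAt A q) := by
  obtain ⟨v, hv⟩ := exists_linearIndependent_of_le_finrank (R := ℝ) h
  have h1 : ∀ i, ∃ Q ∈ A, Q p = v i := fun i => (v i).2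
  choose Q hQ hQv using h1
  have h2 : LinearIndependent ℝ fun i => Q i p := by
    have : (fun i => Q i p) = (valuesAt A p).subtype ∘ v := funext hQv
    rw [this]
    exact hv.map' _ (Submodule.ker_subtype _)
  have h3 : ContinuousAt (fun q => fun i => Q i q) p :=
    continuousAt_pi.2 fun i => (hA _ (hQ i)).continuousAt (hΩ.mem_nhds hp)
  filter_upwards [h3.eventually_mem ((isOpen_setOfPred_linearIndependent (𝕜 := ℝ)).mem_nhds h2)] with q hq
  let w : Fin r → valuesAt A q := fun i => ⟨Q i q, Q i, hQ i, rfl⟩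
  have hw : LinearIndependent ℝ w := LinearIndependent.of_comp (valuesAt A q).subtype hq
  simpa using hw.fintype_card_le_finrank

/-- The space of the values of the canonical algebras. -/
def AlgType.values : AlgType → Set Pt
  | .t => {(1, 0, 0)}
  | .u => {(0, 0, 1)}
  | .tu => {(1, 0, 0), (0, 0, 1)}
  | .xu => {(0, 1, 0), (0, 0, 1)}
  | .uxu => {(0, 0, 1)}
  | .txu => {(1, 0, 0), (0, 1, 0), (0, 0, 1)}
  | .tuxu => {(1, 0, 0), (0, 0, 1)}
  | .uxuc => {(0, 0, 1)}
  | .tuxuc => {(1, 0, 0), (0, 0, 1)}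
  | .series _ => {(0, 0, 1)}

theorem finrank_span_values (k : AlgType) : Module.finrank ℝ (Submodule.span ℝ k.values) = k.rank := by
  have h1 : ∀ v : Pt, v ≠ 0 → Module.finrank ℝ (Submodule.span ℝ {v}) = 1 := fun v hv =>
    finrank_span_singleton hv
  have h2 : ∀ v w : Pt, LinearIndependent ℝ ![v, w] →
      Module.finrank ℝ (Submodule.span ℝ {v, w}) = 2 := fun v w h => by
    have := finrank_span_eq_card h
    rwa [range_fin_two] at this
  have htu : LinearIndependent ℝ ![((1, 0, 0) : Pt), (0, 0, 1)] :=
    LinearIndependent.pair_iff.2 fun s t h => by simpa using h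
  have hxu : LinearIndependent ℝ ![((0, 1, 0) : Pt), (0, 0, 1)] :=
    LinearIndependent.pair_iff.2 fun s t h => by simpa using h
  have htxu : LinearIndependent ℝ ![((1, 0, 0) : Pt), (0, 1, 0), (0, 0, 1)] := by
    rw [Fintype.linearIndependent_iff]
    intro g hg
    simp [Fin.sum_univ_three] at hg
    simp [Fin.forall_fin_succ, hg]
  cases k
  case txu =>
    have := finrank_span_eq_card htxu
    rwa [range_fin_three] at this
  case tu => exact h2 _ _ htu
  case xu => exact h2 _ _ hxu
  case tuxu => exact h2 _ _ htu
  case tuxuc => exact h2 _ _ htu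
  all_goals exact h1 _ (by simp)

theorem valuesAt_span {s : Set VField} {D : Set Pt} {p : Pt}
    (h₁ : ∀ g ∈ s, g p ∈ Submodule.span ℝ D) (h₂ : ∀ d ∈ D, ∃ g ∈ s, g p = d) :
    valuesAt (Submodule.span ℝ s) p = Submodule.span ℝ D := by
  rw [valuesAt, Submodule.map_span]
  refine le_antisymm (Submodule.span_le.2 ?_) (Submodule.span_le.2 ?_)
  · rintro _ ⟨g, hg, rfl⟩
    exact h₁ g hg
  · intro d hd
    obtain ⟨g, hg, rfl⟩ := h₂ d hd
    exact Submodule.subset_span ⟨g, hg, rfl⟩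

/-- The values of the generators `c ∂_u` lie on the line already spanned by `∂_u`, so the space of
values depends neither on the point nor on the functions chosen. -/
theorem IsCanonical.valuesAt_eq {W : Set Pt} {B : Submodule ℝ VField} {k : AlgType}
    (h : IsCanonical W B k) (p : Pt) : valuesAt B p = Submodule.span ℝ k.values := by
  have hu : ∀ {D : Set Pt}, ((0, 0, 1) : Pt) ∈ D → ∀ c, coefU c p ∈ Submodule.span ℝ D := by
    intro D hD c
    have e : coefU c p = c (p.1, p.2.1) • ((0, 0, 1) : Pt) := by ext <;> simp [coefU]
    rw [e]
    exact Submodule.smul_mem _ _ (Submodule.subset_span hD)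
  have hs : ∀ {D : Set Pt} {v : Pt}, v ∈ D → v ∈ Submodule.span ℝ D := fun h =>
    Submodule.subset_span h
  match k, h with
  | .t, h =>
    rw [h]
    refine valuesAt_span ?_ ?_
    · rintro g rfl; exact hs rfl
    · rintro d rfl; exact ⟨_, rfl, rfl⟩
  | .u, h =>
    rw [h]
    refine valuesAt_span ?_ ?_
    · rintro g rfl; exact hs rfl
    · rintro d rfl; exact ⟨_, rfl, rfl⟩
  | .tu, h =>
    rw [h]
    refine valuesAt_span ?_ ?_
    · rintro g (rfl | rfl)
      exacts [hs (Or.inl rfl), hs (Or.inr rfl)]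
    · rintro d (rfl | rfl)
      exacts [⟨genT, by simp, rfl⟩, ⟨genU, by simp, rfl⟩]
  | .xu, h =>
    rw [h]
    refine valuesAt_span ?_ ?_
    · rintro g (rfl | rfl)
      exacts [hs (Or.inl rfl), hs (Or.inr rfl)]
    · rintro d (rfl | rfl)
      exacts [⟨genX, by simp, rfl⟩, ⟨genU, by simp, rfl⟩]
  | .uxu, h =>
    rw [h]
    refine valuesAt_span ?_ ?_
    · rintro g (rfl | rfl)
      exacts [hs rfl, hu (mem_singleton _) _]
    · rintro d rfl
      exact ⟨genU, by simp, rfl⟩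
  | .txu, h =>
    rw [h]
    refine valuesAt_span ?_ ?_
    · rintro g (rfl | rfl | rfl)
      exacts [hs (Or.inl rfl), hs (Or.inr (Or.inl rfl)), hs (Or.inr (Or.inr rfl))]
    · rintro d (rfl | rfl | rfl)
      exacts [⟨genT, by simp, rfl⟩, ⟨genX, by simp, rfl⟩, ⟨genU, by simp, rfl⟩]
  | .tuxu, h =>
    rw [h]
    refine valuesAt_span ?_ ?_
    · rintro g (rfl | rfl | rfl)
      exacts [hs (Or.inl rfl), hs (Or.inr rfl), hu (Or.inr rfl) _]
    · rintro d (rfl | rfl)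
      exacts [⟨genT, by simp, rfl⟩, ⟨genU, by simp, rfl⟩]
  | .uxuc, ⟨c, _, _, h⟩ =>
    rw [h]
    refine valuesAt_span ?_ ?_
    · rintro g (rfl | rfl | rfl)
      exacts [hs rfl, hu (mem_singleton _) _, hu (mem_singleton _) _]
    · rintro d rfl
      exact ⟨genU, by simp, rfl⟩
  | .tuxuc, ⟨c, _, _, h⟩ =>
    rw [h]
    refine valuesAt_span ?_ ?_
    · rintro g (rfl | rfl | rfl | rfl)
      exacts [hs (Or.inl rfl), hs (Or.inr rfl), hu (Or.inr rfl) _, hu (Or.inr rfl) _]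
    · rintro d (rfl | rfl)
      exacts [⟨genT, by simp, rfl⟩, ⟨genU, by simp, rfl⟩]
  | .series m, ⟨c, q, _, _, _, _, _, _, h⟩ =>
    rw [h]
    refine valuesAt_span ?_ ?_
    · rintro g ((rfl | rfl | rfl) | ⟨i, rfl⟩)
      exacts [hs rfl, hu (mem_singleton _) _, hu (mem_singleton _) _, hu (mem_singleton _) _]
    · rintro d rfl
      exact ⟨genU, by simp, rfl⟩

theorem AlgType.rank_pos (k : AlgType) : 0 < k.rank := by
  cases k <;> simp [AlgType.rank]

theorem IsCanonical.properties {k : AlgType} {W : Set Pt} {B : Submodule ℝ VField} (hW : IsOpen W)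
    (hne : W.Nonempty) (h : IsCanonical W B k) :
    IsAbelianOn W B ∧ IsAdmissible W B ∧ dimOn W B = k.dim ∧ rankOn W B = k.rank := by
  obtain ⟨ι, _, a, b, η, H, hcard, rfl⟩ := h.exists_stdFamily hW hne
  refine ⟨H.isAbelianOn hW, H.isAdmissible hW, (H.dimOn_eq hne).trans hcard,
    rankOn_eq k.rank_pos hne fun p _ => ?_⟩
  rw [h.valuesAt_eq p, finrank_span_values]

end PointwiseRank

/-! ### Invariants of equivalence and the rank bounds -/

section Invariance

variable {V W : Set Pt} {A B : Submodule ℝ VField}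

/-- The types of algebras that contain a field with nonzero `∂_t`-component. -/
def AlgType.hasTime : AlgType → Bool
  | .t => true
  | .tu => true
  | .txu => true
  | .tuxu => true
  | .tuxuc => true
  | _ => false

theorem IsCanonical.hasTime_iff {k : AlgType} (h : IsCanonical W B k) (p : Pt) :
    k.hasTime = true ↔ ∃ v ∈ valuesAt B p, v.1 ≠ 0 := by
  rw [h.valuesAt_eq p]
  constructor
  · intro hk
    refine ⟨(1, 0, 0), Submodule.subset_span ?_, one_ne_zero⟩
    cases k <;> simp_all [AlgType.hasTime, AlgType.values]
  · rintro ⟨v, hv, hv0⟩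
    by_contra hk
    refine hv0 ?_
    have : Submodule.span ℝ k.values ≤ LinearMap.ker (LinearMap.fst ℝ ℝ (ℝ × ℝ)) := by
      rw [Submodule.span_le]
      intro w hw
      cases k <;> simp_all [AlgType.hasTime, AlgType.values]
      all_goals rcases hw with rfl | rfl <;> rfl
    exact this hv

/-- Dimension and rank leave only two ambiguities, `⟨∂_t⟩` against `⟨∂_u⟩` and `⟨∂_t, ∂_u⟩` against
`⟨∂_x, ∂_u⟩`; the presence of `∂_t` resolves both. -/
theorem AlgType.eq_of_invariants {k k' : AlgType} (h₁ : k.dim = k'.dim) (h₂ : k.rank = k'.rank)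
    (h₃ : k.hasTime = k'.hasTime) : k = k' := by
  cases k <;> cases k' <;> simp_all [AlgType.dim, AlgType.rank, AlgType.hasTime]

theorem Equivalent.exists_data (h : Equivalent V A W B) (hV : IsOpen V) (hW : IsOpen W) :
    ∃ Φ Ψ : Pt → Pt, IsDiffeo V W Φ Ψ ∧ (∃ T : ℝ → ℝ, ∀ p ∈ V, (Φ p).1 = T p.1) ∧
      AgreeOn W (A.map (pushField Φ Ψ)) B := by
  obtain ⟨Φ, Ψ, h1, h2, h3, h4, h5, h6, hT, -, h7, h8⟩ := h
  have hd : IsDiffeo V W Φ Ψ := ⟨hV, hW, h1, h2, h3, h4, h5, h6⟩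
  have key : ∀ Q R : VField, (∀ p ∈ V, fderiv ℝ Φ p (Q p) = R (Φ p)) →
      EqOn (pushField Φ Ψ Q) R W := fun Q R hQR w hw => by
    rw [pushField_apply, hQR _ (h2 hw), h4 hw]
  refine ⟨Φ, Ψ, hd, hT, ?_, fun R hR => ?_⟩
  · rintro _ ⟨Q, hQ, rfl⟩
    obtain ⟨R, hR, e⟩ := h7 Q hQ
    exact ⟨R, hR, key Q R e⟩
  · obtain ⟨Q, hQ, e⟩ := h8 R hR
    exact ⟨_, Submodule.mem_map_of_mem hQ, key Q R e⟩

theorem AgreeOn.restrictTo_eq (h : AgreeOn W A B) : restrictTo W A = restrictTo W B := by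
  refine le_antisymm ?_ ?_
  · rintro _ ⟨Q, hQ, rfl⟩
    obtain ⟨R, hR, e⟩ := h.1 Q hQ
    exact ⟨R, hR, funext fun w => (e w.2).symm⟩
  · rintro _ ⟨R, hR, rfl⟩
    obtain ⟨Q, hQ, e⟩ := h.2 R hR
    exact ⟨Q, hQ, funext fun w => e w.2⟩

theorem AgreeOn.valuesAt_eq (h : AgreeOn W A B) {w : Pt} (hw : w ∈ W) :
    valuesAt A w = valuesAt B w := by
  refine le_antisymm ?_ ?_
  · rintro _ ⟨Q, hQ, rfl⟩
    obtain ⟨R, hR, e⟩ := h.1 Q hQ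
    exact ⟨R, hR, (e hw).symm⟩
  · rintro _ ⟨R, hR, rfl⟩
    obtain ⟨Q, hQ, e⟩ := h.2 R hR
    exact ⟨Q, hQ, e hw⟩

theorem Equivalent.dimOn_eq (h : Equivalent V A W B) (hV : IsOpen V) (hW : IsOpen W) :
    dimOn V A = dimOn W B := by
  obtain ⟨Φ, Ψ, hd, -, hag⟩ := h.exists_data hV hW
  let L : (V → Pt) →ₗ[ℝ] (W → Pt) :=
    { toFun := fun f w => fderiv ℝ Φ (Ψ w) (f ⟨Ψ w, hd.mapsTo_inv w.2⟩)
      map_add' := fun f g => by ext1 w; simp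
      map_smul' := fun c f => by ext1 w; simp }
  have hL : Function.Injective L := by
    rw [injective_iff_map_eq_zero]
    intro f hf
    funext p
    have h1 : fderiv ℝ Φ (Ψ (Φ p)) (f ⟨Ψ (Φ p), hd.mapsTo_inv (hd.mapsTo p.2)⟩) = 0 :=
      congrFun hf ⟨Φ p, hd.mapsTo p.2⟩
    simp only [hd.left_inv p.2] at h1
    have h2 := hd.fderiv_inv_comp p.2 (f p)
    rw [h1, map_zero] at h2
    exact h2.symm
  have h1 : restrictTo W (A.map (pushField Φ Ψ)) = (restrictTo V A).map L := by
    rw [restrictTo, restrictTo, ← Submodule.map_comp, ← Submodule.map_comp]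
    rfl
  rw [dimOn, dimOn, ← hag.restrictTo_eq, h1]
  exact (LinearEquiv.finrank_eq (Submodule.equivMapOfInjective L hL _))

/-- `L` is the derivative of the transformation. It multiplies the `∂_t`-component by `T'`, which is
nonzero because the derivative is surjective. -/
theorem Equivalent.exists_valuesAt_map (h : Equivalent V A W B) (hV : IsOpen V) (hW : IsOpen W)
    {p : Pt} (hp : p ∈ V) : ∃ w ∈ W, ∃ L : Pt →ₗ[ℝ] Pt, Function.Injective L ∧
      valuesAt B w = (valuesAt A p).map L ∧ ∀ v, (L v).1 ≠ 0 ↔ v.1 ≠ 0 := by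
  obtain ⟨Φ, Ψ, hd, ⟨T, hT⟩, hag⟩ := h.exists_data hV hW
  refine ⟨Φ p, hd.mapsTo hp, (fderiv ℝ Φ p).toLinearMap, ?_, ?_, ?_⟩
  · intro v w e
    rw [← hd.fderiv_inv_comp hp v, ← hd.fderiv_inv_comp hp w]
    exact congrArg _ e
  · rw [← hag.valuesAt_eq (hd.mapsTo hp)]
    refine le_antisymm ?_ ?_
    · rintro _ ⟨_, ⟨Q, hQ, rfl⟩, rfl⟩
      refine ⟨Q p, ⟨Q, hQ, rfl⟩, ?_⟩
      change fderiv ℝ Φ p (Q p) = pushField Φ Ψ Q (Φ p)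
      rw [pushField_apply, hd.left_inv hp]
    · rintro _ ⟨_, ⟨Q, hQ, rfl⟩, rfl⟩
      refine ⟨_, Submodule.mem_map_of_mem hQ, ?_⟩
      change pushField Φ Ψ Q (Φ p) = fderiv ℝ Φ p (Q p)
      rw [pushField_apply, hd.left_inv hp]
  · obtain ⟨T', -, hT'⟩ := exists_hasDerivAt_time hd.1 hd.smooth hT hp
    have hT0 : T' ≠ 0 := by
      rintro rfl
      have h1 : fderiv ℝ Φ p (fderiv ℝ Ψ (Φ p) (1, 0, 0)) = (1, 0, 0) := by
        have := hd.fderiv_comp_inv (hd.mapsTo hp) (1, 0, 0)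
        rwa [hd.left_inv hp] at this
      have h2 := hT' (fderiv ℝ Ψ (Φ p) (1, 0, 0))
      rw [h1, zero_mul] at h2
      exact one_ne_zero h2
    intro v
    change (fderiv ℝ Φ p v).1 ≠ 0 ↔ _
    rw [hT' v, mul_ne_zero_iff]
    exact ⟨fun h => h.2, fun h => ⟨hT0, h⟩⟩

theorem Equivalent.finrank_valuesAt (h : Equivalent V A W B) (hV : IsOpen V) (hW : IsOpen W)
    {p : Pt} (hp : p ∈ V) : ∃ w ∈ W,
      Module.finrank ℝ (valuesAt A p) = Module.finrank ℝ (valuesAt B w) := by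
  obtain ⟨w, hw, L, hL, e, -⟩ := h.exists_valuesAt_map hV hW hp
  refine ⟨w, hw, ?_⟩
  rw [e]
  exact LinearEquiv.finrank_eq (Submodule.equivMapOfInjective L hL _)

theorem IsCanonical.type_eq_of_equivalent {k k' : AlgType} {W W' : Set Pt}
    {B B' : Submodule ℝ VField} (hW : IsOpen W) (hne : W.Nonempty) (hW' : IsOpen W')
    (hne' : W'.Nonempty) (h : IsCanonical W B k) (h' : IsCanonical W' B' k')
    (he : Equivalent W B W' B') : k = k' := by
  obtain ⟨p, hp⟩ := hne
  obtain ⟨w, hw, L, hL, e, ht⟩ := he.exists_valuesAt_map hW hW' hp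
  refine AlgType.eq_of_invariants ?_ ?_ ?_
  · rw [← (h.properties hW ⟨p, hp⟩).2.2.1, ← (h'.properties hW' hne').2.2.1]
    exact he.dimOn_eq hW hW'
  · rw [← finrank_span_values, ← finrank_span_values, ← h.valuesAt_eq p, ← h'.valuesAt_eq w, e]
    exact LinearEquiv.finrank_eq (Submodule.equivMapOfInjective L hL _)
  · rw [Bool.eq_iff_iff, h.hasTime_iff p, h'.hasTime_iff w, e]
    constructor
    · rintro ⟨v, hv, hv0⟩
      exact ⟨L v, ⟨v, hv, rfl⟩, (ht v).2 hv0⟩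
    · rintro ⟨_, ⟨v, hv, rfl⟩, hv0⟩
      exact ⟨v, hv, (ht v).1 hv0⟩

theorem AlgType.dim_eq_of_rank_eq_three {k : AlgType} (h : k.rank = 3) : k.dim = 3 := by
  cases k <;> simp_all [AlgType.rank, AlgType.dim]

theorem AlgType.dim_le_of_rank_eq_two {k : AlgType} (h : k.rank = 2) : k.dim ≤ 4 := by
  cases k <;> simp_all [AlgType.rank, AlgType.dim]

/-- If the rank is `r ≥ 2`, then somewhere the algebra is equivalent to a canonical one of
rank `r`. -/
theorem exists_type_of_rankOn {Ω : Set Pt} {A : Submodule ℝ VField} (hΩ : IsOpen Ω)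
    (hfin : FiniteDimensional ℝ (restrictTo Ω A)) (hab : IsAbelianOn Ω A)
    (hadm : IsAdmissible Ω A) {r : ℕ} (hr : 2 ≤ r) (hrank : rankOn Ω A = r) :
    ∃ V : Set Pt, IsOpen V ∧ V.Nonempty ∧ V ⊆ Ω ∧ ∃ k : AlgType, k.rank = r ∧ dimOn V A = k.dim := by
  -- `r - 1` is positive, so it fails as a bound for the rank only through some point `p` where the
  -- values span dimension at least `r`. This would break down for `r = 1`, since the zero algebra
  -- also has rank `1`. By semicontinuity the dimension is exactly `r` near `p`, and a normal form
  -- found there has rank `r`.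
  obtain ⟨p, hp, hpr⟩ := exists_lt_of_lt_rankOn (r := r - 1) (by omega) (by rw [hrank]; omega :
    r - 1 < rankOn Ω A)
  have hev := eventually_le_finrank_valuesAt hΩ (fun Q hQ => (hadm.1 Q hQ).1.continuousOn) hp
    (by omega : r ≤ Module.finrank ℝ (valuesAt A p))
  obtain ⟨U, hU, hUo, hpU⟩ := mem_nhds_iff.1 (inter_mem hev (hΩ.mem_nhds hp))
  have hUΩ : U ⊆ Ω := fun q hq => (hU hq).2
  have hle : ∀ q ∈ Ω, Module.finrank ℝ (valuesAt A q) ≤ r := by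
    have h1 : (sInf {s | 0 < s ∧ ∀ p ∈ Ω, Module.finrank ℝ (valuesAt A p) ≤ s}) = r := by
      rw [← rankOn_eq_sInf, hrank]
    have h2 := Nat.sInf_mem (s := {s | 0 < s ∧ ∀ p ∈ Ω, Module.finrank ℝ (valuesAt A p) ≤ s})
      (Nat.nonempty_of_pos_sInf (by omega))
    rw [h1] at h2
    exact h2.2
  rcases exists_hasNormalForm hUo ⟨p, hpU⟩ (finiteDimensional_restrictTo_mono hUΩ hfin)
      (fun Q hQ R hR p hp => hab Q hQ R hR p (hUΩ hp)) (hadm.restrict hUo hUΩ le_rfl) with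
      ⟨V, hV, hVo, ⟨q, hq⟩, h0⟩ | ⟨V, hV, hVo, ⟨q, hq⟩, k, W, B, hW, hB, he⟩
  · exfalso
    have h1 : r ≤ Module.finrank ℝ (valuesAt A q) := (hU (hV hq)).1
    have h2 : valuesAt A q = ⊥ := by
      rw [eq_bot_iff]
      rintro _ ⟨Q, hQ, rfl⟩
      exact h0 Q hQ q hq
    rw [h2, finrank_bot] at h1
    omega
  · refine ⟨V, hVo, ⟨q, hq⟩, hV.trans hUΩ, k, ?_, ?_⟩
    · obtain ⟨w, hw, e⟩ := he.finrank_valuesAt hVo hW hq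
      rw [hB.valuesAt_eq w, finrank_span_values] at e
      rw [← e]
      exact le_antisymm (hle q (hUΩ (hV hq))) (hU (hV hq)).1
    · obtain ⟨w, hw, -⟩ := he.finrank_valuesAt hVo hW hq
      rw [he.dimOn_eq hVo hW, (hB.properties hW ⟨w, hw⟩).2.2.1]

end Invariance
end EvolEq

theorem theorem4p1 :
    -- completeness of the list, near generic points
    (∀ (Ω : Set EvolEq.Pt) (A : Submodule ℝ EvolEq.VField), IsOpen Ω →
      FiniteDimensional ℝ (EvolEq.restrictTo Ω A) →
      EvolEq.IsAbelianOn Ω A → EvolEq.IsAdmissible Ω A →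
      ∃ Ω' : Set EvolEq.Pt, IsOpen Ω' ∧ Ω' ⊆ Ω ∧ Ω ⊆ closure Ω' ∧
        ∀ p ∈ Ω', ∃ V : Set EvolEq.Pt, IsOpen V ∧ p ∈ V ∧ V ⊆ Ω ∧
          ((∀ Q ∈ A, ∀ q ∈ V, Q q = 0) ∨
            ∃ (k : EvolEq.AlgType) (W : Set EvolEq.Pt) (B : Submodule ℝ EvolEq.VField),
              IsOpen W ∧ EvolEq.IsCanonical W B k ∧ EvolEq.Equivalent V A W B)) ∧
    -- the algebras of the list are abelian and admissible, of the stated dimension and rank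
    (∀ (k : EvolEq.AlgType) (W : Set EvolEq.Pt) (B : Submodule ℝ EvolEq.VField),
      IsOpen W → W.Nonempty → EvolEq.IsCanonical W B k →
      EvolEq.IsAbelianOn W B ∧ EvolEq.IsAdmissible W B ∧
        EvolEq.dimOn W B = k.dim ∧ EvolEq.rankOn W B = k.rank) ∧
    -- every entry of the list occurs
    (∀ k : EvolEq.AlgType, ∃ (W : Set EvolEq.Pt) (B : Submodule ℝ EvolEq.VField),
      IsOpen W ∧ W.Nonempty ∧ EvolEq.IsCanonical W B k) ∧
    -- different entries of the list are inequivalent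
    (∀ (k k' : EvolEq.AlgType) (W W' : Set EvolEq.Pt) (B B' : Submodule ℝ EvolEq.VField),
      k ≠ k' → IsOpen W → W.Nonempty → IsOpen W' → W'.Nonempty →
      EvolEq.IsCanonical W B k → EvolEq.IsCanonical W' B' k' →
      ¬ EvolEq.Equivalent W B W' B') ∧
    -- no rank 3 in dimension at least 4, no rank 2 in dimension at least 5
    (∀ (Ω : Set EvolEq.Pt) (A : Submodule ℝ EvolEq.VField), IsOpen Ω →
      FiniteDimensional ℝ (EvolEq.restrictTo Ω A) →
      EvolEq.IsAbelianOn Ω A → EvolEq.IsAdmissible Ω A →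
      ¬ (EvolEq.rankOn Ω A = 3 ∧
          ∀ V : Set EvolEq.Pt, IsOpen V → V.Nonempty → V ⊆ Ω → 4 ≤ EvolEq.dimOn V A) ∧
      ¬ (EvolEq.rankOn Ω A = 2 ∧
          ∀ V : Set EvolEq.Pt, IsOpen V → V.Nonempty → V ⊆ Ω → 5 ≤ EvolEq.dimOn V A)) := by
  refine ⟨fun Ω A hΩ hfin hab hadm => EvolEq.exists_dense_normal_forms hΩ hfin hab hadm,
    fun k W B hW hne h => h.properties hW hne, EvolEq.exists_isCanonical,
    fun k k' W W' B B' hk hW hne hW' hne' h h' he =>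
      hk (h.type_eq_of_equivalent hW hne hW' hne' h' he), fun Ω A hΩ hfin hab hadm => ⟨?_, ?_⟩⟩
  · rintro ⟨hrank, hdim⟩
    obtain ⟨V, hV, hne, hVΩ, k, hk, hd⟩ :=
      EvolEq.exists_type_of_rankOn hΩ hfin hab hadm (by norm_num) hrank
    have := hdim V hV hne hVΩ
    rw [hd, EvolEq.AlgType.dim_eq_of_rank_eq_three hk] at this
    omega
  · rintro ⟨hrank, hdim⟩
    obtain ⟨V, hV, hne, hVΩ, k, hk, hd⟩ :=
      EvolEq.exists_type_of_rankOn hΩ hfin hab hadm le_rfl hrank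
    have := hdim V hV hne hVΩ
    have := EvolEq.AlgType.dim_le_of_rank_eq_two hk
    omega
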